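/- **Theorem (Quasi-Hamiltonian reduction).** Manifolds are smooth, finite-dimensional, Hausdorff and second countable. Let $\mathfrak d$ be a quadratic Lie algebra, i.e. a finite-dimensional real Lie algebra with a non-degenerate invariant symmetric bilinear form, acting on a manifold $N$ by vector fields $\rho(\xi)$ with coisotropic stabilizers, so that $\mathfrak d\times N$ is an action Courant algebroid, with anchor $\rho$ and bracket $[\xi_1,\xi_2]+\mathcal L_{\rho(\xi_1)}\xi_2-\mathcal L_{\rho(\xi_2)}\xi_1+\rho^*\langle d\xi_1,\xi_2\rangle$ on $C^\infty(N,\mathfrak d)$. Let $\mathfrak h=\mathfrak h^\perp\subseteq\mathfrak d$ be a Lagrangian subalgebra. For a manifold $M$ let $\mathbb TM=TM\oplus T^*M$ be the standard Courant algebroid, and let $\overline{\mathbb TM}$ be the same with the metric negated. A *morphism of Manin pairs* $R:(\mathbb T,T)M\dashrightarrow(\mathfrak d,\mathfrak h)\times N$ over a smooth map $\mu:M\to N$ is a Dirac structure $R\subseteq(\mathfrak d\times N)\times\overline{\mathbb TM}$ with support on the graph $\operatorname{gr}(\mu)$ (a Lagrangian subbundle over $\operatorname{gr}(\mu)$ such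 that the Courant bracket of any two sections of the ambient Courant algebroid that restrict to sections of $R$ again restricts to a section of $R$), such that $(\xi;X)\in R$ with $X\in TM$ implies $\xi\in\mathfrak h$, and $(0;X)\in R$ with $X\in TM$ implies $X=0$. Then every $\xi\in\mathfrak h$ acts on $M$ by the unique vector field $\rho_R(\xi)$ with $(\xi;\rho_R(\xi))\in R$. Let $R$ be such a morphism and let $(\mathfrak c,S)$ be reductive data for it: $\mathfrak c\subseteq\mathfrak d$ is a coisotropic subalgebra ($\mathfrak c^\perp\subseteq\mathfrak c$) and $i_N:S\hookrightarrow N$ is an embedded submanifold to which the vector fields $\rho(\xi)$, $\xi\in\mathfrak c$, are tangent, such that 1. the $\mathfrak c^\perp$-orbits in $S$ form a regular foliation, with quotient $q_N:S\to N_{\mathfrak c,S}$ (a foliation is regular if its leaf space carries the structure of a smooth manifold for which the quotient map is a surjective submersion); 2. $\operatorname{gr}(\mu)$ intersects $S\times M$ cleanly, i.e. $i_M:\mu^{-1}(S)\hookrightarrow M$ is an embedded submanifold with $T\mu^{-1}(S)=(d\mu)^{-1}(TS)$, and the $\mathfrak h\cap\mathfrak c^\perp$-orbits in $\mu^{-1}(S)$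 form a regular foliation, with quotient $q_M:\mu^{-1}(S)\to M_{\mathfrak c,S}=\mu^{-1}(S)/(\mathfrak h\cap\mathfrak c^\perp)$. Put $\mathfrak d_{\mathfrak c}=\mathfrak c/\mathfrak c^\perp$ with the induced metric, and let $\mathfrak h_{\mathfrak c}=(\mathfrak h\cap\mathfrak c)/(\mathfrak h\cap\mathfrak c^\perp)$, i.e. the image of $\mathfrak h\cap\mathfrak c$ in $\mathfrak d_{\mathfrak c}$. Let $R_{\mathfrak c}:\mathfrak d\dashrightarrow\mathfrak d_{\mathfrak c}$ be the relation $\xi\sim\xi+\mathfrak c^\perp$ ($\xi\in\mathfrak c$), and for a smooth map $f$ let $R_f$ be the relation $X+f^*\beta\sim f_*X+\beta$ between generalized tangent bundles. Let $$R_1=R_{q_M}\circ R_{i_M}^\top,\qquad R_2=R_{\mathfrak c}\times\bigl(\operatorname{gr}(q_N)\circ\operatorname{gr}(i_N)^\top\bigr),\qquad R_{\mathfrak c,S}=R_2\circ R\circ R_1^\top.$$ Then $\mathfrak h_{\mathfrak c}\subseteq\mathfrak d_{\mathfrak c}$ is a Lagrangian subalgebra; the action of $\mathfrak c$ on $S$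 descends to an action of $\mathfrak d_{\mathfrak c}$ on $N_{\mathfrak c,S}$ with coisotropic stabilizers; $\mu$ descends to a smooth map $\tilde\mu:M_{\mathfrak c,S}\to N_{\mathfrak c,S}$; and $$R_{\mathfrak c,S}:(\mathbb T,T)M_{\mathfrak c,S}\dashrightarrow(\mathfrak d_{\mathfrak c},\mathfrak h_{\mathfrak c})\times N_{\mathfrak c,S}$$ is a morphism of Manin pairs over $\tilde\mu$. If moreover $\mathfrak c$ is Lagrangian, then $\mathfrak d_{\mathfrak c}=0$ and $R_{\mathfrak c,S}$ is the graph $\{\pi^\sharp\gamma+\gamma\}$ of a Poisson structure $\pi$ on $M_{\mathfrak c,S}$, i.e. $Z+\gamma\in\mathbb T_xM_{\mathfrak c,S}$ is related to $(0,n)$ if and only if $n=\tilde\mu(x)$ and $Z=\pi^\sharp\gamma$. -/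

import Mathlib

open scoped Manifold ContDiff

/-! ## Quadratic Lie algebras and coisotropic reduction -/

/-- An invariant metric on a real Lie algebra: a non-degenerate symmetric bilinear form `form` with
`form [x, y] z = - form y [x, z]`. -/
structure InvariantMetric (𝔡 : Type*) [LieRing 𝔡] [LieAlgebra ℝ 𝔡] where
  form : LinearMap.BilinForm ℝ 𝔡
  symm : form.IsSymm
  nondeg : form.Nondegenerate
  invariant : form.lieInvariant 𝔡

namespace InvariantMetric

section

variable {𝔡 : Type*} [LieRing 𝔡] [LieAlgebra ℝ 𝔡] (K : InvariantMetric 𝔡)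

/-- The orthogonal complement `Vᗮ` of a subspace with respect to the metric. -/
def perp (V : Submodule ℝ 𝔡) : Submodule ℝ 𝔡 := K.form.orthogonal V

/-- `V` is coisotropic: `Vᗮ ⊆ V`. -/
def IsCoisotropic (V : Submodule ℝ 𝔡) : Prop := K.perp V ≤ V

/-- `V` is Lagrangian: `Vᗮ = V`. -/
def IsLagrangian (V : Submodule ℝ 𝔡) : Prop := K.perp V = V

lemma mem_perp {V : Submodule ℝ 𝔡} {x : 𝔡} : x ∈ K.perp V ↔ ∀ y ∈ V, K.form y x = 0 :=
  Iff.rfl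

variable (𝔠 : LieSubalgebra ℝ 𝔡)

/-- The elements of `𝔠` lying in `𝔠ᗮ`; an ideal of `𝔠`, which is all of `𝔠ᗮ` when `𝔠` is
coisotropic. -/
def perpIdeal : LieIdeal ℝ 𝔠 where
  toSubmodule := (K.perp 𝔠.toSubmodule).comap 𝔠.toSubmodule.subtype
  lie_mem := by
    intro x m hm y hy
    have h := K.invariant (x : 𝔡) y (m : 𝔡)
    have h2 : K.form ⁅(x : 𝔡), y⁆ (m : 𝔡) = 0 := hm _ (𝔠.lie_mem x.2 hy)
    have h3 : K.form y ⁅(x : 𝔡), (m : 𝔡)⁆ = 0 := by linarith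
    exact h3

/-- The reduced Lie algebra `𝔡_𝔠 = 𝔠 / 𝔠ᗮ`. -/
abbrev Reduced : Type _ := 𝔠 ⧸ K.perpIdeal 𝔠

/-- The quotient map `𝔠 → 𝔡_𝔠 = 𝔠 / 𝔠ᗮ`. -/
def toReduced : 𝔠 →ₗ[ℝ] K.Reduced 𝔠 := (K.perpIdeal 𝔠).toSubmodule.mkQ

lemma toReduced_surjective : Function.Surjective (K.toReduced 𝔠) :=
  (K.perpIdeal 𝔠).toSubmodule.mkQ_surjective

lemma toReduced_lie (x y : 𝔠) :
    K.toReduced 𝔠 ⁅x, y⁆ = ⁅K.toReduced 𝔠 x, K.toReduced 𝔠 y⁆ := rfl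

lemma toReduced_eq_zero {x : 𝔠} : K.toReduced 𝔠 x = 0 ↔ (x : 𝔡) ∈ K.perp 𝔠.toSubmodule :=
  Submodule.Quotient.mk_eq_zero (K.perpIdeal 𝔠).toSubmodule

/-- The bilinear form on `𝔠 / 𝔠ᗮ` induced by the metric of `𝔡`. -/
def reducedForm : LinearMap.BilinForm ℝ (K.Reduced 𝔠) :=
  (K.perpIdeal 𝔠).toSubmodule.liftQ
    { toFun := fun x => (K.perpIdeal 𝔠).toSubmodule.liftQ
        ((K.form (x : 𝔡)).comp 𝔠.toSubmodule.subtype)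
        (fun m hm => (hm (x : 𝔡) x.2 : K.form (x : 𝔡) (m : 𝔡) = 0))
      map_add' := by
        intro x y
        refine LinearMap.ext fun z => ?_
        obtain ⟨z, rfl⟩ := K.toReduced_surjective 𝔠 z
        exact LinearMap.map_add₂ K.form (x : 𝔡) (y : 𝔡) (z : 𝔡)
      map_smul' := by
        intro r x
        refine LinearMap.ext fun z => ?_
        obtain ⟨z, rfl⟩ := K.toReduced_surjective 𝔠 z
        exact LinearMap.map_smul₂ K.form r (x : 𝔡) (z : 𝔡) }
    (by
      intro m hm
      refine LinearMap.ext fun z => ?_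
      obtain ⟨z, rfl⟩ := K.toReduced_surjective 𝔠 z
      have h : K.form (z : 𝔡) (m : 𝔡) = 0 := hm (z : 𝔡) z.2
      have h2 : K.form (m : 𝔡) (z : 𝔡) = 0 := (K.symm.eq (m : 𝔡) (z : 𝔡)).trans h
      exact h2)

@[simp] lemma reducedForm_toReduced (x y : 𝔠) :
    K.reducedForm 𝔠 (K.toReduced 𝔠 x) (K.toReduced 𝔠 y) = K.form (x : 𝔡) (y : 𝔡) := rfl

/-- The metric of `𝔡` descends to an invariant metric on `𝔡_𝔠 = 𝔠 / 𝔠ᗮ`. -/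
def reduce : InvariantMetric (K.Reduced 𝔠) where
  form := K.reducedForm 𝔠
  symm := by
    refine ⟨fun x y => ?_⟩
    obtain ⟨x, rfl⟩ := K.toReduced_surjective 𝔠 x
    obtain ⟨y, rfl⟩ := K.toReduced_surjective 𝔠 y
    simpa using K.symm.eq (x : 𝔡) (y : 𝔡)
  nondeg := by
    constructor
    · intro x hx
      obtain ⟨x, rfl⟩ := K.toReduced_surjective 𝔠 x
      rw [toReduced_eq_zero]
      intro y hy
      have h := hx (K.toReduced 𝔠 ⟨y, hy⟩)
      rw [reducedForm_toReduced] at h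
      exact (K.symm.eq y (x : 𝔡)).trans h
    · intro y hy
      obtain ⟨y, rfl⟩ := K.toReduced_surjective 𝔠 y
      rw [toReduced_eq_zero]
      intro x hx
      have h := hy (K.toReduced 𝔠 ⟨x, hx⟩)
      rwa [reducedForm_toReduced] at h
  invariant := by
    intro x y z
    obtain ⟨x, rfl⟩ := K.toReduced_surjective 𝔠 x
    obtain ⟨y, rfl⟩ := K.toReduced_surjective 𝔠 y
    obtain ⟨z, rfl⟩ := K.toReduced_surjective 𝔠 z
    rw [← toReduced_lie, ← toReduced_lie, reducedForm_toReduced, reducedForm_toReduced]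
    exact K.invariant (x : 𝔡) (y : 𝔡) (z : 𝔡)

/-- The relation `R_𝔠 : 𝔡 ⇢ 𝔡_𝔠`, `ξ ∼ ξ + 𝔠ᗮ` for `ξ ∈ 𝔠`. -/
def reductionRel : SetRel 𝔡 (K.Reduced 𝔠) :=
  {x | ∃ ξ : 𝔠, x = ((ξ : 𝔡), K.toReduced 𝔠 ξ)}

/-- The subalgebra `𝔥_𝔠 = R_𝔠 ∘ 𝔥 ⊆ 𝔡_𝔠`, i.e. the image of `𝔥 ∩ 𝔠` in `𝔠 / 𝔠ᗮ`. -/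
def reduceSubalgebra (𝔥 : LieSubalgebra ℝ 𝔡) : LieSubalgebra ℝ (K.Reduced 𝔠) where
  toSubmodule := (𝔥.toSubmodule.comap 𝔠.toSubmodule.subtype).map (K.toReduced 𝔠)
  lie_mem' := by
    rintro _ _ ⟨x, hx, rfl⟩ ⟨y, hy, rfl⟩
    exact ⟨⁅x, y⁆, 𝔥.lie_mem hx hy, K.toReduced_lie 𝔠 x y⟩

end

end InvariantMetric

/-! ## Tangent and cotangent vectors, forms, relations -/

noncomputable section

section Calculus

variable {E : Type*} [NormedAddCommGroup E] [NormedSpace ℝ E]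
  {M : Type*} [TopologicalSpace M] [ChartedSpace E M]
  {E' : Type*} [NormedAddCommGroup E'] [NormedSpace ℝ E']
  {M' : Type*} [TopologicalSpace M'] [ChartedSpace E' M']

/-- The tangent space `T_m M` of a manifold modelled on `E`. -/
abbrev Tan (E : Type*) [NormedAddCommGroup E] [NormedSpace ℝ E]
    {M : Type*} [TopologicalSpace M] [ChartedSpace E M] (m : M) : Type _ :=
  TangentSpace 𝓘(ℝ, E) m

/-- The cotangent space `T*_m M`. -/
abbrev Cotan (E : Type*) [NormedAddCommGroup E] [NormedSpace ℝ E]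
    {M : Type*} [TopologicalSpace M] [ChartedSpace E M] (m : M) : Type _ :=
  Tan E m →L[ℝ] ℝ

/-- The total space of `𝕋M = TM ⊕ T*M`: triples `⟨m, X, α⟩`, standing for `X + α` at `m`. -/
abbrev GenTan (E : Type*) [NormedAddCommGroup E] [NormedSpace ℝ E]
    (M : Type*) [TopologicalSpace M] [ChartedSpace E M] : Type _ :=
  Σ m : M, Tan E m × Cotan E m

/-- The differential `T_m M → T_{f m} M'`. -/
abbrev dMap (E E' : Type*) [NormedAddCommGroup E] [NormedSpace ℝ E]
    [NormedAddCommGroup E'] [NormedSpace ℝ E']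
    {M : Type*} [TopologicalSpace M] [ChartedSpace E M]
    {M' : Type*} [TopologicalSpace M'] [ChartedSpace E' M'] (f : M → M') (m : M) :
    Tan E m →L[ℝ] Tan E' (f m) :=
  mfderiv 𝓘(ℝ, E) 𝓘(ℝ, E') f m

/-- The differential `df_m ∈ T*_m M` of a real function. -/
def dFun (f : M → ℝ) (m : M) : Cotan E m := mfderiv 𝓘(ℝ, E) 𝓘(ℝ, ℝ) f m

/-- The derivative `T_m M → V` of a function with values in a normed space `V`. -/
def dVec {V : Type*} [NormedAddCommGroup V] [NormedSpace ℝ V] (f : M → V) (m : M) :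
    Tan E m →L[ℝ] V :=
  mfderiv 𝓘(ℝ, E) 𝓘(ℝ, V) f m

/-- The derivative at `m`, along `v ∈ T_m M`, of a function with values in a finite-dimensional
real vector space `V` without a chosen norm, computed in coordinates. -/
def dirDeriv {V : Type*} [AddCommGroup V] [Module ℝ V] [Module.Finite ℝ V]
    (f : M → V) (m : M) (v : Tan E m) : V :=
  ∑ i, dFun (E := E) (fun x => (Module.finBasis ℝ V).repr (f x) i) m v • Module.finBasis ℝ V i

/-- A vector field on `M` read in the preferred chart at `m`. -/
def fieldInChart (m : M) (X : ∀ x : M, Tan E x) : E → E :=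
  fun y => VectorField.mpullback 𝓘(ℝ, E) 𝓘(ℝ, E) (extChartAt 𝓘(ℝ, E) m).symm X y

/-- A one-form on `M` read in the preferred chart at `m`. -/
def formInChart (m : M) (α : ∀ x : M, Cotan E x) : E → E →L[ℝ] ℝ :=
  fun y => (α ((extChartAt 𝓘(ℝ, E) m).symm y)).comp
    (mfderiv 𝓘(ℝ, E) 𝓘(ℝ, E) (extChartAt 𝓘(ℝ, E) m).symm y)

/-- The Lie derivative `(L_X β)_m` of a one-form; in a chart, `v ↦ Dβ(X) v + β (DX v)`. -/
def lieDerivForm (X : ∀ x : M, Tan E x) (β : ∀ x : M, Cotan E x) (m : M) : Cotan E m :=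
  let y : E := extChartAt 𝓘(ℝ, E) m m
  (fderiv ℝ (formInChart m β) y (fieldInChart m X y) +
    (formInChart m β y).comp (fderiv ℝ (fieldInChart m X) y)).comp
      (mfderiv 𝓘(ℝ, E) 𝓘(ℝ, E) (extChartAt 𝓘(ℝ, E) m) m)

/-- The contraction `(ι_Y dα)_m` of the exterior derivative of a one-form; in a chart,
`v ↦ Dα(Y) v - Dα(v) Y`. -/
def contractExtDeriv (Y : ∀ x : M, Tan E x) (α : ∀ x : M, Cotan E x) (m : M) : Cotan E m :=
  let y : E := extChartAt 𝓘(ℝ, E) m m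
  (fderiv ℝ (formInChart m α) y (fieldInChart m Y y) -
    (fderiv ℝ (formInChart m α) y).flip (fieldInChart m Y y)).comp
      (mfderiv 𝓘(ℝ, E) 𝓘(ℝ, E) (extChartAt 𝓘(ℝ, E) m) m)

/-- The standard lift `R_f : 𝕋M ⇢ 𝕋M'` of (the graph of) a map:
`X + f^*β ∼ df X + β`. -/
def stdLift (E E' : Type*) [NormedAddCommGroup E] [NormedSpace ℝ E]
    [NormedAddCommGroup E'] [NormedSpace ℝ E']
    {M : Type*} [TopologicalSpace M] [ChartedSpace E M]
    {M' : Type*} [TopologicalSpace M'] [ChartedSpace E' M'] (f : M → M') :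
    SetRel (GenTan E M) (GenTan E' M') :=
  {x | ∃ (m : M) (X : Tan E m) (β : Cotan E' (f m)),
    x = (⟨m, X, β.comp (dMap E E' f m)⟩, ⟨f m, dMap E E' f m X, β⟩)}

/-- One step along the flow of a member of the family `𝓕` of vector fields on `M`. -/
def FlowStep (𝓕 : Set (∀ x : M, Tan E x)) (x y : M) : Prop :=
  ∃ v ∈ 𝓕, ∃ γ : ℝ → M, IsMIntegralCurveOn (I := 𝓘(ℝ, E)) γ v (Set.Icc 0 1) ∧ γ 0 = x ∧ γ 1 = y

/-- `x` and `y` lie in the same orbit of the family `𝓕` of vector fields: they are joined by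
finitely many integral curves of members of `𝓕`. -/
def SameOrbit (𝓕 : Set (∀ x : M, Tan E x)) : M → M → Prop := Relation.EqvGen (FlowStep 𝓕)

/-- The orbits of the family `𝓕` form a regular foliation of `M` with quotient map `q : M → M'`:
`q` is a surjective submersion onto the manifold `M'`, its fibres are the orbits (so that `M'` is
the leaf space), and its vertical tangent spaces are the tangent spaces of the orbits, i.e. the
spaces of values of the members of `𝓕`. -/
structure IsRegularFoliation (E E' : Type*) [NormedAddCommGroup E] [NormedSpace ℝ E]
    [NormedAddCommGroup E'] [NormedSpace ℝ E']
    {M : Type*} [TopologicalSpace M] [ChartedSpace E M]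
    {M' : Type*} [TopologicalSpace M'] [ChartedSpace E' M']
    (𝓕 : Set (∀ x : M, Tan E x)) (q : M → M') : Prop where
  submersion : Manifold.IsSubmersion 𝓘(ℝ, E) 𝓘(ℝ, E') ∞ q
  surjective : Function.Surjective q
  fibres : ∀ x y : M, q x = q y ↔ SameOrbit 𝓕 x y
  vertical : ∀ (x : M) (v : Tan E x), dMap E E' q x v = 0 ↔ ∃ X ∈ 𝓕, X x = v

/-- A Poisson structure, given by its bivector field `π`, through `π♯ : T*M → TM`. The associated
bracket is `{f, g} = π(df, dg) = dg (π♯ df)`. -/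
structure IsPoisson (π : ∀ x : M, Cotan E x →ₗ[ℝ] Tan E x) : Prop where
  skew : ∀ (x : M) (α β : Cotan E x), β (π x α) = - α (π x β)
  smooth : ∀ f g : M → ℝ, ContMDiff 𝓘(ℝ, E) 𝓘(ℝ, ℝ) ∞ f → ContMDiff 𝓘(ℝ, E) 𝓘(ℝ, ℝ) ∞ g →
    ContMDiff 𝓘(ℝ, E) 𝓘(ℝ, ℝ) ∞ (fun x => dFun (E := E) g x (π x (dFun (E := E) f x)))
  jacobi : ∀ f g h : M → ℝ, ContMDiff 𝓘(ℝ, E) 𝓘(ℝ, ℝ) ∞ f → ContMDiff 𝓘(ℝ, E) 𝓘(ℝ, ℝ) ∞ g →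
    ContMDiff 𝓘(ℝ, E) 𝓘(ℝ, ℝ) ∞ h →
    let br : (M → ℝ) → (M → ℝ) → M → ℝ :=
      fun a b x => dFun (E := E) b x (π x (dFun (E := E) a x))
    ∀ x : M, br f (br g h) x + br g (br h f) x + br h (br f g) x = 0

end Calculus

/-! ## The Courant algebroid `(𝔡 × N) × \overline{𝕋M}` -/

section Courant

variable {𝔡 : Type*} [LieRing 𝔡] [LieAlgebra ℝ 𝔡]
  {EN : Type*} [NormedAddCommGroup EN] [NormedSpace ℝ EN]
  {N : Type*} [TopologicalSpace N] [ChartedSpace EN N] [IsManifold 𝓘(ℝ, EN) ∞ N]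
  {EM : Type*} [NormedAddCommGroup EM] [NormedSpace ℝ EM]
  {M : Type*} [TopologicalSpace M] [ChartedSpace EM M]

/-- The data of an action Courant algebroid `𝔡 × N`: an action `ρ = field` of the quadratic Lie
algebra `𝔡` on `N` by smooth vector fields, all of whose stabilizers are coisotropic. -/
structure CourantAction (K : InvariantMetric 𝔡) (EN : Type*) [NormedAddCommGroup EN]
    [NormedSpace ℝ EN] (N : Type*) [TopologicalSpace N] [ChartedSpace EN N]
    [IsManifold 𝓘(ℝ, EN) ∞ N] where
  field : 𝔡 →ₗ[ℝ] (∀ n : N, Tan EN n)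
  smooth : ∀ ξ : 𝔡, ContMDiff 𝓘(ℝ, EN) 𝓘(ℝ, EN).tangent ∞
    (fun n => (⟨n, field ξ n⟩ : TangentBundle 𝓘(ℝ, EN) N))
  field_lie : ∀ (ξ η : 𝔡) (n : N),
    field ⁅ξ, η⁆ n = VectorField.mlieBracket 𝓘(ℝ, EN) (field ξ) (field η) n
  coisotropic : ∀ n : N, K.IsCoisotropic (LinearMap.ker ((LinearMap.proj n).comp field))

namespace CourantAction

variable {K : InvariantMetric 𝔡} (A : CourantAction K EN N)

/-- The anchor `ρ_n : 𝔡 → T_n N`. -/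
def anchor (n : N) : 𝔡 →ₗ[ℝ] Tan EN n := (LinearMap.proj n).comp A.field

/-- The dual `ρ^*_n : T*_n N → 𝔡^* ≅ 𝔡` of the anchor: `⟨ρ^* β, ξ⟩ = β (ρ ξ)`. -/
def coanchor [Module.Finite ℝ 𝔡] (n : N) (β : Cotan EN n) : 𝔡 :=
  (K.form.toDual K.nondeg).symm (β.toLinearMap.comp (A.anchor n))

end CourantAction

/-- The fibre of `(𝔡 × N) × \overline{𝕋M}` at `(n, m)`: triples `(ξ, X, α)` with `ξ ∈ 𝔡`,
`X ∈ T_m M`, `α ∈ T*_m M`. It does not depend on `n`. -/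
abbrev CFib (𝔡 : Type*) (E : Type*) [NormedAddCommGroup E] [NormedSpace ℝ E]
    {M : Type*} [TopologicalSpace M] [ChartedSpace E M] (m : M) : Type _ :=
  𝔡 × Tan E m × Cotan E m

/-- The fibre metric of `(𝔡 × N) × \overline{𝕋M}`: the metric of `𝔡` minus that of `𝕋M`. -/
def cpair (K : InvariantMetric 𝔡) {m : M} (e e' : CFib 𝔡 EM m) : ℝ :=
  K.form e.1 e'.1 - (e.2.2 e'.2.1 + e'.2.2 e.2.1)

/-- Smoothness of a section `e` of `𝔡 ⊕ TM ⊕ T*M` along a map `f : B → M`. -/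
structure IsSmoothAlong {EB HB : Type*} [NormedAddCommGroup EB] [NormedSpace ℝ EB]
    [TopologicalSpace HB] (I : ModelWithCorners ℝ EB HB)
    {B : Type*} [TopologicalSpace B] [ChartedSpace HB B]
    [IsManifold 𝓘(ℝ, EM) ∞ M] (f : B → M) (e : ∀ b : B, CFib 𝔡 EM (f b)) : Prop where
  algebra : ∀ φ : 𝔡 →ₗ[ℝ] ℝ, ContMDiff I 𝓘(ℝ, ℝ) ∞ (fun b => φ (e b).1)
  tangent : ContMDiff I 𝓘(ℝ, EM).tangent ∞
    (fun b => (⟨f b, (e b).2.1⟩ : TangentBundle 𝓘(ℝ, EM) M))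
  cotangent : ContMDiff I (𝓘(ℝ, EM).prod 𝓘(ℝ, EM →L[ℝ] ℝ)) ∞
    (fun b => Bundle.TotalSpace.mk' (EM →L[ℝ] ℝ) (E := fun m : M => Cotan EM m) (f b) (e b).2.2)

/-- The Courant bracket of two sections `e₁, e₂` of `(𝔡 × N) × \overline{𝕋M}` over `N × M`.

On sections pulled back from the factors it is the bracket
`[ξ₁, ξ₂] + L_{ρ ξ₁} ξ₂ - L_{ρ ξ₂} ξ₁ + ρ^*⟨dξ₁, ξ₂⟩` of `𝔡 × N`, respectively the bracket
`[X₁, X₂] + L_{X₁} α₂ - ι_{X₂} dα₁` of `𝕋M`, and sections pulled back from different factors have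
zero bracket. A general section depends on both variables, and the Leibniz rules
`[e₁, f e₂] = f [e₁, e₂] + (a(e₁) f) e₂` and
`[f e₁, e₂] = f [e₁, e₂] - (a(e₂) f) e₁ + ⟨e₁, e₂⟩ a^* df`, with anchor
`a(ξ, X, α) = (ρ ξ, X)` and `a^*(β_N, β_M) = (ρ^* β_N, 0, - β_M)`, produce the remaining terms
below, which involve the partial derivatives in the two variables. -/
def courantBracket [Module.Finite ℝ 𝔡] {K : InvariantMetric 𝔡} (A : CourantAction K EN N)
    (e₁ e₂ : ∀ p : N × M, CFib 𝔡 EM p.2) (p : N × M) : CFib 𝔡 EM p.2 :=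
  let n : N := p.1
  let m : M := p.2
  -- the values at `p`
  let ξ₁ : 𝔡 := (e₁ (n, m)).1
  let ξ₂ : 𝔡 := (e₂ (n, m)).1
  let X₁ : Tan EM m := (e₁ (n, m)).2.1
  let X₂ : Tan EM m := (e₂ (n, m)).2.1
  let v₁ : Tan EN n := A.anchor n ξ₁
  let v₂ : Tan EN n := A.anchor n ξ₂
  -- derivatives along `v₁, v₂ ∈ T_n N` of the components in the fixed fibre `𝕋_m M`
  let X₂' : Tan EM m := dVec (E := EN) (V := EM) (fun x => (e₂ (x, m)).2.1) n v₁
  let X₁' : Tan EM m := dVec (E := EN) (V := EM) (fun x => (e₁ (x, m)).2.1) n v₂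
  let α₂' : Cotan EM m := dVec (E := EN) (V := EM →L[ℝ] ℝ) (fun x => (e₂ (x, m)).2.2) n v₁
  let α₁' : Cotan EM m := dVec (E := EN) (V := EM →L[ℝ] ℝ) (fun x => (e₁ (x, m)).2.2) n v₂
  ( ⁅ξ₁, ξ₂⁆
      + (dirDeriv (E := EN) (fun x => (e₂ (x, m)).1) n v₁
        + dirDeriv (E := EM) (fun y => (e₂ (n, y)).1) m X₁)
      - (dirDeriv (E := EN) (fun x => (e₁ (x, m)).1) n v₂
        + dirDeriv (E := EM) (fun y => (e₁ (n, y)).1) m X₂)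
      + A.coanchor n (dFun (E := EN) (fun x => cpair K (e₁ (x, m)) (e₂ (n, m))) n),
    VectorField.mlieBracket 𝓘(ℝ, EM) (fun y => (e₁ (n, y)).2.1) (fun y => (e₂ (n, y)).2.1) m
      + X₂' - X₁',
    lieDerivForm (E := EM) (fun y => (e₁ (n, y)).2.1) (fun y => (e₂ (n, y)).2.2) m
      - contractExtDeriv (E := EM) (fun y => (e₂ (n, y)).2.1) (fun y => (e₁ (n, y)).2.2) m
      + α₂' - α₁'
      - dFun (E := EM) (fun y => K.form (e₁ (n, y)).1 ξ₂) m )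

/-- The family of subspaces `L_m`, `m ∈ M`, viewed over the graph `{(μ m, m)}` of `μ : M → N`, is
a Dirac structure of `(𝔡 × N) × \overline{𝕋M}` with support on that graph: a Lagrangian smooth
subbundle, whose sections are closed under the Courant bracket of the ambient Courant algebroid. -/
structure IsDiracAlongGraph [Module.Finite ℝ 𝔡] [IsManifold 𝓘(ℝ, EM) ∞ M]
    {K : InvariantMetric 𝔡} (A : CourantAction K EN N)
    (μ : M → N) (L : ∀ m : M, Submodule ℝ (CFib 𝔡 EM m)) : Prop where
  lagrangian : ∀ (m : M) (e : CFib 𝔡 EM m), e ∈ L m ↔ ∀ e' ∈ L m, cpair K e e' = 0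
  subbundle : ∀ (m : M), ∀ e ∈ L m, ∃ σ : ∀ x : M, CFib 𝔡 EM x,
    IsSmoothAlong 𝓘(ℝ, EM) (fun x : M => x) σ ∧ (∀ x, σ x ∈ L x) ∧ σ m = e
  involutive : ∀ e₁ e₂ : (∀ p : N × M, CFib 𝔡 EM p.2),
    IsSmoothAlong (𝓘(ℝ, EN).prod 𝓘(ℝ, EM)) (fun p : N × M => p.2) e₁ →
    IsSmoothAlong (𝓘(ℝ, EN).prod 𝓘(ℝ, EM)) (fun p : N × M => p.2) e₂ →
    (∀ m, e₁ (μ m, m) ∈ L m) → (∀ m, e₂ (μ m, m) ∈ L m) →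
    ∀ m, courantBracket A e₁ e₂ (μ m, m) ∈ L m

/-- `R : 𝕋M ⇢ 𝔡 × N` is a Courant morphism over `μ : M → N`: as a subset it is (the total space
of) a Dirac structure in `(𝔡 × N) × \overline{𝕋M}` with support on the graph of the smooth map
`μ`. A pair `(⟨m, X, α⟩, (ξ, n)) ∈ R` means `X + α ∼ (ξ, n)`. -/
def IsCourantMorphism [Module.Finite ℝ 𝔡] [IsManifold 𝓘(ℝ, EM) ∞ M]
    {K : InvariantMetric 𝔡} (A : CourantAction K EN N)
    (μ : M → N) (R : SetRel (GenTan EM M) (𝔡 × N)) : Prop :=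
  ContMDiff 𝓘(ℝ, EM) 𝓘(ℝ, EN) ∞ μ ∧
  ∃ L : ∀ m : M, Submodule ℝ (CFib 𝔡 EM m), IsDiracAlongGraph A μ L ∧
    ∀ (m : M) (X : Tan EM m) (α : Cotan EM m) (ξ : 𝔡) (n : N),
      ((⟨m, X, α⟩, (ξ, n)) : GenTan EM M × (𝔡 × N)) ∈ R ↔ n = μ m ∧ (ξ, X, α) ∈ L m

/-- `R : (𝕋, T)M ⇢ (𝔡, 𝔥) × N` is a morphism of Manin pairs over `μ`: a Courant morphism with
`R ∘ TM ⊆ 𝔥 × N` and `ker R ∩ TM = 0`. -/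
structure IsManinMorphism [Module.Finite ℝ 𝔡] [IsManifold 𝓘(ℝ, EM) ∞ M]
    {K : InvariantMetric 𝔡} (A : CourantAction K EN N) (𝔥 : LieSubalgebra ℝ 𝔡)
    (μ : M → N) (R : SetRel (GenTan EM M) (𝔡 × N)) : Prop where
  courant : IsCourantMorphism A μ R
  image_tangent : ∀ (m : M) (X : Tan EM m) (ξ : 𝔡) (n : N),
    ((⟨m, X, 0⟩, (ξ, n)) : GenTan EM M × (𝔡 × N)) ∈ R → ξ ∈ 𝔥
  ker_tangent : ∀ (m : M) (X : Tan EM m) (n : N),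
    ((⟨m, X, 0⟩, (0, n)) : GenTan EM M × (𝔡 × N)) ∈ R → X = 0

end Courant

/-! ## Reductive data and the reduced relation -/

section Reduction

variable {𝔡 : Type*} [LieRing 𝔡] [LieAlgebra ℝ 𝔡]
  {EN : Type*} [NormedAddCommGroup EN] [NormedSpace ℝ EN]
  {N : Type*} [TopologicalSpace N] [ChartedSpace EN N] [IsManifold 𝓘(ℝ, EN) ∞ N]
  {EM : Type*} [NormedAddCommGroup EM] [NormedSpace ℝ EM]
  {M : Type*} [TopologicalSpace M] [ChartedSpace EM M]

/-- The vector fields on the invariant submanifold `iN : S → N` by which the elements of the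
subspace `V ⊆ 𝔡` act. -/
def actionFields {K : InvariantMetric 𝔡} (A : CourantAction K EN N) (V : Submodule ℝ 𝔡)
    (ES : Type*) [NormedAddCommGroup ES] [NormedSpace ℝ ES]
    {S : Type*} [TopologicalSpace S] [ChartedSpace ES S] (iN : S → N) :
    Set (∀ s : S, Tan ES s) :=
  {v | ∃ ξ ∈ V, ∀ s : S, dMap ES EN iN s (v s) = A.field ξ (iN s)}

/-- The vector fields on the submanifold `iM : P → M` by which the elements of the subspace
`V ⊆ 𝔥` act. Here `ξ ∈ 𝔥` acts on `M` by the vector field `ρ_R(ξ)` determined by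
`ρ_R(ξ) ∼_R ξ`. -/
def momentFields (R : SetRel (GenTan EM M) (𝔡 × N)) (μ : M → N) (V : Submodule ℝ 𝔡)
    (EP : Type*) [NormedAddCommGroup EP] [NormedSpace ℝ EP]
    {P : Type*} [TopologicalSpace P] [ChartedSpace EP P] (iM : P → M) :
    Set (∀ p : P, Tan EP p) :=
  {v | ∃ ξ ∈ V, ∀ p : P, ((⟨iM p, dMap EP EM iM p (v p), 0⟩, (ξ, μ (iM p))) :
    GenTan EM M × (𝔡 × N)) ∈ R}

/-- Reductive data `(𝔠, S)` for a morphism of Manin pairs `R : (𝕋, T)M ⇢ (𝔡, 𝔥) × N` over `μ`,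
together with the quotients. The submanifold `S ⊆ N` is given by its inclusion `iN : S → N`, the
submanifold `μ⁻¹(S) ⊆ M` by its inclusion `iM : P → M`; the quotient maps are
`qN : S → N_{𝔠,S} = Nr` and `qM : P = μ⁻¹(S) → M_{𝔠,S} = Mr`. -/
structure IsReductiveData (ES EP ENr EMr : Type*)
    [NormedAddCommGroup ES] [NormedSpace ℝ ES] [NormedAddCommGroup EP] [NormedSpace ℝ EP]
    [NormedAddCommGroup ENr] [NormedSpace ℝ ENr] [NormedAddCommGroup EMr] [NormedSpace ℝ EMr]
    {S : Type*} [TopologicalSpace S] [ChartedSpace ES S]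
    {P : Type*} [TopologicalSpace P] [ChartedSpace EP P]
    {Nr : Type*} [TopologicalSpace Nr] [ChartedSpace ENr Nr]
    {Mr : Type*} [TopologicalSpace Mr] [ChartedSpace EMr Mr]
    {K : InvariantMetric 𝔡} (A : CourantAction K EN N)
    (𝔥 : LieSubalgebra ℝ 𝔡) (μ : M → N) (R : SetRel (GenTan EM M) (𝔡 × N))
    (𝔠 : LieSubalgebra ℝ 𝔡) (iN : S → N) (qN : S → Nr) (iM : P → M) (qM : P → Mr) : Prop where
  /-- `𝔠` is coisotropic. -/
  coisotropic : K.IsCoisotropic 𝔠.toSubmodule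
  /-- `S` is a submanifold of `N`. -/
  embedding_N : Manifold.IsSmoothEmbedding 𝓘(ℝ, ES) 𝓘(ℝ, EN) ∞ iN
  /-- `S` is `𝔠`-invariant: the vector fields `ρ(ξ)`, `ξ ∈ 𝔠`, are tangent to `S`. -/
  invariant : ∀ ξ ∈ 𝔠, ∀ s : S, ∃ w : Tan ES s, dMap ES EN iN s w = A.field ξ (iN s)
  /-- The `𝔠ᗮ`-orbits in `S` form a regular foliation with quotient `qN`. -/
  foliation_N : IsRegularFoliation ES ENr (actionFields A (K.perp 𝔠.toSubmodule) ES iN) qN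
  /-- The intersection `μ⁻¹(S)` of the graph of `μ` with `S × M` is clean: it is a submanifold... -/
  embedding_M : Manifold.IsSmoothEmbedding 𝓘(ℝ, EP) 𝓘(ℝ, EM) ∞ iM
  range_M : Set.range iM = μ ⁻¹' Set.range iN
  /-- ... whose tangent space is the intersection of the tangent spaces. -/
  clean : ∀ (p : P) (s : S), iN s = μ (iM p) → ∀ v : Tan EM (iM p),
    (∃ u : Tan EP p, dMap EP EM iM p u = v) ↔
      ∃ w : Tan ES s, (dMap ES EN iN s w : EN) = dMap EM EN μ (iM p) v
  /-- The `𝔥 ∩ 𝔠ᗮ`-orbits in `μ⁻¹(S)` form a regular foliation with quotient `qM`. -/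
  foliation_M : IsRegularFoliation EP EMr
    (momentFields R μ (𝔥.toSubmodule ⊓ K.perp 𝔠.toSubmodule) EP iM) qM

/-- `R₁ = R_{qM} ∘ R_{iM}ᵀ : 𝕋M ⇢ 𝕋M_{𝔠,S}`. -/
def relOne (EM EP EMr : Type*) [NormedAddCommGroup EM] [NormedSpace ℝ EM]
    [NormedAddCommGroup EP] [NormedSpace ℝ EP] [NormedAddCommGroup EMr] [NormedSpace ℝ EMr]
    {M : Type*} [TopologicalSpace M] [ChartedSpace EM M]
    {P : Type*} [TopologicalSpace P] [ChartedSpace EP P]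
    {Mr : Type*} [TopologicalSpace Mr] [ChartedSpace EMr Mr] (iM : P → M) (qM : P → Mr) :
    SetRel (GenTan EM M) (GenTan EMr Mr) :=
  (stdLift EP EM iM).inv.comp (stdLift EP EMr qM)

/-- `R₂ = R_𝔠 × (gr(qN) ∘ gr(iN)ᵀ) : 𝔡 × N ⇢ 𝔡_𝔠 × N_{𝔠,S}`. -/
def relTwo {𝔡 : Type*} [LieRing 𝔡] [LieAlgebra ℝ 𝔡] (K : InvariantMetric 𝔡)
    (𝔠 : LieSubalgebra ℝ 𝔡) {N S Nr : Type*} (iN : S → N) (qN : S → Nr) :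
    SetRel (𝔡 × N) (K.Reduced 𝔠 × Nr) :=
  {x | (x.1.1, x.2.1) ∈ K.reductionRel 𝔠 ∧
    (x.1.2, x.2.2) ∈ (Function.graph iN).inv.comp (Function.graph qN)}

/-- The reduced relation `R_{𝔠,S} = R₂ ∘ R ∘ R₁ᵀ : 𝕋M_{𝔠,S} ⇢ 𝔡_𝔠 × N_{𝔠,S}`. (`SetRel.comp` takes
its arguments in the order of application.) -/
def reducedRel (K : InvariantMetric 𝔡) (R : SetRel (GenTan EM M) (𝔡 × N))
    (𝔠 : LieSubalgebra ℝ 𝔡) (EP EMr : Type*)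
    [NormedAddCommGroup EP] [NormedSpace ℝ EP] [NormedAddCommGroup EMr] [NormedSpace ℝ EMr]
    {S Nr : Type*} {P : Type*} [TopologicalSpace P] [ChartedSpace EP P]
    {Mr : Type*} [TopologicalSpace Mr] [ChartedSpace EMr Mr]
    (iN : S → N) (qN : S → Nr) (iM : P → M) (qM : P → Mr) :
    SetRel (GenTan EMr Mr) (K.Reduced 𝔠 × Nr) :=
  ((relOne EM EP EMr iM qM).inv.comp R).comp (relTwo K 𝔠 iN qN)

end Reduction

end

/-! A morphism of Manin pairs is a family of Lagrangian subspaces `L m ⊆ 𝔡 × T_m M × T*_m M`. Once a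
linear projection `t` of `𝔡` onto `𝔥` is chosen, `(ξ, X, α) ↦ (t ξ, α)` is an isomorphism `L m ≅ 𝔥 ×
T*_m M` (`IsManinFibre.exists_mem_proj`, `IsManinFibre.eq_of_proj`). Hence `L` has global smooth
sections with prescribed `ζ ∈ 𝔥` and prescribed exact one-form `df` (`exists_isSmoothAlong_proj`),
and everything is tested on these.

Integrability becomes a condition over `M` alone. The anchor of `L` is tangent to the graph of `μ`
(`IsDiracAlongGraph.anchor`), so the pairing of `[e₁, e₂]` with `e₃ ∈ L` involves only the
restrictions of `e₁`, `e₂` to the graph; it is then `courantTri`. As `L` is isotropic, `courantTri`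
depends only on values at the point (`courantTri_congr`), and it suffices to see it vanish on one
convenient choice of sections through given values (`isDiracAlongGraph_of_courantTri`). On sections
with exact one-forms it is an expression in functions and their derivatives along the vector
components (`courantTri_of_exact`), and such expressions can be carried along `M ← P → Mr`.

Fibrewise, the elements `(ξ + 𝔠ᗮ, q U, γ)` with `(ξ, i U, α) ∈ L` and `α ∘ i = γ ∘ q` again form a
Manin fibre; the main input is `(𝔥 + 𝔠)ᗮ = 𝔥 ∩ 𝔠ᗮ` (`IsReductiveFibre.isManinFibre`). The reduced
fibre must agree at all points of a leaf. Along an integral curve of a field from `𝔥 ∩ 𝔠ᗮ`, take the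
element of the reduced fibre with fixed projections to `𝔥_𝔠` and to the cotangent space. The
vanishing of `courantTri` puts its derivative into the reduced fibre, where the two projections of
the derivative are zero; so the element is constant (`IsReductiveMoment.reducedFibreAt_le`).

With a projection of `𝔡` adapted to one of `𝔡_𝔠` (`exists_isProj_adapted`), exact sections of `L`
descend to exact sections of the reduction, and the vanishing of `courantTri` descends with them.
The action on `N` is descended by the same differentiation along leaves (`IsReductiveBase`). For
`𝔡_𝔠 = 0` the reduction is the graph of some `π`, and the vanishing of `courantTri` is the Jacobi
identity (`exists_isPoisson`). -/

noncomputable section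

open scoped Topology
open Set Filter

set_option linter.unusedSectionVars false

/-! ### Tangent vectors, cotangent vectors and smoothness in a chart. -/

section Flat
variable {E : Type*} [NormedAddCommGroup E] [NormedSpace ℝ E] {M : Type*} [TopologicalSpace M] [ChartedSpace E M]

/-- The coordinates, in the chart at `m₀`, of tangent vectors at `m`. -/
def tangentCoord (m₀ m : M) : Tan E m →L[ℝ] E :=
  mfderiv 𝓘(ℝ, E) 𝓘(ℝ, E) (extChartAt 𝓘(ℝ, E) m₀) m

/-- The tangent vector at `m` with given coordinates in the chart at `m₀`. -/
def tangentOfCoord (m₀ m : M) : E →L[ℝ] Tan E m :=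
  mfderivWithin 𝓘(ℝ, E) 𝓘(ℝ, E) (extChartAt 𝓘(ℝ, E) m₀).symm (range 𝓘(ℝ, E)) (extChartAt 𝓘(ℝ, E) m₀ m)

variable [IsManifold 𝓘(ℝ, E) ∞ M]

lemma tangentCoord_eq_trivializationAt {m₀ m : M} (hm : m ∈ (chartAt E m₀).source) (v : Tan E m) :
    tangentCoord m₀ m v = (trivializationAt E (TangentSpace 𝓘(ℝ, E)) m₀ ⟨m, v⟩).2 := by
  rw [tangentCoord, ← TangentBundle.continuousLinearMapAt_trivializationAt hm]
  rw [Bundle.Trivialization.continuousLinearMapAt_apply, Bundle.Trivialization.coe_linearMapAt_of_mem _ (by simpa using hm)]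

lemma tangentCoord_self (m : M) (v : Tan E m) : tangentCoord m m v = v := by
  rw [tangentCoord, mfderiv_extChartAt_self]; rfl

lemma tangentOfCoord_self (m : M) (v : E) : tangentOfCoord m m v = v := by
  rw [tangentOfCoord, mfderivWithin_range_extChartAt_symm]; rfl

lemma tangentOfCoord_tangentCoord {m₀ m : M} (hm : m ∈ (extChartAt 𝓘(ℝ, E) m₀).source)
    (v : Tan E m) : tangentOfCoord m₀ m (tangentCoord m₀ m v) = v := by
  exact DFunLike.congr_fun (mfderivWithin_extChartAt_symm_comp_mfderiv_extChartAt' hm) v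

lemma tangentCoord_tangentOfCoord {m₀ m : M} (hm : m ∈ (extChartAt 𝓘(ℝ, E) m₀).source)
    (v : E) : tangentCoord m₀ m (tangentOfCoord m₀ m v) = v := by
  exact DFunLike.congr_fun (mfderiv_extChartAt_comp_mfderivWithin_extChartAt_symm' hm) v

lemma fieldInChart_eq {m₀ : M} {y : E} (hy : y ∈ (extChartAt 𝓘(ℝ, E) m₀).target)
    (X : ∀ x : M, Tan E x) :
    fieldInChart m₀ X y = tangentCoord m₀ ((extChartAt 𝓘(ℝ, E) m₀).symm y)
      (X ((extChartAt 𝓘(ℝ, E) m₀).symm y)) := by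
  have h1 := mfderivWithin_extChartAt_symm_comp_mfderiv_extChartAt (I := 𝓘(ℝ, E)) hy
  have h2 := mfderiv_extChartAt_comp_mfderivWithin_extChartAt_symm (I := 𝓘(ℝ, E)) hy
  simp only [modelWithCornersSelf_coe, range_id, mfderivWithin_univ] at h1 h2
  rw [fieldInChart, VectorField.mpullback_apply, ContinuousLinearMap.inverse_eq h1 h2]
  rfl

lemma fieldInChart_extChartAt {m₀ m : M} (hm : m ∈ (extChartAt 𝓘(ℝ, E) m₀).source)
    (X : ∀ x : M, Tan E x) :
    fieldInChart m₀ X (extChartAt 𝓘(ℝ, E) m₀ m) = tangentCoord m₀ m (X m) := by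
  rw [fieldInChart_eq ((extChartAt 𝓘(ℝ, E) m₀).map_source hm)]
  exact congrArg (fun m => tangentCoord m₀ m (X m)) ((extChartAt 𝓘(ℝ, E) m₀).left_inv hm)

omit [IsManifold 𝓘(ℝ, E) ∞ M] in
lemma formInChart_extChartAt {m₀ m : M} (hm : m ∈ (extChartAt 𝓘(ℝ, E) m₀).source)
    (α : ∀ x : M, Cotan E x) :
    formInChart m₀ α (extChartAt 𝓘(ℝ, E) m₀ m) = (α m).comp (tangentOfCoord m₀ m) := by
  rw [formInChart, tangentOfCoord, modelWithCornersSelf_coe, range_id, mfderivWithin_univ]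
  exact congrArg (fun m' : M => (α m').comp
    (mfderiv 𝓘(ℝ, E) 𝓘(ℝ, E) (extChartAt 𝓘(ℝ, E) m₀).symm (extChartAt 𝓘(ℝ, E) m₀ m) : E →L[ℝ] E))
    ((extChartAt 𝓘(ℝ, E) m₀).left_inv hm)

/-- The derivative of a vector-valued function, in the chart at `m₀`. -/
lemma dVec_eq_fderiv {V : Type*} [NormedAddCommGroup V] [NormedSpace ℝ V] {m₀ m : M}
    (hm : m ∈ (extChartAt 𝓘(ℝ, E) m₀).source) {f : M → V}
    (hf : MDifferentiableAt 𝓘(ℝ, E) 𝓘(ℝ, V) f m) (v : Tan E m) :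
    dVec f m v = fderiv ℝ (f ∘ (extChartAt 𝓘(ℝ, E) m₀).symm) (extChartAt 𝓘(ℝ, E) m₀ m)
      (tangentCoord m₀ m v) := by
  have hφ : MDifferentiableAt 𝓘(ℝ, E) 𝓘(ℝ, E) (extChartAt 𝓘(ℝ, E) m₀) m :=
    mdifferentiableAt_extChartAt (by simpa using hm)
  have hs : MDifferentiableAt 𝓘(ℝ, E) 𝓘(ℝ, E) (extChartAt 𝓘(ℝ, E) m₀).symm
      (extChartAt 𝓘(ℝ, E) m₀ m) := by
    have := mdifferentiableWithinAt_extChartAt_symm (I := 𝓘(ℝ, E))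
      ((extChartAt 𝓘(ℝ, E) m₀).map_source hm)
    simpa only [modelWithCornersSelf_coe, range_id, mdifferentiableWithinAt_univ] using this
  have hfs : MDifferentiableAt 𝓘(ℝ, E) 𝓘(ℝ, V) (f ∘ (extChartAt 𝓘(ℝ, E) m₀).symm)
      (extChartAt 𝓘(ℝ, E) m₀ m) :=
    MDifferentiableAt.comp _ (by rwa [(extChartAt 𝓘(ℝ, E) m₀).left_inv hm]) hs
  have h : f =ᶠ[𝓝 m] (f ∘ (extChartAt 𝓘(ℝ, E) m₀).symm) ∘ extChartAt 𝓘(ℝ, E) m₀ := by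
    filter_upwards [(isOpen_extChartAt_source m₀).mem_nhds hm] with x hx
    exact (congrArg f ((extChartAt 𝓘(ℝ, E) m₀).left_inv hx)).symm
  rw [dVec, h.mfderiv_eq, mfderiv_comp m hfs hφ, mfderiv_eq_fderiv]
  rfl

lemma dFun_self_eq_fderiv {m : M} {f : M → ℝ}
    (hf : MDifferentiableAt 𝓘(ℝ, E) 𝓘(ℝ, ℝ) f m) (v : Tan E m) :
    dFun f m v = fderiv ℝ (f ∘ (extChartAt 𝓘(ℝ, E) m).symm) (extChartAt 𝓘(ℝ, E) m m) v := by
  have h := dVec_eq_fderiv (mem_extChartAt_source m) hf v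
  rwa [tangentCoord_self] at h

/-- The chart at `m` has the identity as derivative at `m`, so the derivative in coordinates and the
intrinsic one are the same linear map. -/
lemma hasMFDerivAt_of_eventuallyEq_comp_extChartAt
    {V : Type*} [NormedAddCommGroup V] [NormedSpace ℝ V] {m : M} {f : M → V} {h : E → V}
    {h' : E →L[ℝ] V} (hh : HasFDerivAt h h' (extChartAt 𝓘(ℝ, E) m m))
    (hf : f =ᶠ[𝓝 m] h ∘ extChartAt 𝓘(ℝ, E) m) :
    HasMFDerivAt 𝓘(ℝ, E) 𝓘(ℝ, V) f m h' := by
  have hφ : HasMFDerivAt 𝓘(ℝ, E) 𝓘(ℝ, E) (extChartAt 𝓘(ℝ, E) m) m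
      (ContinuousLinearMap.id ℝ E) := by
    have := (mdifferentiableAt_extChartAt (I := 𝓘(ℝ, E)) (mem_chart_source E m)).hasMFDerivAt
    rwa [mfderiv_extChartAt_self] at this
  exact (hh.hasMFDerivAt.comp m hφ).congr_of_eventuallyEq hf

variable {EB HB : Type*} [NormedAddCommGroup EB] [NormedSpace ℝ EB]
    [TopologicalSpace HB] {I : ModelWithCorners ℝ EB HB}
    {B : Type*} [TopologicalSpace B] [ChartedSpace HB B]

/-- Smoothness into the tangent bundle is measured in the trivialization at the base point, which is
`tangentCoord` near that point. With its cotangent analogue below, this turns bundle smoothness into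
smoothness of vector-valued maps. -/
lemma contMDiffAt_tangent_iff {f : B → M} {X : ∀ b, Tan E (f b)} {b₀ : B} :
    ContMDiffAt I 𝓘(ℝ, E).tangent ∞ (fun b => (⟨f b, X b⟩ : TangentBundle 𝓘(ℝ, E) M)) b₀ ↔
    ContMDiffAt I 𝓘(ℝ, E) ∞ f b₀ ∧
      ContMDiffAt I 𝓘(ℝ, E) ∞ (fun b => tangentCoord (f b₀) (f b) (X b)) b₀ := by
  refine (Bundle.contMDiffAt_totalSpace (F := E) (E := TangentSpace 𝓘(ℝ, E)) (IB := 𝓘(ℝ, E))).trans ?_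
  refine and_congr_right fun hf => ?_
  refine Filter.EventuallyEq.contMDiffAt_iff ?_
  filter_upwards [hf.continuousAt.preimage_mem_nhds ((chartAt E (f b₀)).open_source.mem_nhds (mem_chart_source E _))] with b hb
  exact (tangentCoord_eq_trivializationAt hb _).symm

lemma contMDiffAt_cotangent_iff {f : B → M} {α : ∀ b, Cotan E (f b)} {b₀ : B} :
    ContMDiffAt I (𝓘(ℝ, E).prod 𝓘(ℝ, E →L[ℝ] ℝ)) ∞
    (fun b => Bundle.TotalSpace.mk' (E →L[ℝ] ℝ) (E := fun m : M => Cotan E m) (f b) (α b)) b₀ ↔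
    ContMDiffAt I 𝓘(ℝ, E) ∞ f b₀ ∧
      ContMDiffAt I 𝓘(ℝ, E →L[ℝ] ℝ) ∞ (fun b => (α b).comp (tangentOfCoord (f b₀) (f b))) b₀ := by
  refine (contMDiffAt_hom_bundle (F₁ := E) (E₁ := TangentSpace 𝓘(ℝ, E)) (IB := 𝓘(ℝ, E)) (F₂ := ℝ)
    (E₂ := Bundle.Trivial M ℝ) _).trans ?_
  refine and_congr_right fun hf => ?_
  refine Filter.EventuallyEq.contMDiffAt_iff ?_
  filter_upwards [hf.continuousAt.preimage_mem_nhds ((chartAt E (f b₀)).open_source.mem_nhds (mem_chart_source E _))] with b hb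
  ext v
  simp only [ContinuousLinearMap.inCoordinates, tangentOfCoord]
  rw [TangentBundle.symmL_trivializationAt hb]
  simp
end Flat

/-! ### The Courant bracket in charts. -/

/-- A norm on a finite-dimensional Lie algebra. -/
@[reducible] def algNorm (𝔡 : Type*) [LieRing 𝔡] [LieAlgebra ℝ 𝔡] [Module.Finite ℝ 𝔡] :
    NormedAddCommGroup 𝔡 :=
  NormedAddCommGroup.induced 𝔡 (Fin (Module.finrank ℝ 𝔡) → ℝ)
    (Module.finBasis ℝ 𝔡).equivFun.toLinearMap (Module.finBasis ℝ 𝔡).equivFun.injective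

attribute [local instance low] algNorm

/-- The normed space structure belonging to `algNorm`. -/
@[reducible] def algNormedSpace (𝔡 : Type*) [LieRing 𝔡] [LieAlgebra ℝ 𝔡] [Module.Finite ℝ 𝔡] :
    NormedSpace ℝ 𝔡 :=
  NormedSpace.induced ℝ 𝔡 (Fin (Module.finrank ℝ 𝔡) → ℝ)
    (Module.finBasis ℝ 𝔡).equivFun.toLinearMap

attribute [local instance low] algNormedSpace

section

variable {𝔡 : Type*} [LieRing 𝔡] [LieAlgebra ℝ 𝔡] [Module.Finite ℝ 𝔡] {K : InvariantMetric 𝔡}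
  {EN : Type*} [NormedAddCommGroup EN] [NormedSpace ℝ EN]
  {N : Type*} [TopologicalSpace N] [ChartedSpace EN N] [IsManifold 𝓘(ℝ, EN) ∞ N]
  {E : Type*} [NormedAddCommGroup E] [NormedSpace ℝ E]
  {M : Type*} [TopologicalSpace M] [ChartedSpace E M]

variable (K) in
/-- The metric of `𝔡 × E × E*`. -/
def flatPair [FiniteDimensional ℝ E] :
    (𝔡 × E × (E →L[ℝ] ℝ)) →L[ℝ] (𝔡 × E × (E →L[ℝ] ℝ)) →L[ℝ] ℝ :=
  LinearMap.toContinuousBilinearMap (LinearMap.mk₂ ℝ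
    (fun e e' => K.form e.1 e'.1 - (e.2.2 e'.2.1 + e'.2.2 e.2.1))
    (by intros; simp; ring) (by intros; simp; ring) (by intros; simp; ring)
    (by intros; simp; ring))

lemma flatPair_apply [FiniteDimensional ℝ E] (e e' : 𝔡 × E × (E →L[ℝ] ℝ)) :
    flatPair K e e' = K.form e.1 e'.1 - (e.2.2 e'.2.1 + e'.2.2 e.2.1) := rfl

/-- A section of `𝔡 × TM × T*M` in the chart at `m`. -/
def flatSec (m : M) (σ : ∀ x : M, CFib 𝔡 E x) (y : E) : 𝔡 × E × (E →L[ℝ] ℝ) :=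
  ((σ ((extChartAt 𝓘(ℝ, E) m).symm y)).1, fieldInChart m (fun x => (σ x).2.1) y,
    formInChart m (fun x => (σ x).2.2) y)

/-- A section of `𝔡 × TM × T*M` over `N × M` in the charts at `n` and `m`. -/
def flatSecProd (n : N) (m : M) (e : ∀ p : N × M, CFib 𝔡 E p.2) (z : EN × E) :
    𝔡 × E × (E →L[ℝ] ℝ) :=
  flatSec m (fun x => e ((extChartAt 𝓘(ℝ, EN) n).symm z.1, x)) z.2

omit [Module.Finite ℝ 𝔡] in
lemma flatSec_extChartAt [IsManifold 𝓘(ℝ, E) ∞ M] {m x : M}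
    (hx : x ∈ (extChartAt 𝓘(ℝ, E) m).source) (σ : ∀ x : M, CFib 𝔡 E x) :
    flatSec m σ (extChartAt 𝓘(ℝ, E) m x) =
      ((σ x).1, tangentCoord m x (σ x).2.1, (σ x).2.2.comp (tangentOfCoord m x)) := by
  refine Prod.ext ?_ (Prod.ext ?_ ?_)
  · exact congrArg (fun x => (σ x).1) ((extChartAt 𝓘(ℝ, E) m).left_inv hx)
  · exact fieldInChart_extChartAt hx (fun x => (σ x).2.1)
  · exact formInChart_extChartAt hx (fun x => (σ x).2.2)

omit [Module.Finite ℝ 𝔡] in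
lemma flatSec_extChartAt_self [IsManifold 𝓘(ℝ, E) ∞ M] (m : M) (σ : ∀ x : M, CFib 𝔡 E x) :
    flatSec m σ (extChartAt 𝓘(ℝ, E) m m) = σ m := by
  rw [flatSec_extChartAt (mem_extChartAt_source m)]
  refine Prod.ext rfl (Prod.ext (tangentCoord_self m _) (ContinuousLinearMap.ext fun v => ?_))
  exact congrArg (σ m).2.2 (tangentOfCoord_self m v)

omit [Module.Finite ℝ 𝔡] [IsManifold 𝓘(ℝ, EN) ∞ N] in
lemma flatSecProd_extChartAt {n x : N} (hx : x ∈ (extChartAt 𝓘(ℝ, EN) n).source) (m : M)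
    (e : ∀ p : N × M, CFib 𝔡 E p.2) (y : E) :
    flatSecProd n m e (extChartAt 𝓘(ℝ, EN) n x, y) = flatSec m (fun y => e (x, y)) y :=
  congrArg (fun x => flatSec m (fun y => e (x, y)) y) ((extChartAt 𝓘(ℝ, EN) n).left_inv hx)

lemma dirDeriv_eq_dVec {f : M → 𝔡} {m : M} (hf : MDifferentiableAt 𝓘(ℝ, E) 𝓘(ℝ, 𝔡) f m)
    (v : Tan E m) : dirDeriv f m v = dVec f m v := by
  have h : ∀ i, dFun (E := E) (fun x => (Module.finBasis ℝ 𝔡).repr (f x) i) m v =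
      (Module.finBasis ℝ 𝔡).repr (dVec f m v) i := by
    intro i
    let p : 𝔡 →L[ℝ] ℝ := ((Module.finBasis ℝ 𝔡).coord i).toContinuousLinearMap
    have := (p.hasMFDerivAt (x := f m)).comp m hf.hasMFDerivAt
    exact DFunLike.congr_fun this.mfderiv v
  rw [dirDeriv]
  simp_rw [h]
  exact (Module.finBasis ℝ 𝔡).sum_repr (dVec f m v : 𝔡)

variable [FiniteDimensional ℝ E] [IsManifold 𝓘(ℝ, E) ∞ M]

section SectionDerivatives

variable {σ σ₁ σ₂ : ∀ x : M, CFib 𝔡 E x} {m : M} {D D₁ D₂ : E →L[ℝ] 𝔡 × E × (E →L[ℝ] ℝ)}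

omit [FiniteDimensional ℝ E] in
lemma hasMFDerivAt_algebra (h : HasFDerivAt (flatSec m σ) D (extChartAt 𝓘(ℝ, E) m m))
    {V : Type*} [NormedAddCommGroup V] [NormedSpace ℝ V] (p : 𝔡 →L[ℝ] V) :
    HasMFDerivAt 𝓘(ℝ, E) 𝓘(ℝ, V) (fun x => p (σ x).1) m
      ((p.comp (ContinuousLinearMap.fst ℝ _ _)).comp D) := by
  refine hasMFDerivAt_of_eventuallyEq_comp_extChartAt
    ((p.comp (ContinuousLinearMap.fst ℝ _ _)).hasFDerivAt.comp _ h) ?_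
  filter_upwards [extChartAt_source_mem_nhds (I := 𝓘(ℝ, E)) m] with x hx
  have := flatSec_extChartAt hx σ
  simp only [Function.comp_apply, this]
  rfl

omit [FiniteDimensional ℝ E] [IsManifold 𝓘(ℝ, E) ∞ M] in
lemma hasFDerivAt_fieldInChart (h : HasFDerivAt (flatSec m σ) D (extChartAt 𝓘(ℝ, E) m m)) :
    HasFDerivAt (fieldInChart m (fun x => (σ x).2.1))
      ((ContinuousLinearMap.fst ℝ E (E →L[ℝ] ℝ)).comp ((ContinuousLinearMap.snd ℝ 𝔡 _).comp D))
      (extChartAt 𝓘(ℝ, E) m m) :=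
  (ContinuousLinearMap.fst ℝ E (E →L[ℝ] ℝ)).hasFDerivAt.comp _
    ((ContinuousLinearMap.snd ℝ 𝔡 (E × (E →L[ℝ] ℝ))).hasFDerivAt.comp _ h)

omit [FiniteDimensional ℝ E] [IsManifold 𝓘(ℝ, E) ∞ M] in
lemma hasFDerivAt_formInChart (h : HasFDerivAt (flatSec m σ) D (extChartAt 𝓘(ℝ, E) m m)) :
    HasFDerivAt (formInChart m (fun x => (σ x).2.2))
      ((ContinuousLinearMap.snd ℝ E (E →L[ℝ] ℝ)).comp ((ContinuousLinearMap.snd ℝ 𝔡 _).comp D))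
      (extChartAt 𝓘(ℝ, E) m m) :=
  (ContinuousLinearMap.snd ℝ E (E →L[ℝ] ℝ)).hasFDerivAt.comp _
    ((ContinuousLinearMap.snd ℝ 𝔡 (E × (E →L[ℝ] ℝ))).hasFDerivAt.comp _ h)

omit [FiniteDimensional ℝ E] in
lemma fieldInChart_self (X : ∀ x : M, Tan E x) :
    fieldInChart m X (extChartAt 𝓘(ℝ, E) m m) = X m :=
  (fieldInChart_extChartAt (mem_extChartAt_source m) X).trans (tangentCoord_self m _)

omit [FiniteDimensional ℝ E] in
lemma formInChart_self (α : ∀ x : M, Cotan E x) :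
    formInChart m α (extChartAt 𝓘(ℝ, E) m m) = α m := by
  refine (formInChart_extChartAt (mem_extChartAt_source m) α).trans ?_
  exact ContinuousLinearMap.ext fun v => congrArg (α m) (tangentOfCoord_self m v)

-- The bracket is defined by pulling back the bracket in the chart at `m`; at `m` itself that
-- pullback is the identity.
omit [FiniteDimensional ℝ E] in
lemma mlieBracket_eq_fderiv (X Y : ∀ x : M, Tan E x) :
    VectorField.mlieBracket 𝓘(ℝ, E) X Y m =
      fderiv ℝ (fieldInChart m Y) (extChartAt 𝓘(ℝ, E) m m) (X m) -
      fderiv ℝ (fieldInChart m X) (extChartAt 𝓘(ℝ, E) m m) (Y m) := by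
  rw [← VectorField.mlieBracketWithin_univ, VectorField.mlieBracketWithin_apply]
  rw [mfderiv_extChartAt_self]
  refine (DFunLike.congr_fun (ContinuousLinearMap.inverse_id (R := ℝ) (M := E)) _).trans ?_
  simp only [modelWithCornersSelf_coe, range_id, Set.preimage_univ, Set.univ_inter,
    VectorField.mpullbackWithin_univ]
  have hX := fieldInChart_self (m := m) X
  have hY := fieldInChart_self (m := m) Y
  conv_rhs => rw [← hX, ← hY]
  exact congrFun (VectorField.lieBracketWithin_univ (𝕜 := ℝ) (E := E) (V := fieldInChart m X)
    (W := fieldInChart m Y)) _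

omit [FiniteDimensional ℝ E] in
lemma mlieBracket_flat (h₁ : HasFDerivAt (flatSec m σ₁) D₁ (extChartAt 𝓘(ℝ, E) m m))
    (h₂ : HasFDerivAt (flatSec m σ₂) D₂ (extChartAt 𝓘(ℝ, E) m m)) :
    VectorField.mlieBracket 𝓘(ℝ, E) (fun x => (σ₁ x).2.1) (fun x => (σ₂ x).2.1) m =
      (D₂ (σ₁ m).2.1).2.1 - (D₁ (σ₂ m).2.1).2.1 := by
  rw [mlieBracket_eq_fderiv, (hasFDerivAt_fieldInChart h₁).fderiv,
    (hasFDerivAt_fieldInChart h₂).fderiv]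
  rfl

omit [FiniteDimensional ℝ E] in
lemma lieDerivForm_flat (h₁ : HasFDerivAt (flatSec m σ₁) D₁ (extChartAt 𝓘(ℝ, E) m m))
    (h₂ : HasFDerivAt (flatSec m σ₂) D₂ (extChartAt 𝓘(ℝ, E) m m)) (v : Tan E m) :
    lieDerivForm (fun x => (σ₁ x).2.1) (fun x => (σ₂ x).2.2) m v =
      (D₂ (σ₁ m).2.1).2.2 v + (σ₂ m).2.2 (D₁ v).2.1 := by
  rw [lieDerivForm, (hasFDerivAt_fieldInChart h₁).fderiv, (hasFDerivAt_formInChart h₂).fderiv,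
    fieldInChart_self, formInChart_self, mfderiv_extChartAt_self]
  rfl

omit [FiniteDimensional ℝ E] in
lemma contractExtDeriv_flat (h₁ : HasFDerivAt (flatSec m σ₁) D₁ (extChartAt 𝓘(ℝ, E) m m))
    (Y : ∀ x : M, Tan E x) (v : Tan E m) :
    contractExtDeriv Y (fun x => (σ₁ x).2.2) m v =
      (D₁ (Y m)).2.2 v - (D₁ v).2.2 (Y m) := by
  rw [contractExtDeriv, (hasFDerivAt_formInChart h₁).fderiv,
    fieldInChart_self, mfderiv_extChartAt_self]
  rfl

end SectionDerivatives

section ProdDerivatives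

variable {e : ∀ p : N × M, CFib 𝔡 E p.2} {n : N} {m : M} {D : EN × E →L[ℝ] 𝔡 × E × (E →L[ℝ] ℝ)}

-- With `m` fixed, the fibre `𝔡 × T_m M × T*_m M` is a fixed vector space, so a section can be
-- differentiated in the direction of `N` after any linear map.
omit [FiniteDimensional ℝ E] in
lemma hasMFDerivAt_left
    (h : HasFDerivAt (flatSecProd n m e) D (extChartAt 𝓘(ℝ, EN) n n, extChartAt 𝓘(ℝ, E) m m))
    {V : Type*} [NormedAddCommGroup V] [NormedSpace ℝ V] (p : (𝔡 × E × (E →L[ℝ] ℝ)) →L[ℝ] V) :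
    HasMFDerivAt 𝓘(ℝ, EN) 𝓘(ℝ, V) (fun x : N => p (e (x, m))) n
      ((p.comp D).comp (ContinuousLinearMap.inl ℝ EN E)) := by
  have h1 : HasFDerivAt (fun z : EN => (z, extChartAt 𝓘(ℝ, E) m m))
      (ContinuousLinearMap.inl ℝ EN E) (extChartAt 𝓘(ℝ, EN) n n) :=
    hasFDerivAt_prodMk_left _ _
  have h2 := (p.hasFDerivAt.comp _ h).comp (extChartAt 𝓘(ℝ, EN) n n) h1
  refine hasMFDerivAt_of_eventuallyEq_comp_extChartAt h2 ?_
  filter_upwards [extChartAt_source_mem_nhds (I := 𝓘(ℝ, EN)) n] with x hx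
  refine congrArg p ?_
  exact ((flatSecProd_extChartAt hx m e _).trans (flatSec_extChartAt_self m _)).symm

omit [FiniteDimensional ℝ E] [IsManifold 𝓘(ℝ, E) ∞ M] [IsManifold 𝓘(ℝ, EN) ∞ N] in
lemma hasFDerivAt_right
    (h : HasFDerivAt (flatSecProd n m e) D (extChartAt 𝓘(ℝ, EN) n n, extChartAt 𝓘(ℝ, E) m m)) :
    HasFDerivAt (flatSec m (fun x => e (n, x))) (D.comp (ContinuousLinearMap.inr ℝ EN E))
      (extChartAt 𝓘(ℝ, E) m m) := by
  have h1 : HasFDerivAt (fun y : E => (extChartAt 𝓘(ℝ, EN) n n, y))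
      (ContinuousLinearMap.inr ℝ EN E) (extChartAt 𝓘(ℝ, E) m m) :=
    hasFDerivAt_prodMk_right _ _
  have h2 := h.comp (extChartAt 𝓘(ℝ, E) m m) h1
  refine h2.congr_of_eventuallyEq (Eventually.of_forall fun y => ?_)
  exact (flatSecProd_extChartAt (mem_extChartAt_source n) m e y).symm

end ProdDerivatives

/-- The Courant bracket in charts, paired with a vector `w`. -/
theorem cpair_courantBracket (A : CourantAction K EN N) {e₁ e₂ : ∀ p : N × M, CFib 𝔡 E p.2}
    {n : N} {m : M} {D₁ D₂ : EN × E →L[ℝ] 𝔡 × E × (E →L[ℝ] ℝ)}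
    (h₁ : HasFDerivAt (flatSecProd n m e₁) D₁ (extChartAt 𝓘(ℝ, EN) n n, extChartAt 𝓘(ℝ, E) m m))
    (h₂ : HasFDerivAt (flatSecProd n m e₂) D₂ (extChartAt 𝓘(ℝ, EN) n n, extChartAt 𝓘(ℝ, E) m m))
    (w : CFib 𝔡 E m) :
    cpair K (courantBracket A e₁ e₂ (n, m)) w =
      K.form ⁅(e₁ (n, m)).1, (e₂ (n, m)).1⁆ w.1 +
      flatPair K (E := E) (D₂ (A.anchor n (e₁ (n, m)).1, (e₁ (n, m)).2.1)) w -
      flatPair K (E := E) (D₁ (A.anchor n (e₂ (n, m)).1, (e₂ (n, m)).2.1)) w +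
      flatPair K (E := E) (D₁ (A.anchor n w.1, w.2.1)) (e₂ (n, m)) := by
  have g₁ := hasFDerivAt_right h₁
  have g₂ := hasFDerivAt_right h₂
  let pr₁ : (𝔡 × E × (E →L[ℝ] ℝ)) →L[ℝ] 𝔡 := ContinuousLinearMap.fst ℝ _ _
  let pr₂ : (𝔡 × E × (E →L[ℝ] ℝ)) →L[ℝ] E :=
    (ContinuousLinearMap.fst ℝ _ _).comp (ContinuousLinearMap.snd ℝ _ _)
  let pr₃ : (𝔡 × E × (E →L[ℝ] ℝ)) →L[ℝ] (E →L[ℝ] ℝ) :=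
    (ContinuousLinearMap.snd ℝ _ _).comp (ContinuousLinearMap.snd ℝ _ _)
  have a1 : ∀ v : Tan EN n, dirDeriv (E := EN) (fun x => (e₁ (x, m)).1) n v = (D₁ (v, 0)).1 := by
    intro v
    have := hasMFDerivAt_left h₁ pr₁
    exact (dirDeriv_eq_dVec this.mdifferentiableAt v).trans (DFunLike.congr_fun this.mfderiv v)
  have a2 : ∀ v : Tan EN n, dirDeriv (E := EN) (fun x => (e₂ (x, m)).1) n v = (D₂ (v, 0)).1 := by
    intro v
    have := hasMFDerivAt_left h₂ pr₁
    exact (dirDeriv_eq_dVec this.mdifferentiableAt v).trans (DFunLike.congr_fun this.mfderiv v)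
  have b1 : ∀ v : Tan E m, dirDeriv (E := E) (fun x => (e₁ (n, x)).1) m v = (D₁ (0, v)).1 := by
    intro v
    have := hasMFDerivAt_algebra g₁ (ContinuousLinearMap.id ℝ 𝔡)
    exact (dirDeriv_eq_dVec this.mdifferentiableAt v).trans (DFunLike.congr_fun this.mfderiv v)
  have b2 : ∀ v : Tan E m, dirDeriv (E := E) (fun x => (e₂ (n, x)).1) m v = (D₂ (0, v)).1 := by
    intro v
    have := hasMFDerivAt_algebra g₂ (ContinuousLinearMap.id ℝ 𝔡)
    exact (dirDeriv_eq_dVec this.mdifferentiableAt v).trans (DFunLike.congr_fun this.mfderiv v)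
  have c1 : ∀ v : Tan EN n, dVec (E := EN) (V := E) (fun x => (e₁ (x, m)).2.1) n v =
      (D₁ (v, 0)).2.1 := fun v => DFunLike.congr_fun (hasMFDerivAt_left h₁ pr₂).mfderiv v
  have c2 : ∀ v : Tan EN n, dVec (E := EN) (V := E) (fun x => (e₂ (x, m)).2.1) n v =
      (D₂ (v, 0)).2.1 := fun v => DFunLike.congr_fun (hasMFDerivAt_left h₂ pr₂).mfderiv v
  have d1 : ∀ v : Tan EN n, dVec (E := EN) (V := E →L[ℝ] ℝ) (fun x => (e₁ (x, m)).2.2) n v =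
      (D₁ (v, 0)).2.2 := fun v => DFunLike.congr_fun (hasMFDerivAt_left h₁ pr₃).mfderiv v
  have d2 : ∀ v : Tan EN n, dVec (E := EN) (V := E →L[ℝ] ℝ) (fun x => (e₂ (x, m)).2.2) n v =
      (D₂ (v, 0)).2.2 := fun v => DFunLike.congr_fun (hasMFDerivAt_left h₂ pr₃).mfderiv v
  have k1 : ∀ v : Tan EN n, dFun (E := EN) (fun x => cpair K (e₁ (x, m)) (e₂ (n, m))) n v =
      flatPair K (E := E) (D₁ (v, 0)) (e₂ (n, m)) := fun v =>
    DFunLike.congr_fun (hasMFDerivAt_left h₁ ((flatPair K (E := E)).flip (e₂ (n, m)))).mfderiv v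
  have k2 : ∀ v : Tan E m, dFun (E := E) (fun y => K.form (e₁ (n, y)).1 (e₂ (n, m)).1) m v =
      K.form (D₁ (0, v)).1 (e₂ (n, m)).1 := fun v =>
    DFunLike.congr_fun (hasMFDerivAt_algebra g₁ (K.form.flip (e₂ (n, m)).1).toContinuousLinearMap).mfderiv v
  have l1 : ∀ v : Tan E m, lieDerivForm (fun x => (e₁ (n, x)).2.1) (fun x => (e₂ (n, x)).2.2) m v =
      (D₂ (0, (e₁ (n, m)).2.1)).2.2 v + (e₂ (n, m)).2.2 (D₁ (0, v)).2.1 := lieDerivForm_flat g₁ g₂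
  have l2 : ∀ v : Tan E m, contractExtDeriv (fun x => (e₂ (n, x)).2.1) (fun x => (e₁ (n, x)).2.2) m v =
      (D₁ (0, (e₂ (n, m)).2.1)).2.2 v - (D₁ (0, v)).2.2 (e₂ (n, m)).2.1 :=
    contractExtDeriv_flat g₁ _
  have l3 : VectorField.mlieBracket 𝓘(ℝ, E) (fun x => (e₁ (n, x)).2.1) (fun x => (e₂ (n, x)).2.1) m =
      (D₂ (0, (e₁ (n, m)).2.1)).2.1 - (D₁ (0, (e₂ (n, m)).2.1)).2.1 := mlieBracket_flat g₁ g₂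
  have hD : ∀ (D : EN × E →L[ℝ] 𝔡 × E × (E →L[ℝ] ℝ)) (v : EN) (u : E),
      D (v, u) = D (v, 0) + D (0, u) := by
    intro D v u
    rw [← map_add]; simp
  -- The defining property `⟨ρ^* β, ξ⟩ = β (ρ ξ)`: the last term of the bracket becomes a derivative
  -- of `e₁` along the anchor of `w`.
  have hco : K.form (A.coanchor n (dFun (E := EN) (fun x => cpair K (e₁ (x, m)) (e₂ (n, m))) n)) w.1 =
      flatPair K (E := E) (D₁ (A.anchor n w.1, 0)) (e₂ (n, m)) := by
    refine Eq.trans ?_ (k1 _)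
    rw [CourantAction.coanchor]
    exact LinearMap.BilinForm.apply_toDual_symm_apply (hB := K.nondeg) _ _
  have t1 : K.form (courantBracket A e₁ e₂ (n, m)).1 w.1 =
      K.form ⁅(e₁ (n, m)).1, (e₂ (n, m)).1⁆ w.1 +
      (K.form (D₂ (A.anchor n (e₁ (n, m)).1, 0)).1 w.1 + K.form (D₂ (0, (e₁ (n, m)).2.1)).1 w.1) -
      (K.form (D₁ (A.anchor n (e₂ (n, m)).1, 0)).1 w.1 + K.form (D₁ (0, (e₂ (n, m)).2.1)).1 w.1) +
      flatPair K (E := E) (D₁ (A.anchor n w.1, 0)) (e₂ (n, m)) := by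
    rw [← hco, ← a1, ← a2, ← b1, ← b2]
    simp only [← LinearMap.add_apply, ← LinearMap.sub_apply, ← map_add, ← map_sub]
    rfl
  have t2 : (courantBracket A e₁ e₂ (n, m)).2.2 w.2.1 =
      (D₂ (0, (e₁ (n, m)).2.1)).2.2 w.2.1 + (e₂ (n, m)).2.2 (D₁ (0, w.2.1)).2.1 -
      ((D₁ (0, (e₂ (n, m)).2.1)).2.2 w.2.1 - (D₁ (0, w.2.1)).2.2 (e₂ (n, m)).2.1) +
      (D₂ (A.anchor n (e₁ (n, m)).1, 0)).2.2 w.2.1 - (D₁ (A.anchor n (e₂ (n, m)).1, 0)).2.2 w.2.1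
      - K.form (D₁ (0, w.2.1)).1 (e₂ (n, m)).1 := by
    rw [← l1, ← l2, ← k2, ← d1, ← d2]
    rfl
  have t3 : w.2.2 (courantBracket A e₁ e₂ (n, m)).2.1 =
      w.2.2 (D₂ (0, (e₁ (n, m)).2.1)).2.1 - w.2.2 (D₁ (0, (e₂ (n, m)).2.1)).2.1 +
      w.2.2 (D₂ (A.anchor n (e₁ (n, m)).1, 0)).2.1 -
      w.2.2 (D₁ (A.anchor n (e₂ (n, m)).1, 0)).2.1 := by
    have h : ∀ (a : E →L[ℝ] ℝ) (x₁ x₂ x₃ x₄ : E), a (x₁ - x₂ + x₃ - x₄) = a x₁ - a x₂ + a x₃ - a x₄ := by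
      intros; simp
    refine Eq.trans ?_ (h w.2.2 _ _ _ _)
    exact congrArg w.2.2
      (congrArg₂ (fun (x y : E) => x - y) (congrArg₂ (fun (x y : E) => x + y) l3 (c2 _)) (c1 _))
  have hc : cpair K (courantBracket A e₁ e₂ (n, m)) w =
    K.form (courantBracket A e₁ e₂ (n, m)).1 w.1 - ((courantBracket A e₁ e₂ (n, m)).2.2 w.2.1 +
      w.2.2 (courantBracket A e₁ e₂ (n, m)).2.1) := rfl
  -- In the fixed vector space `𝔡 × E × E*`, the partial derivatives along `N` and `M` recombine
  -- into total derivatives along the anchors `(ρ ξ, X)`.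
  have key : ∀ (v₁ v₂ v : EN) (x₁ x₂ x : 𝔡 × E × (E →L[ℝ] ℝ)) (c : ℝ),
      c + (K.form (D₂ (v₁, 0)).1 x.1 + K.form (D₂ (0, x₁.2.1)).1 x.1) -
      (K.form (D₁ (v₂, 0)).1 x.1 + K.form (D₁ (0, x₂.2.1)).1 x.1) +
      flatPair K (D₁ (v, 0)) x₂ - ((D₂ (0, x₁.2.1)).2.2 x.2.1 + x₂.2.2 (D₁ (0, x.2.1)).2.1 -
      ((D₁ (0, x₂.2.1)).2.2 x.2.1 - (D₁ (0, x.2.1)).2.2 x₂.2.1) +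
      (D₂ (v₁, 0)).2.2 x.2.1 - (D₁ (v₂, 0)).2.2 x.2.1
      - K.form (D₁ (0, x.2.1)).1 x₂.1 + (x.2.2 (D₂ (0, x₁.2.1)).2.1 - x.2.2 (D₁ (0, x₂.2.1)).2.1 +
      x.2.2 (D₂ (v₁, 0)).2.1 - x.2.2 (D₁ (v₂, 0)).2.1)) =
      c + flatPair K (D₂ (v₁, x₁.2.1)) x - flatPair K (D₁ (v₂, x₂.2.1)) x +
      flatPair K (D₁ (v, x.2.1)) x₂ := by
    intro v₁ v₂ v x₁ x₂ x c
    rw [hD D₂ v₁ x₁.2.1, hD D₁ v₂ x₂.2.1, hD D₁ v x.2.1]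
    simp only [map_add, add_apply]
    simp only [flatPair_apply]
    ring
  rw [hc, t1, t2, t3]
  exact key _ _ _ (e₁ (n, m)) (e₂ (n, m)) w _

end

/-! ### Dirac structures along a graph, tested over `M`. -/

section

variable {𝔡 : Type*} [LieRing 𝔡] [LieAlgebra ℝ 𝔡] [Module.Finite ℝ 𝔡] {K : InvariantMetric 𝔡}
  {EN : Type*} [NormedAddCommGroup EN] [NormedSpace ℝ EN]
  {N : Type*} [TopologicalSpace N] [ChartedSpace EN N] [IsManifold 𝓘(ℝ, EN) ∞ N]
  {E : Type*} [NormedAddCommGroup E] [NormedSpace ℝ E] [FiniteDimensional ℝ E]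
  {M : Type*} [TopologicalSpace M] [ChartedSpace E M] [IsManifold 𝓘(ℝ, E) ∞ M]

/-- An element of the fibre `𝔡 × T_m M × T*_m M` in the chart at `m₀`. -/
def flatten (m₀ m : M) (e : CFib 𝔡 E m) : 𝔡 × E × (E →L[ℝ] ℝ) :=
  (e.1, tangentCoord m₀ m e.2.1, e.2.2.comp (tangentOfCoord m₀ m))

lemma flatSec_eq_flatten {m₀ m : M} (hm : m ∈ (extChartAt 𝓘(ℝ, E) m₀).source)
    (σ : ∀ x : M, CFib 𝔡 E x) :
    flatSec m₀ σ (extChartAt 𝓘(ℝ, E) m₀ m) = flatten m₀ m (σ m) := flatSec_extChartAt hm σ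

lemma flatPair_flatten {m₀ m : M} (hm : m ∈ (extChartAt 𝓘(ℝ, E) m₀).source)
    (e e' : CFib 𝔡 E m) : flatPair K (flatten m₀ m e) (flatten m₀ m e') = cpair K e e' := by
  rw [flatPair_apply, cpair, flatten, flatten]
  congr 1
  exact congrArg₂ (fun x y : ℝ => x + y) (congrArg e.2.2 (tangentOfCoord_tangentCoord hm _))
    (congrArg e'.2.2 (tangentOfCoord_tangentCoord hm _))

section Smooth

variable {EB HB : Type*} [NormedAddCommGroup EB] [NormedSpace ℝ EB]
    [TopologicalSpace HB] {I : ModelWithCorners ℝ EB HB}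
    {B : Type*} [TopologicalSpace B] [ChartedSpace HB B]

/-- Smoothness along a map, at a point. -/
def SmoothAlongAt (I : ModelWithCorners ℝ EB HB) (f : B → M) (e : ∀ b : B, CFib 𝔡 E (f b))
    (b₀ : B) : Prop :=
  ContMDiffAt I 𝓘(ℝ, E) ∞ f b₀ ∧
    ContMDiffAt I 𝓘(ℝ, 𝔡 × E × (E →L[ℝ] ℝ)) ∞ (fun b => flatten (f b₀) (f b) (e b)) b₀

lemma SmoothAlongAt.clm_comp {V : Type*} [NormedAddCommGroup V] [NormedSpace ℝ V] {f : B → M}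
    {e : ∀ b : B, CFib 𝔡 E (f b)} {b₀ : B} (h : SmoothAlongAt I f e b₀)
    (l : 𝔡 × E × (E →L[ℝ] ℝ) →L[ℝ] V) :
    ContMDiffAt I 𝓘(ℝ, V) ∞ (fun b => l (flatten (f b₀) (f b) (e b))) b₀ :=
  ContMDiffAt.comp (g := l) (f := fun b => flatten (f b₀) (f b) (e b)) b₀
    l.contMDiff.contMDiffAt h.2

lemma contMDiffAt_of_forall_dual {V : Type*} [NormedAddCommGroup V] [NormedSpace ℝ V]
    [FiniteDimensional ℝ V] {g : B → V} {b₀ : B}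
    (h : ∀ φ : V →ₗ[ℝ] ℝ, ContMDiffAt I 𝓘(ℝ, ℝ) ∞ (fun b => φ (g b)) b₀) :
    ContMDiffAt I 𝓘(ℝ, V) ∞ g b₀ := by
  let L : (Fin (Module.finrank ℝ V) → ℝ) →L[ℝ] V :=
    (Module.finBasis ℝ V).equivFun.symm.toLinearMap.toContinuousLinearMap
  have h1 : ContMDiffAt I 𝓘(ℝ, Fin (Module.finrank ℝ V) → ℝ) ∞
      (fun b i => (Module.finBasis ℝ V).coord i (g b)) b₀ :=
    contMDiffAt_pi_space.2 fun i => h _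
  have h2 := L.contMDiff.contMDiffAt.comp b₀ h1
  refine h2.congr_of_eventuallyEq (Eventually.of_forall fun b => ?_)
  exact ((Module.finBasis ℝ V).equivFun.symm_apply_apply (g b)).symm

/-- Replaces the three componentwise conditions by smoothness of one map into the fixed space `𝔡 × E
× E*`, which can be differentiated. -/
lemma isSmoothAlong_iff {f : B → M} {e : ∀ b : B, CFib 𝔡 E (f b)} :
    IsSmoothAlong I f e ↔ ∀ b₀, SmoothAlongAt I f e b₀ := by
  constructor
  · intro h b₀
    have h1 := contMDiffAt_tangent_iff.1 (h.tangent b₀)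
    have h2 := contMDiffAt_cotangent_iff.1 (h.cotangent b₀)
    refine ⟨h1.1, ContMDiffAt.prodMk_space ?_ (ContMDiffAt.prodMk_space h1.2 h2.2)⟩
    exact contMDiffAt_of_forall_dual fun φ => h.algebra φ b₀
  · intro h
    refine ⟨fun φ b₀ => ?_, fun b₀ => ?_, fun b₀ => ?_⟩
    · exact (h b₀).clm_comp (φ.toContinuousLinearMap.comp (ContinuousLinearMap.fst ℝ 𝔡
        (E × (E →L[ℝ] ℝ))))
    · exact contMDiffAt_tangent_iff.2 ⟨(h b₀).1, (h b₀).clm_comp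
        ((ContinuousLinearMap.fst ℝ E (E →L[ℝ] ℝ)).comp
        (ContinuousLinearMap.snd ℝ 𝔡 (E × (E →L[ℝ] ℝ))))⟩
    · exact contMDiffAt_cotangent_iff.2 ⟨(h b₀).1, (h b₀).clm_comp
        ((ContinuousLinearMap.snd ℝ E (E →L[ℝ] ℝ)).comp
        (ContinuousLinearMap.snd ℝ 𝔡 (E × (E →L[ℝ] ℝ))))⟩

lemma SmoothAlongAt.comp {EC HC : Type*} [NormedAddCommGroup EC] [NormedSpace ℝ EC]
    [TopologicalSpace HC] {J : ModelWithCorners ℝ EC HC}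
    {C : Type*} [TopologicalSpace C] [ChartedSpace HC C] {f : B → M}
    {e : ∀ b : B, CFib 𝔡 E (f b)} {g : C → B} {c₀ : C} (he : SmoothAlongAt I f e (g c₀))
    (hg : ContMDiffAt J I ∞ g c₀) : SmoothAlongAt J (fun c => f (g c)) (fun c => e (g c)) c₀ :=
  ⟨he.1.comp c₀ hg, he.2.comp c₀ hg⟩

end Smooth

lemma SmoothAlongAt.differentiableAt_flatSecProd {e : ∀ p : N × M, CFib 𝔡 E p.2} {n : N} {m : M}
    (h : SmoothAlongAt (𝓘(ℝ, EN).prod 𝓘(ℝ, E)) (fun p : N × M => p.2) e (n, m)) :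
    DifferentiableAt ℝ (flatSecProd n m e) (extChartAt 𝓘(ℝ, EN) n n, extChartAt 𝓘(ℝ, E) m m) := by
  have s1 : ContMDiffAt 𝓘(ℝ, EN × E) 𝓘(ℝ, EN) ∞
      (fun z : EN × E => (extChartAt 𝓘(ℝ, EN) n).symm z.1)
      (extChartAt 𝓘(ℝ, EN) n n, extChartAt 𝓘(ℝ, E) m m) :=
    ContMDiffAt.comp (g := (extChartAt 𝓘(ℝ, EN) n).symm) (f := Prod.fst)
      (extChartAt 𝓘(ℝ, EN) n n, extChartAt 𝓘(ℝ, E) m m)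
      ((contMDiffOn_extChartAt_symm n).contMDiffAt
        (extChartAt_target_mem_nhds (I := 𝓘(ℝ, EN)) n))
      (contMDiff_iff_contDiff.2 contDiff_fst).contMDiffAt
  have s2 : ContMDiffAt 𝓘(ℝ, EN × E) 𝓘(ℝ, E) ∞
      (fun z : EN × E => (extChartAt 𝓘(ℝ, E) m).symm z.2)
      (extChartAt 𝓘(ℝ, EN) n n, extChartAt 𝓘(ℝ, E) m m) :=
    ContMDiffAt.comp (g := (extChartAt 𝓘(ℝ, E) m).symm) (f := Prod.snd)
      (extChartAt 𝓘(ℝ, EN) n n, extChartAt 𝓘(ℝ, E) m m)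
      ((contMDiffOn_extChartAt_symm m).contMDiffAt
        (extChartAt_target_mem_nhds (I := 𝓘(ℝ, E)) m))
      (contMDiff_iff_contDiff.2 contDiff_snd).contMDiffAt
  have h2 := ContMDiffAt.comp_of_eq h.2 (s1.prodMk s2)
    (by simp only [extChartAt_to_inv])
  refine ((contMDiffAt_iff_contDiffAt.1 h2).differentiableAt (by simp)).congr_of_eventuallyEq ?_
  have : ∀ᶠ z : EN × E in 𝓝 (extChartAt 𝓘(ℝ, EN) n n, extChartAt 𝓘(ℝ, E) m m),
      z.2 ∈ (extChartAt 𝓘(ℝ, E) m).target :=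
    continuousAt_snd.eventually (extChartAt_target_mem_nhds (I := 𝓘(ℝ, E)) m)
  filter_upwards [this] with z hz
  have := flatSec_eq_flatten ((extChartAt 𝓘(ℝ, E) m).map_target hz)
    (fun x => e ((extChartAt 𝓘(ℝ, EN) n).symm z.1, x))
  rw [(extChartAt 𝓘(ℝ, E) m).right_inv hz] at this
  exact this

lemma SmoothAlongAt.contDiffAt_flatSec {σ : ∀ x : M, CFib 𝔡 E x} {m : M}
    (h : SmoothAlongAt 𝓘(ℝ, E) (fun x : M => x) σ m) :
    ContDiffAt ℝ ∞ (flatSec m σ) (extChartAt 𝓘(ℝ, E) m m) := by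
  have s2 : ContMDiffAt 𝓘(ℝ, E) 𝓘(ℝ, E) ∞ (extChartAt 𝓘(ℝ, E) m).symm (extChartAt 𝓘(ℝ, E) m m) :=
    (contMDiffOn_extChartAt_symm m).contMDiffAt (extChartAt_target_mem_nhds m)
  have h2 := ContMDiffAt.comp_of_eq h.2 s2 (by simp only [extChartAt_to_inv])
  refine (contMDiffAt_iff_contDiffAt.1 h2).congr_of_eventuallyEq ?_
  filter_upwards [extChartAt_target_mem_nhds (I := 𝓘(ℝ, E)) m] with y hy
  have := flatSec_eq_flatten ((extChartAt 𝓘(ℝ, E) m).map_target hy) σ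
  rw [(extChartAt 𝓘(ℝ, E) m).right_inv hy] at this
  exact this

lemma SmoothAlongAt.hasFDerivAt {σ : ∀ x : M, CFib 𝔡 E x} {m : M}
    (h : SmoothAlongAt 𝓘(ℝ, E) (fun x : M => x) σ m) :
    HasFDerivAt (flatSec m σ) (fderiv ℝ (flatSec m σ) (extChartAt 𝓘(ℝ, E) m m))
      (extChartAt 𝓘(ℝ, E) m m) :=
  (h.contDiffAt_flatSec.differentiableAt (by simp)).hasFDerivAt

/-- The restriction to the graph of `μ` of a section over `N × M`, and its derivative. -/
lemma hasFDerivAt_flatSec_graph {e : ∀ p : N × M, CFib 𝔡 E p.2} {μ : M → N} {m : M}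
    {D : EN × E →L[ℝ] 𝔡 × E × (E →L[ℝ] ℝ)}
    (hD : HasFDerivAt (flatSecProd (μ m) m e) D
      (extChartAt 𝓘(ℝ, EN) (μ m) (μ m), extChartAt 𝓘(ℝ, E) m m))
    (hμ : MDifferentiableAt 𝓘(ℝ, E) 𝓘(ℝ, EN) μ m) :
    HasFDerivAt (flatSec m (fun x => e (μ x, x)))
      (D.comp ((show E →L[ℝ] EN from dMap E EN μ m).prod (ContinuousLinearMap.id ℝ E)))
      (extChartAt 𝓘(ℝ, E) m m) := by
  have h1 : HasFDerivAt (writtenInExtChartAt 𝓘(ℝ, E) 𝓘(ℝ, EN) m μ)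
      (show E →L[ℝ] EN from dMap E EN μ m) (extChartAt 𝓘(ℝ, E) m m) :=
    hasFDerivWithinAt_univ.1 (by
      have := hμ.hasMFDerivAt.2
      rw [modelWithCornersSelf_coe, range_id] at this
      exact this)
  have h2 := h1.prodMk (hasFDerivAt_id (𝕜 := ℝ) (extChartAt 𝓘(ℝ, E) m m))
  have h3 : writtenInExtChartAt 𝓘(ℝ, E) 𝓘(ℝ, EN) m μ (extChartAt 𝓘(ℝ, E) m m) =
      extChartAt 𝓘(ℝ, EN) (μ m) (μ m) := by
    simp only [writtenInExtChartAt, Function.comp_apply, extChartAt_to_inv]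
  rw [← h3] at hD
  have h4 := HasFDerivAt.comp (g := flatSecProd (μ m) m e)
    (f := fun y => (writtenInExtChartAt 𝓘(ℝ, E) 𝓘(ℝ, EN) m μ y, y)) _ hD h2
  refine h4.congr_of_eventuallyEq ?_
  have hc : ContinuousAt (fun y => μ ((extChartAt 𝓘(ℝ, E) m).symm y)) (extChartAt 𝓘(ℝ, E) m m) :=
    ContinuousAt.comp (by rw [extChartAt_to_inv]; exact hμ.continuousAt)
      (continuousAt_extChartAt_symm m)
  have hn : ∀ᶠ y in 𝓝 (extChartAt 𝓘(ℝ, E) m m),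
      μ ((extChartAt 𝓘(ℝ, E) m).symm y) ∈ (extChartAt 𝓘(ℝ, EN) (μ m)).source := by
    refine hc.eventually ?_
    simp only [extChartAt_to_inv]
    exact extChartAt_source_mem_nhds (μ m)
  filter_upwards [hn, extChartAt_target_mem_nhds (I := 𝓘(ℝ, E)) m] with y hy hy2
  have e1 := flatSecProd_extChartAt hy m e y
  refine Eq.trans ?_ e1.symm
  have f1 := flatSec_eq_flatten ((extChartAt 𝓘(ℝ, E) m).map_target hy2) (fun x => e (μ x, x))
  have f2 := flatSec_eq_flatten ((extChartAt 𝓘(ℝ, E) m).map_target hy2)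
    (fun x => e (μ ((extChartAt 𝓘(ℝ, E) m).symm y), x))
  rw [(extChartAt 𝓘(ℝ, E) m).right_inv hy2] at f1 f2
  rw [f1, f2]

variable (K) in
/-- The pairing of the Courant bracket of two sections over `M` with `e₃`. -/
def courantTri (m : M) (σ₁ σ₂ : ∀ x : M, CFib 𝔡 E x) (e₃ : CFib 𝔡 E m) : ℝ :=
  K.form ⁅(σ₁ m).1, (σ₂ m).1⁆ e₃.1 +
    flatPair K (fderiv ℝ (flatSec m σ₂) (extChartAt 𝓘(ℝ, E) m m) (σ₁ m).2.1) e₃ -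
    flatPair K (fderiv ℝ (flatSec m σ₁) (extChartAt 𝓘(ℝ, E) m m) (σ₂ m).2.1) e₃ +
    flatPair K (fderiv ℝ (flatSec m σ₁) (extChartAt 𝓘(ℝ, E) m m) e₃.2.1) (σ₂ m)

variable {A : CourantAction K EN N} {μ : M → N} {L : ∀ m : M, Submodule ℝ (CFib 𝔡 E m)}

lemma isSmoothAlong_snd {σ : ∀ x : M, CFib 𝔡 E x} (h : IsSmoothAlong 𝓘(ℝ, E) (fun x : M => x) σ) :
    IsSmoothAlong (𝓘(ℝ, EN).prod 𝓘(ℝ, E)) (fun p : N × M => p.2) (fun p => σ p.2) :=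
  isSmoothAlong_iff.2 fun b => (isSmoothAlong_iff.1 h b.2).comp contMDiffAt_snd

lemma hasFDerivAt_flatSecProd_snd {σ : ∀ x : M, CFib 𝔡 E x} {m : M} (n : N)
    {D : E →L[ℝ] 𝔡 × E × (E →L[ℝ] ℝ)}
    (h : HasFDerivAt (flatSec m σ) D (extChartAt 𝓘(ℝ, E) m m)) :
    HasFDerivAt (flatSecProd n m (fun p => σ p.2)) (D.comp (ContinuousLinearMap.snd ℝ EN E))
      (extChartAt 𝓘(ℝ, EN) n n, extChartAt 𝓘(ℝ, E) m m) :=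
  HasFDerivAt.comp (g := flatSec m σ) (f := Prod.snd)
    (extChartAt 𝓘(ℝ, EN) n n, extChartAt 𝓘(ℝ, E) m m) h hasFDerivAt_snd

/-- Extend `σ₁`, `σ₂` to `N × M` constantly in the direction of `N`. Their bracket lies in the
Lagrangian `L` along the graph, and its derivatives in the direction of `N` drop out. -/
lemma IsDiracAlongGraph.courantTri_eq_zero (hL : IsDiracAlongGraph A μ L)
    {σ₁ σ₂ : ∀ x : M, CFib 𝔡 E x} (h₁ : IsSmoothAlong 𝓘(ℝ, E) (fun x : M => x) σ₁)
    (h₂ : IsSmoothAlong 𝓘(ℝ, E) (fun x : M => x) σ₂)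
    (m₁ : ∀ x, σ₁ x ∈ L x) (m₂ : ∀ x, σ₂ x ∈ L x) {m : M} {e₃ : CFib 𝔡 E m} (h₃ : e₃ ∈ L m) :
    courantTri K m σ₁ σ₂ e₃ = 0 := by
  have h := hL.involutive (fun p => σ₁ p.2) (fun p => σ₂ p.2) (isSmoothAlong_snd h₁)
    (isSmoothAlong_snd h₂) m₁ m₂ m
  have h' := (hL.lagrangian m _).1 h e₃ h₃
  rw [cpair_courantBracket A
    (hasFDerivAt_flatSecProd_snd (μ m) (isSmoothAlong_iff.1 h₁ m).hasFDerivAt)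
    (hasFDerivAt_flatSecProd_snd (μ m) (isSmoothAlong_iff.1 h₂ m).hasFDerivAt)] at h'
  exact h'

/-- For sections `σ, τ` of an isotropic subbundle, `⟨Dσ v, τ⟩ = - ⟨σ, Dτ v⟩`. -/
lemma flatPair_fderiv_add {σ τ : ∀ x : M, CFib 𝔡 E x} {m : M}
    (hσ : SmoothAlongAt 𝓘(ℝ, E) (fun x : M => x) σ m)
    (hτ : SmoothAlongAt 𝓘(ℝ, E) (fun x : M => x) τ m)
    (h : ∀ x, cpair K (σ x) (τ x) = 0) (v : E) :
    flatPair K (E := E) (σ m) (fderiv ℝ (flatSec m τ) (extChartAt 𝓘(ℝ, E) m m) v) +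
    flatPair K (E := E) (fderiv ℝ (flatSec m σ) (extChartAt 𝓘(ℝ, E) m m) v) (τ m) = 0 := by
  have h1 := (flatPair K (E := E)).hasFDerivAt_of_bilinear hσ.hasFDerivAt hτ.hasFDerivAt
  have h2 : (fun y => flatPair K (flatSec m σ y) (flatSec m τ y)) =ᶠ[𝓝 (extChartAt 𝓘(ℝ, E) m m)]
      fun _ => (0 : ℝ) := by
    filter_upwards [extChartAt_target_mem_nhds (I := 𝓘(ℝ, E)) m] with y hy
    have f1 := flatSec_eq_flatten ((extChartAt 𝓘(ℝ, E) m).map_target hy) σ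
    have f2 := flatSec_eq_flatten ((extChartAt 𝓘(ℝ, E) m).map_target hy) τ
    rw [(extChartAt 𝓘(ℝ, E) m).right_inv hy] at f1 f2
    rw [f1, f2, flatPair_flatten ((extChartAt 𝓘(ℝ, E) m).map_target hy), h]
  have h3 := h1.unique ((hasFDerivAt_const (0 : ℝ) _).congr_of_eventuallyEq h2)
  have h4 := DFunLike.congr_fun h3 v
  rw [flatSec_extChartAt_self, flatSec_extChartAt_self] at h4
  exact h4

/-- On sections of an isotropic subbundle, `courantTri` only depends on values. -/
lemma courantTri_congr (hL : ∀ (m : M), ∀ e ∈ L m, ∀ e' ∈ L m, cpair K e e' = 0)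
    (hsub : ∀ (m : M), ∀ e ∈ L m, ∃ σ : ∀ x : M, CFib 𝔡 E x,
      IsSmoothAlong 𝓘(ℝ, E) (fun x : M => x) σ ∧ (∀ x, σ x ∈ L x) ∧ σ m = e)
    {σ₁ σ₂ τ₁ τ₂ : ∀ x : M, CFib 𝔡 E x} (h₁ : IsSmoothAlong 𝓘(ℝ, E) (fun x : M => x) σ₁)
    (h₂ : IsSmoothAlong 𝓘(ℝ, E) (fun x : M => x) σ₂)
    (k₁ : IsSmoothAlong 𝓘(ℝ, E) (fun x : M => x) τ₁)
    (k₂ : IsSmoothAlong 𝓘(ℝ, E) (fun x : M => x) τ₂)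
    (m₁ : ∀ x, σ₁ x ∈ L x) (m₂ : ∀ x, σ₂ x ∈ L x) (n₁ : ∀ x, τ₁ x ∈ L x) (n₂ : ∀ x, τ₂ x ∈ L x)
    {m : M} (e₁ : σ₁ m = τ₁ m) (e₂ : σ₂ m = τ₂ m) {e₃ : CFib 𝔡 E m} (h₃ : e₃ ∈ L m) :
    courantTri K m σ₁ σ₂ e₃ = courantTri K m τ₁ τ₂ e₃ := by
  -- Extend `e` to a section `κ` of `L`. Differentiating `⟨σ, κ⟩ = 0` gives `⟨Dσ v, e⟩ = - ⟨σ m, Dκ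
  -- v⟩`, where `σ` enters only through its value. Each derivative in `courantTri` is paired in this
  -- way with an element of `L m`.
  have key : ∀ {σ τ : ∀ x : M, CFib 𝔡 E x}, IsSmoothAlong 𝓘(ℝ, E) (fun x : M => x) σ →
      IsSmoothAlong 𝓘(ℝ, E) (fun x : M => x) τ → (∀ x, σ x ∈ L x) → (∀ x, τ x ∈ L x) →
      σ m = τ m → ∀ e ∈ L m, ∀ v : E,
      flatPair K (E := E) (fderiv ℝ (flatSec m σ) (extChartAt 𝓘(ℝ, E) m m) v) e =
      flatPair K (E := E) (fderiv ℝ (flatSec m τ) (extChartAt 𝓘(ℝ, E) m m) v) e := by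
    intro σ τ hσ hτ mσ mτ hst e he v
    obtain ⟨κ, hκ, mκ, rfl⟩ := hsub m e he
    have t1 := flatPair_fderiv_add (isSmoothAlong_iff.1 hσ m) (isSmoothAlong_iff.1 hκ m)
      (fun x => hL x _ (mσ x) _ (mκ x)) v
    have t2 := flatPair_fderiv_add (isSmoothAlong_iff.1 hτ m) (isSmoothAlong_iff.1 hκ m)
      (fun x => hL x _ (mτ x) _ (mκ x)) v
    rw [hst] at t1
    linarith
  unfold courantTri
  rw [e₁, e₂]
  exact congrArg₂ (fun x y : ℝ => x + y) (congrArg₂ (fun x y : ℝ => x - y)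
    (congrArg (fun x : ℝ => K.form ⁅(τ₁ m).1, (τ₂ m).1⁆ e₃.1 + x) (key h₂ k₂ m₂ n₂ e₂ _ h₃ _))
    (key h₁ k₁ m₁ n₁ e₁ _ h₃ _)) (key h₁ k₁ m₁ n₁ e₁ _ (n₂ m) _)

/-- A criterion for Dirac structures along graphs. -/
theorem isDiracAlongGraph_of_courantTri (hμ : ContMDiff 𝓘(ℝ, E) 𝓘(ℝ, EN) ∞ μ)
    (lagr : ∀ (m : M) (e : CFib 𝔡 E m), e ∈ L m ↔ ∀ e' ∈ L m, cpair K e e' = 0)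
    (hsub : ∀ (m : M), ∀ e ∈ L m, ∃ σ : ∀ x : M, CFib 𝔡 E x,
      IsSmoothAlong 𝓘(ℝ, E) (fun x : M => x) σ ∧ (∀ x, σ x ∈ L x) ∧ σ m = e)
    (hanchor : ∀ (m : M), ∀ e ∈ L m, dMap E EN μ m e.2.1 = A.anchor (μ m) e.1)
    (htri : ∀ (m : M), ∀ e₁ ∈ L m, ∀ e₂ ∈ L m, ∀ e₃ ∈ L m, ∃ σ₁ σ₂ : ∀ x : M, CFib 𝔡 E x,
      IsSmoothAlong 𝓘(ℝ, E) (fun x : M => x) σ₁ ∧ IsSmoothAlong 𝓘(ℝ, E) (fun x : M => x) σ₂ ∧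
      (∀ x, σ₁ x ∈ L x) ∧ (∀ x, σ₂ x ∈ L x) ∧ σ₁ m = e₁ ∧ σ₂ m = e₂ ∧
      courantTri K m σ₁ σ₂ e₃ = 0) : IsDiracAlongGraph A μ L where
  lagrangian := lagr
  subbundle := hsub
  involutive := by
    intro e₁ e₂ h₁ h₂ m₁ m₂ m
    rw [lagr]
    intro e₃ h₃
    obtain ⟨σ₁, σ₂, s₁, s₂, l₁, l₂, v₁, v₂, htr⟩ := htri m _ (m₁ m) _ (m₂ m) e₃ h₃
    have d₁ := (isSmoothAlong_iff.1 h₁ (μ m, m)).differentiableAt_flatSecProd.hasFDerivAt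
    have d₂ := (isSmoothAlong_iff.1 h₂ (μ m, m)).differentiableAt_flatSecProd.hasFDerivAt
    rw [cpair_courantBracket A d₁ d₂]
    have hμm : MDifferentiableAt 𝓘(ℝ, E) 𝓘(ℝ, EN) μ m := (hμ m).mdifferentiableAt (by simp)
    have g₁ := hasFDerivAt_flatSec_graph d₁ hμm
    have g₂ := hasFDerivAt_flatSec_graph d₂ hμm
    have k₁ : IsSmoothAlong 𝓘(ℝ, E) (fun x : M => x) (fun x => e₁ (μ x, x)) :=
      isSmoothAlong_iff.2 fun x => SmoothAlongAt.comp (g := fun x => (μ x, x))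
        (isSmoothAlong_iff.1 h₁ (μ x, x)) ((hμ x).prodMk contMDiffAt_id)
    have k₂ : IsSmoothAlong 𝓘(ℝ, E) (fun x : M => x) (fun x => e₂ (μ x, x)) :=
      isSmoothAlong_iff.2 fun x => SmoothAlongAt.comp (g := fun x => (μ x, x))
        (isSmoothAlong_iff.1 h₂ (μ x, x)) ((hμ x).prodMk contMDiffAt_id)
    have hc := courantTri_congr (fun m e he => (lagr m e).1 he) hsub k₁ k₂ s₁ s₂ m₁ m₂ l₁ l₂
      v₁.symm v₂.symm h₃
    rw [htr, courantTri, g₁.fderiv, g₂.fderiv] at hc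
    -- The bracket differentiates `e₁` and `e₂` along vectors `(ρ ξ, X)`. These equal `(dμ X, X)`,
    -- hence are tangent to the graph, and the derivatives are those of the restrictions.
    rw [← hanchor m _ (m₁ m), ← hanchor m _ (m₂ m), ← hanchor m _ h₃]
    exact hc

end

/-! ### Smooth functions with prescribed germ or differential. -/

section Functions

variable {E : Type*} [NormedAddCommGroup E] [NormedSpace ℝ E] [FiniteDimensional ℝ E]
  {M : Type*} [TopologicalSpace M] [ChartedSpace E M] [IsManifold 𝓘(ℝ, E) ∞ M]
  {V : Type*} [NormedAddCommGroup V] [NormedSpace ℝ V]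

omit [FiniteDimensional ℝ E] in
lemma exists_clm_apply_ne_zero {v : E} (hv : v ≠ 0) : ∃ a : E →L[ℝ] ℝ, a v ≠ 0 :=
  SeparatingDual.exists_ne_zero hv

/-- Multiply by a bump function supported in `U` and equal to `1` near `m`. -/
lemma exists_contMDiff_eventuallyEq [T2Space M] {U : Set M} (hU : IsOpen U) {m : M} (hm : m ∈ U)
    {u : M → V} (hu : ContMDiffOn 𝓘(ℝ, E) 𝓘(ℝ, V) ∞ u U) :
    ∃ f : M → V, ContMDiff 𝓘(ℝ, E) 𝓘(ℝ, V) ∞ f ∧ f =ᶠ[𝓝 m] u := by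
  obtain ⟨b, hb⟩ := ((SmoothBumpFunction.nhds_basis_support (I := 𝓘(ℝ, E))
    (hU.mem_nhds hm)).mem_iff).1 (univ_mem : (univ : Set M) ∈ 𝓝 m)
  refine ⟨fun x => b x • u x, contMDiff_of_tsupport fun x hx => ?_, ?_⟩
  · have hx' : x ∈ U := hb.1 (tsupport_smul_subset_left (fun x => b x) u hx)
    exact b.contMDiffAt.smul (hu.contMDiffAt (hU.mem_nhds hx'))
  · filter_upwards [b.eventuallyEq_one] with x hx
    rw [hx, Pi.one_apply, one_smul]

omit [FiniteDimensional ℝ E] in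
lemma hasFDerivAt_comp_extChartAt_symm {f : M → V} {m : M}
    (hf : MDifferentiableAt 𝓘(ℝ, E) 𝓘(ℝ, V) f m) :
    HasFDerivAt (f ∘ (extChartAt 𝓘(ℝ, E) m).symm) (show E →L[ℝ] V from dVec f m)
      (extChartAt 𝓘(ℝ, E) m m) := by
  have h := hasFDerivWithinAt_univ.1 (by
      have := hf.hasMFDerivAt.2
      rw [modelWithCornersSelf_coe, range_id] at this
      exact this)
  exact h

/-- A linear function of the coordinates, cut off away from `m`. -/
lemma exists_dFun_eq [T2Space M] (m : M) (α : Cotan E m) :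
    ∃ f : M → ℝ, ContMDiff 𝓘(ℝ, E) 𝓘(ℝ, ℝ) ∞ f ∧ dFun f m = α := by
  let a : E →L[ℝ] ℝ := α
  have hu : ContMDiffOn 𝓘(ℝ, E) 𝓘(ℝ, ℝ) ∞ (fun x => a (extChartAt 𝓘(ℝ, E) m x))
      (chartAt E m).source := fun x hx =>
    (ContMDiffAt.comp (g := a) (f := extChartAt 𝓘(ℝ, E) m) x a.contMDiff.contMDiffAt
      (contMDiffAt_extChartAt' hx)).contMDiffWithinAt
  obtain ⟨f, hf, hfu⟩ := exists_contMDiff_eventuallyEq (chartAt E m).open_source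
    (mem_chart_source E m) hu
  exact ⟨f, hf, (hasMFDerivAt_of_eventuallyEq_comp_extChartAt a.hasFDerivAt hfu).mfderiv⟩

omit [FiniteDimensional ℝ E] in
lemma dFun_comp_tangentOfCoord {m₀ m : M} (hm : m ∈ (extChartAt 𝓘(ℝ, E) m₀).source) {f : M → ℝ}
    (hf : MDifferentiableAt 𝓘(ℝ, E) 𝓘(ℝ, ℝ) f m) :
    (dFun f m).comp (tangentOfCoord m₀ m) =
      fderiv ℝ (f ∘ (extChartAt 𝓘(ℝ, E) m₀).symm) (extChartAt 𝓘(ℝ, E) m₀ m) := by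
  ext v
  refine (dVec_eq_fderiv hm hf (tangentOfCoord m₀ m v)).trans ?_
  exact congrArg _ (tangentCoord_tangentOfCoord hm v)

omit [FiniteDimensional ℝ E] in
lemma contDiffAt_comp_extChartAt_symm {m₀ m : M} (hm : m ∈ (extChartAt 𝓘(ℝ, E) m₀).source)
    {f : M → V} (hf : ContMDiffAt 𝓘(ℝ, E) 𝓘(ℝ, V) ∞ f m) :
    ContDiffAt ℝ ∞ (f ∘ (extChartAt 𝓘(ℝ, E) m₀).symm) (extChartAt 𝓘(ℝ, E) m₀ m) := by
  have hs : ContMDiffAt 𝓘(ℝ, E) 𝓘(ℝ, E) ∞ (extChartAt 𝓘(ℝ, E) m₀).symm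
      (extChartAt 𝓘(ℝ, E) m₀ m) :=
    (contMDiffOn_extChartAt_symm m₀).contMDiffAt
      (extChartAt_target_mem_nhds' ((extChartAt 𝓘(ℝ, E) m₀).map_source hm))
  exact contMDiffAt_iff_contDiffAt.1
    (ContMDiffAt.comp_of_eq hf hs ((extChartAt 𝓘(ℝ, E) m₀).left_inv hm))

omit [FiniteDimensional ℝ E] in
lemma contMDiffAt_dFun_comp_tangentOfCoord {m : M} {f : M → ℝ}
    (hf : ContMDiff 𝓘(ℝ, E) 𝓘(ℝ, ℝ) ∞ f) :
    ContMDiffAt 𝓘(ℝ, E) 𝓘(ℝ, E →L[ℝ] ℝ) ∞ (fun x => (dFun (E := E) f x).comp (tangentOfCoord m x)) m := by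
  have h1 : ContDiffAt ℝ ∞ (fderiv ℝ (f ∘ (extChartAt 𝓘(ℝ, E) m).symm))
      (extChartAt 𝓘(ℝ, E) m m) :=
    (contDiffAt_comp_extChartAt_symm (mem_extChartAt_source m) (hf m)).fderiv_right (by simp)
  refine (ContMDiffAt.comp (g := fderiv ℝ (f ∘ (extChartAt 𝓘(ℝ, E) m).symm))
    (f := extChartAt 𝓘(ℝ, E) m) m (contMDiffAt_iff_contDiffAt.2 h1)
    (contMDiffAt_extChartAt (I := 𝓘(ℝ, E)))).congr_of_eventuallyEq ?_
  filter_upwards [extChartAt_source_mem_nhds (I := 𝓘(ℝ, E)) m] with x hx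
  exact dFun_comp_tangentOfCoord hx ((hf x).mdifferentiableAt (by simp))

end Functions

/-! ### The anchor of a Dirac structure is tangent to its support. -/

section

variable {𝔡 : Type*} [LieRing 𝔡] [LieAlgebra ℝ 𝔡] [Module.Finite ℝ 𝔡] {K : InvariantMetric 𝔡}
  {EN : Type*} [NormedAddCommGroup EN] [NormedSpace ℝ EN]
  {N : Type*} [TopologicalSpace N] [ChartedSpace EN N] [IsManifold 𝓘(ℝ, EN) ∞ N]
  {E : Type*} [NormedAddCommGroup E] [NormedSpace ℝ E] [FiniteDimensional ℝ E]
  {M : Type*} [TopologicalSpace M] [ChartedSpace E M] [IsManifold 𝓘(ℝ, E) ∞ M]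
  {EB HB : Type*} [NormedAddCommGroup EB] [NormedSpace ℝ EB]
    [TopologicalSpace HB] {I : ModelWithCorners ℝ EB HB}
    {B : Type*} [TopologicalSpace B] [ChartedSpace HB B]

lemma flatten_smul (m₀ m : M) (r : ℝ) (e : CFib 𝔡 E m) :
    flatten m₀ m (r • e) = r • flatten m₀ m e := by
  unfold flatten
  exact Prod.ext rfl (Prod.ext (map_smul _ _ _) rfl)

lemma flatten_add (m₀ m : M) (e e' : CFib 𝔡 E m) :
    flatten m₀ m (e + e') = flatten m₀ m e + flatten m₀ m e' := by
  unfold flatten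
  exact Prod.ext rfl (Prod.ext (map_add _ _ _) (ContinuousLinearMap.add_comp _ _ _))

lemma SmoothAlongAt.smul {f : B → M} {e : ∀ b : B, CFib 𝔡 E (f b)} {b₀ : B} {g : B → ℝ}
    (hg : ContMDiffAt I 𝓘(ℝ, ℝ) ∞ g b₀) (he : SmoothAlongAt I f e b₀) :
    SmoothAlongAt I f (fun b => g b • e b) b₀ := by
  refine ⟨he.1, (hg.smul he.2).congr_of_eventuallyEq (Eventually.of_forall fun b => ?_)⟩
  exact flatten_smul _ _ _ _

lemma smoothAlongAt_dFun (w : 𝔡) {k : M → ℝ} (hk : ContMDiff 𝓘(ℝ, E) 𝓘(ℝ, ℝ) ∞ k) (m : M) :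
    SmoothAlongAt 𝓘(ℝ, E) (fun x : M => x)
      (fun x => ((w, 0, dFun k x) : CFib 𝔡 E x)) m := by
  refine ⟨contMDiffAt_id, contMDiffAt_const.prodMk_space (ContMDiffAt.prodMk_space ?_
    (contMDiffAt_dFun_comp_tangentOfCoord (E := E) hk))⟩
  exact (contMDiffAt_const (c := (0 : E))).congr_of_eventuallyEq
    (Eventually.of_forall fun b => map_zero _)

/-- At a zero of `f`, only the derivative of `f` survives in the product rule. -/
lemma hasFDerivAt_flatSecProd_smul {n : N} {m : M} {f : N × M → ℝ} {F : EN × E →L[ℝ] ℝ}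
    (hF : HasFDerivAt (fun z : EN × E =>
        f ((extChartAt 𝓘(ℝ, EN) n).symm z.1, (extChartAt 𝓘(ℝ, E) m).symm z.2)) F
      (extChartAt 𝓘(ℝ, EN) n n, extChartAt 𝓘(ℝ, E) m m)) (h0 : f (n, m) = 0)
    {σ : ∀ x : M, CFib 𝔡 E x} (hσ : SmoothAlongAt 𝓘(ℝ, E) (fun x : M => x) σ m) :
    HasFDerivAt (flatSecProd n m (fun p => f p • σ p.2))
      (F.smulRight (show 𝔡 × E × (E →L[ℝ] ℝ) from σ m))
      (extChartAt 𝓘(ℝ, EN) n n, extChartAt 𝓘(ℝ, E) m m) := by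
  have g₄ := HasFDerivAt.comp (f := Prod.snd)
    (extChartAt 𝓘(ℝ, EN) n n, extChartAt 𝓘(ℝ, E) m m) hσ.hasFDerivAt hasFDerivAt_snd
  have g₅ := hF.smul g₄
  have hz : f ((extChartAt 𝓘(ℝ, EN) n).symm (extChartAt 𝓘(ℝ, EN) n n),
      (extChartAt 𝓘(ℝ, E) m).symm (extChartAt 𝓘(ℝ, E) m m)) = 0 := by
    rw [extChartAt_to_inv, extChartAt_to_inv, h0]
  rw [hz, zero_smul, zero_add, Function.comp_apply, flatSec_extChartAt_self] at g₅
  refine g₅.congr_of_eventuallyEq ?_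
  have : ∀ᶠ z : EN × E in 𝓝 (extChartAt 𝓘(ℝ, EN) n n, extChartAt 𝓘(ℝ, E) m m),
      z.2 ∈ (extChartAt 𝓘(ℝ, E) m).target :=
    continuousAt_snd.eventually (extChartAt_target_mem_nhds (I := 𝓘(ℝ, E)) m)
  filter_upwards [this] with z hz
  have f1 := flatSec_eq_flatten ((extChartAt 𝓘(ℝ, E) m).map_target hz)
    (fun x => f ((extChartAt 𝓘(ℝ, EN) n).symm z.1, x) • σ x)
  have f2 := flatSec_eq_flatten ((extChartAt 𝓘(ℝ, E) m).map_target hz) σ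
  rw [(extChartAt 𝓘(ℝ, E) m).right_inv hz] at f1 f2
  refine f1.trans ((flatten_smul _ _ _ _).trans ?_)
  rw [← f2]
  rfl

variable {A : CourantAction K EN N} {μ : M → N} {L : ∀ m : M, Submodule ℝ (CFib 𝔡 E m)}

/-- If `a(σ) = (ρ ξ, X)` is not tangent to the graph, some `f` vanishing on the graph has `a(σ) f ≠
0`. For every `W`, the section `f W` restricts to zero in `L`, so `[σ, f W] = (a(σ) f) W` lies in
`L` at that point. Then `σ` is orthogonal to all such `W`, which forces `ξ = 0` and `X = 0`, a
contradiction. -/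
lemma IsDiracAlongGraph.anchor [FiniteDimensional ℝ EN] [T2Space N] [T2Space M]
    (hL : IsDiracAlongGraph A μ L)
    (hμ : ContMDiff 𝓘(ℝ, E) 𝓘(ℝ, EN) ∞ μ) {m : M} {e : CFib 𝔡 E m} (he : e ∈ L m) :
    dMap E EN μ m e.2.1 = A.anchor (μ m) e.1 := by
  by_contra hne
  obtain ⟨β, hβ⟩ : ∃ β : Cotan EN (μ m), β (A.anchor (μ m) e.1 - dMap E EN μ m e.2.1) ≠ 0 :=
    exists_clm_apply_ne_zero (E := EN) (sub_ne_zero.2 (Ne.symm hne))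
  obtain ⟨h, hh, hdh⟩ := exists_dFun_eq (E := EN) (μ m) β
  obtain ⟨σ, hσ, mσ, rfl⟩ := hL.subbundle m e he
  -- Here `W = (w, 0, dk)` and `f (n, x) = h n - h (μ x)`, where `dh = β` separates `ρ ξ` from `dμ
  -- X`.
  have key : ∀ (w : 𝔡) (k : M → ℝ), ContMDiff 𝓘(ℝ, E) 𝓘(ℝ, ℝ) ∞ k →
      cpair K ((w, 0, dFun k m) : CFib 𝔡 E m) (σ m) = 0 := by
    intro w k hk
    have hf : ContMDiff (𝓘(ℝ, EN).prod 𝓘(ℝ, E)) 𝓘(ℝ, ℝ) ∞ (fun p : N × M => h p.1 - h (μ p.2)) :=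
      (hh.comp contMDiff_fst).sub (hh.comp (hμ.comp contMDiff_snd))
    have hw : ∀ m, SmoothAlongAt 𝓘(ℝ, E) (fun x : M => x)
      (fun x => ((w, 0, dFun k x) : CFib 𝔡 E x)) m := smoothAlongAt_dFun w hk
    have h₂ : IsSmoothAlong (𝓘(ℝ, EN).prod 𝓘(ℝ, E)) (fun p : N × M => p.2)
        (fun p => (h p.1 - h (μ p.2)) • ((w, 0, dFun k p.2) : CFib 𝔡 E p.2)) :=
      isSmoothAlong_iff.2 fun p =>
        SmoothAlongAt.smul (hf p) ((hw p.2).comp (J := 𝓘(ℝ, EN).prod 𝓘(ℝ, E)) (g := Prod.snd) (c₀ := p) contMDiffAt_snd)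
    have hin := hL.involutive (fun p => σ p.2)
      (fun p => (h p.1 - h (μ p.2)) • ((w, 0, dFun k p.2) : CFib 𝔡 E p.2))
      (isSmoothAlong_snd (EN := EN) hσ) h₂ mσ
      (fun x => by rw [sub_self, zero_smul]; exact zero_mem _) m
    have hp := (hL.lagrangian m _).1 hin _ (mσ m)
    have d₁ := hasFDerivAt_flatSecProd_snd (EN := EN) (μ m) (isSmoothAlong_iff.1 hσ m).hasFDerivAt
    have g₁ := hasFDerivAt_comp_extChartAt_symm (E := EN) (m := μ m)
      ((hh (μ m)).mdifferentiableAt (by simp))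
    have g₂ := hasFDerivAt_comp_extChartAt_symm (E := E) (m := m) (f := h ∘ μ)
      (((hh.comp hμ) m).mdifferentiableAt (by simp))
    have g₃ := (HasFDerivAt.comp (f := Prod.fst)
        (extChartAt 𝓘(ℝ, EN) (μ m) (μ m), extChartAt 𝓘(ℝ, E) m m) g₁ hasFDerivAt_fst).sub
      (HasFDerivAt.comp (f := Prod.snd)
        (extChartAt 𝓘(ℝ, EN) (μ m) (μ m), extChartAt 𝓘(ℝ, E) m m) g₂ hasFDerivAt_snd)
    have d₂ := hasFDerivAt_flatSecProd_smul (f := fun p : N × M => h p.1 - h (μ p.2)) g₃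
      (by simp) (hw m)
    rw [cpair_courantBracket A d₁ d₂] at hp
    -- The second section has value `s • W` with `s = 0` and derivative `c • W` along the anchor, so
    -- a single term of the bracket remains.
    have aux : ∀ (l : 𝔡 →ₗ[ℝ] EN) (ξ : 𝔡) (s c : ℝ) (_ : s = 0) (W S Z : 𝔡 × E × (E →L[ℝ] ℝ))
        (D : EN × E →L[ℝ] 𝔡 × E × (E →L[ℝ] ℝ)),
        K.form ⁅ξ, (s • W).1⁆ S.1 + flatPair K (c • W) S -
          flatPair K (D (l (s • W).1, (s • W).2.1)) S + flatPair K Z (s • W) = 0 →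
        c * flatPair K W S = 0 := by
      rintro l ξ s c rfl W S Z D h
      have h0 : D ((0 : EN), (0 : E)) = 0 := map_zero D
      simpa [h0] using h
    have h1 := aux (A.anchor (μ m)) _ _ _ (sub_self (h (μ m))) _ _ _ _ hp
    refine (mul_eq_zero.1 h1).resolve_left (fun h2 => hβ ?_)
    rw [map_sub, sub_eq_zero, ← hdh]
    refine (sub_eq_zero.1 h2).trans ?_
    exact DFunLike.congr_fun (mfderiv_comp m ((hh (μ m)).mdifferentiableAt (by simp))
      ((hμ m).mdifferentiableAt (by simp))) _
  have hξ : (σ m).1 = 0 := by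
    refine K.nondeg.2 _ fun w => ?_
    have := key w 0 contMDiff_const
    have h0 : dFun (E := E) (0 : M → ℝ) m = 0 := mfderiv_const
    rw [h0, cpair] at this
    simpa using this
  have hX : (σ m).2.1 = 0 := by
    by_contra hX
    obtain ⟨α, hα⟩ : ∃ α : Cotan E m, α (σ m).2.1 ≠ 0 := exists_clm_apply_ne_zero (E := E) hX
    obtain ⟨k, hk, hdk⟩ := exists_dFun_eq (E := E) m α
    have := key 0 k hk
    rw [hdk, cpair] at this
    refine hα ?_
    simpa using this
  rw [hξ, hX, map_zero, map_zero] at hne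
  exact hne rfl

end

/-! ### Linear algebra of Manin pairs and of their reduction. -/

section

variable {𝔡 : Type*} [LieRing 𝔡] [LieAlgebra ℝ 𝔡] {K : InvariantMetric 𝔡}

namespace InvariantMetric

lemma form_comm (K : InvariantMetric 𝔡) (x y : 𝔡) : K.form x y = K.form y x := K.symm.eq x y

variable [Module.Finite ℝ 𝔡]

lemma perp_perp (K : InvariantMetric 𝔡) (V : Submodule ℝ 𝔡) : K.perp (K.perp V) = V :=
  LinearMap.BilinForm.orthogonal_orthogonal K.nondeg K.symm.isRefl V

lemma mem_of_form_eq_zero {V : Submodule ℝ 𝔡} {x : 𝔡} (h : ∀ y ∈ K.perp V, K.form y x = 0) :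
    x ∈ V := by
  rw [← K.perp_perp V]
  exact h

variable {𝔥 𝔠 : Submodule ℝ 𝔡}

/-- Double orthogonality applied to `(𝔥 + 𝔠)ᗮ = 𝔥ᗮ ∩ 𝔠ᗮ = 𝔥 ∩ 𝔠ᗮ`. -/
lemma mem_sup_of_form_eq_zero (h𝔥 : K.IsLagrangian 𝔥) {x : 𝔡}
    (h : ∀ y ∈ 𝔥 ⊓ K.perp 𝔠, K.form y x = 0) : x ∈ 𝔥 ⊔ 𝔠 := by
  refine mem_of_form_eq_zero (K := K) fun y hy => h y ⟨?_, ?_⟩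
  · rw [← h𝔥]
    exact fun z hz => hy z (le_sup_left (a := 𝔥) (b := 𝔠) hz)
  · exact fun z hz => hy z (le_sup_right (a := 𝔥) (b := 𝔠) hz)

lemma IsLagrangian.form_eq_zero (h𝔥 : K.IsLagrangian 𝔥) {x y : 𝔡} (hx : x ∈ 𝔥) (hy : y ∈ 𝔥) :
    K.form x y = 0 := by
  rw [← h𝔥] at hy
  exact hy x hx

end InvariantMetric

section

variable [Module.Finite ℝ 𝔡]

lemma mem_reduceSubalgebra {𝔥 𝔠 : LieSubalgebra ℝ 𝔡} {η : K.Reduced 𝔠} :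
    η ∈ (K.reduceSubalgebra 𝔠 𝔥).toSubmodule ↔ ∃ ξ : 𝔠, (ξ : 𝔡) ∈ 𝔥 ∧ K.toReduced 𝔠 ξ = η :=
  Iff.rfl

/-- If the class of `ξ` is orthogonal to `𝔥_𝔠`, then `ξ ∈ (𝔥 ∩ 𝔠)ᗮ = 𝔥 + 𝔠ᗮ`. Its component in `𝔥`
lies in `𝔠` because `𝔠ᗮ ⊆ 𝔠`, and it represents the same class. -/
theorem isLagrangian_reduceSubalgebra {𝔥 𝔠 : LieSubalgebra ℝ 𝔡}
    (h𝔥 : K.IsLagrangian 𝔥.toSubmodule) (h𝔠 : K.IsCoisotropic 𝔠.toSubmodule) :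
    (K.reduce 𝔠).IsLagrangian (K.reduceSubalgebra 𝔠 𝔥).toSubmodule := by
  refine le_antisymm (fun η hη => ?_) ?_
  · obtain ⟨ξ, rfl⟩ := K.toReduced_surjective 𝔠 η
    have h1 : (ξ : 𝔡) ∈ 𝔥.toSubmodule ⊔ K.perp 𝔠.toSubmodule := by
      refine InvariantMetric.mem_sup_of_form_eq_zero h𝔥 fun y hy => ?_
      rw [K.perp_perp] at hy
      exact hη (K.toReduced 𝔠 ⟨y, hy.2⟩) ⟨⟨y, hy.2⟩, hy.1, rfl⟩
    obtain ⟨a, ha, b, hb, hab⟩ := Submodule.mem_sup.1 h1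
    have ha' : a ∈ 𝔠 := by
      rw [← sub_eq_of_eq_add hab.symm]
      exact 𝔠.sub_mem ξ.2 (h𝔠 hb)
    refine ⟨⟨a, ha'⟩, ha, ?_⟩
    rw [← sub_eq_zero, ← map_sub, K.toReduced_eq_zero]
    have : a - (ξ : 𝔡) = - b := by rw [← hab]; abel
    change a - (ξ : 𝔡) ∈ _
    rw [this]
    exact Submodule.neg_mem _ hb
  · rintro _ ⟨x, hx, rfl⟩ _ ⟨y, hy, rfl⟩
    exact h𝔥.form_eq_zero hy hx

/-- A projection onto `𝔥` that is compatible with a given projection onto `𝔥_𝔠`. -/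
theorem exists_isProj_adapted {𝔥 𝔠 : LieSubalgebra ℝ 𝔡}
    {t' : K.Reduced 𝔠 →ₗ[ℝ] K.Reduced 𝔠}
    (ht' : LinearMap.IsProj (K.reduceSubalgebra 𝔠 𝔥).toSubmodule t') :
    ∃ t : 𝔡 →ₗ[ℝ] 𝔡, LinearMap.IsProj 𝔥.toSubmodule t ∧
      ∀ ξ ∈ 𝔥.toSubmodule ⊔ 𝔠.toSubmodule, t ξ = 0 →
        ∃ h : ξ ∈ 𝔠, t' (K.toReduced 𝔠 ⟨ξ, h⟩) = 0 := by
  -- `𝔠₀` is the part of `𝔠` whose class is killed by `t'`. It contains a complement `𝔠₀ ⊓ C` of `𝔥`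
  -- in `𝔥 + 𝔠`: every value of `t'` lifts to `𝔥 ∩ 𝔠`, so `𝔥 + 𝔠 = 𝔥 + 𝔠₀`.
  let 𝔠₀ : Submodule ℝ 𝔡 := (LinearMap.ker (t' ∘ₗ K.toReduced 𝔠)).map 𝔠.toSubmodule.subtype
  obtain ⟨C, hC⟩ := exists_isCompl (𝔥.toSubmodule ⊓ 𝔠₀)
  have hd : Disjoint 𝔥.toSubmodule (𝔠₀ ⊓ C) := by
    rw [disjoint_iff, ← inf_assoc]
    exact hC.inf_eq_bot
  -- `W` is to be the kernel of `t`. It contains `𝔠₀ ⊓ C`, and being complementary to `𝔥` it meets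
  -- `𝔥 + 𝔠` in nothing more.
  obtain ⟨W, hW₀, hW⟩ := hd.symm.exists_isCompl
  replace hW := hW.symm
  have h0 : 𝔠₀ ≤ 𝔥.toSubmodule ⊔ (𝔠₀ ⊓ C) := by
    intro x hx
    obtain ⟨a, ha, b, hb, hab⟩ := Submodule.mem_sup.1
      (hC.sup_eq_top ▸ Submodule.mem_top : x ∈ (𝔥.toSubmodule ⊓ 𝔠₀) ⊔ C)
    have hb' : b ∈ 𝔠₀ := by
      rw [← sub_eq_of_eq_add' hab.symm]
      exact sub_mem hx ha.2
    exact Submodule.mem_sup.2 ⟨a, ha.1, b, ⟨hb', hb⟩, hab⟩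
  have h1 : 𝔥.toSubmodule ⊔ 𝔠.toSubmodule ≤ 𝔥.toSubmodule ⊔ (𝔠₀ ⊓ C) := by
    refine sup_le le_sup_left fun x hx => ?_
    obtain ⟨y, hy, hyx⟩ := ht'.map_mem (K.toReduced 𝔠 ⟨x, hx⟩)
    have hx0 : x - y ∈ 𝔠₀ := by
      refine ⟨⟨x, hx⟩ - y, ?_, rfl⟩
      refine LinearMap.mem_ker.2 ?_
      rw [LinearMap.comp_apply, map_sub, hyx, map_sub, ht'.map_id _ (ht'.map_mem _), sub_self]
    rw [← sub_add_cancel x (y : 𝔡)]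
    exact add_mem (h0 hx0) (le_sup_left (a := 𝔥.toSubmodule) (b := 𝔠₀ ⊓ C) hy)
  refine ⟨𝔥.toSubmodule.projection W hW, ⟨Submodule.projection_apply_mem hW, fun x hx => ?_⟩,
    fun ξ hξ hξ0 => ?_⟩
  · exact Submodule.projection_apply_of_mem_left hW hx
  · rw [Submodule.projection_apply_eq_zero_iff] at hξ0
    obtain ⟨a, ha, b, hb, hab⟩ := Submodule.mem_sup.1 (h1 hξ)
    have ha0 : a = 0 := by
      refine Submodule.disjoint_def.1 hW.disjoint a ha ?_
      rw [← sub_eq_of_eq_add hab.symm]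
      exact sub_mem hξ0 (hW₀ hb)
    rw [ha0, zero_add] at hab
    subst hab
    obtain ⟨y, hy, rfl⟩ := hb.1
    exact ⟨y.2, hy⟩

end

section Fibre

variable [Module.Finite ℝ 𝔡]
  {E : Type*} [NormedAddCommGroup E] [NormedSpace ℝ E] [FiniteDimensional ℝ E]

variable (K) in
/-- The linear algebra of a morphism of Manin pairs at a point. -/
structure IsManinFibre (𝔥 : Submodule ℝ 𝔡) (L : Submodule ℝ (𝔡 × E × (E →L[ℝ] ℝ))) : Prop where
  lagrangian : ∀ e, e ∈ L ↔ ∀ e' ∈ L, flatPair K e e' = 0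
  image : ∀ ξ X, ((ξ, X, 0) : 𝔡 × E × (E →L[ℝ] ℝ)) ∈ L → ξ ∈ 𝔥
  ker : ∀ X, ((0, X, 0) : 𝔡 × E × (E →L[ℝ] ℝ)) ∈ L → X = 0

lemma exists_linearMap_apply_eq {V W : Type*} [AddCommGroup V] [Module ℝ V] [AddCommGroup W]
    [Module ℝ W] (p : V →ₗ[ℝ] W) (φ : V →ₗ[ℝ] ℝ) (h : ∀ v, p v = 0 → φ v = 0) :
    ∃ ψ : W →ₗ[ℝ] ℝ, ∀ v, ψ (p v) = φ v := by
  have h1 : φ ∈ LinearMap.range p.dualMap := by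
    rw [LinearMap.range_dualMap_eq_dualAnnihilator_ker, Submodule.mem_dualAnnihilator]
    exact h
  obtain ⟨ψ, hψ⟩ := h1
  exact ⟨ψ, LinearMap.congr_fun hψ⟩

omit [LieRing 𝔡] [LieAlgebra ℝ 𝔡] [Module.Finite ℝ 𝔡] in
lemma exists_forall_dual_apply_eq (ψ : (E →L[ℝ] ℝ) →ₗ[ℝ] ℝ) : ∃ Y : E, ∀ a, ψ a = a Y := by
  let ι : (E →ₗ[ℝ] ℝ) ≃ₗ[ℝ] (E →L[ℝ] ℝ) := LinearMap.toContinuousLinearMap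
  refine ⟨(Module.evalEquiv ℝ E).symm (ψ ∘ₗ ι.toLinearMap), fun a => ?_⟩
  have h := LinearMap.congr_fun ((Module.evalEquiv ℝ E).apply_symm_apply (ψ ∘ₗ ι.toLinearMap))
    (a : E →ₗ[ℝ] ℝ)
  exact h.symm

variable {𝔥 : Submodule ℝ 𝔡} {L : Submodule ℝ (𝔡 × E × (E →L[ℝ] ℝ))}

/-- The projection of a Lagrangian fibre to the cotangent space. -/
def cotanProj (L : Submodule ℝ (𝔡 × E × (E →L[ℝ] ℝ))) : L →ₗ[ℝ] (E →L[ℝ] ℝ) :=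
  LinearMap.snd ℝ E (E →L[ℝ] ℝ) ∘ₗ LinearMap.snd ℝ 𝔡 _ ∘ₗ L.subtype

namespace IsManinFibre

/-- This is the action of `𝔥` on `M`. The set `𝔥₀` of those `ξ` occurring in `L` with zero covector
lies in `𝔥`, so `ζ ⟂ 𝔥₀`. Hence `e ↦ ⟨ζ, e.1⟩` on `L` factors through the covector, as evaluation at
some `Y`; then `(ζ, Y, 0)` is orthogonal to `L` and so belongs to it. -/
lemma exists_mem_of_mem (hL : IsManinFibre K 𝔥 L) (h𝔥 : K.IsLagrangian 𝔥) {ζ : 𝔡} (hζ : ζ ∈ 𝔥) :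
    ∃ X, (ζ, X, 0) ∈ L := by
  let 𝔥₀ : Submodule ℝ 𝔡 := (LinearMap.ker (cotanProj L)).map (LinearMap.fst ℝ 𝔡 _ ∘ₗ L.subtype)
  have h₀ : ∀ w, (∀ y ∈ 𝔥₀, K.form y w = 0) → ∃ Y, (w, Y, 0) ∈ L := by
    intro w hw
    obtain ⟨ψ, hψ⟩ := exists_linearMap_apply_eq (cotanProj L)
      (K.form w ∘ₗ (LinearMap.fst ℝ 𝔡 _ ∘ₗ L.subtype))
      fun e he => (K.form_comm _ _).trans (hw _ ⟨e, LinearMap.mem_ker.2 he, rfl⟩)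
    obtain ⟨Y, hY⟩ := exists_forall_dual_apply_eq ψ
    refine ⟨Y, (hL.lagrangian _).2 fun e he => ?_⟩
    have h3 : ψ e.2.2 = K.form w e.1 := hψ ⟨e, he⟩
    rw [flatPair_apply, ← h3, hY]
    simp
  have h₁ : 𝔥₀ ≤ 𝔥 := by
    rintro _ ⟨e, he, rfl⟩
    refine hL.image _ (e : 𝔡 × E × (E →L[ℝ] ℝ)).2.1 ?_
    have : (e : 𝔡 × E × (E →L[ℝ] ℝ)).2.2 = 0 := he
    rw [← this]
    exact e.2
  exact h₀ ζ fun y hy => h𝔥.form_eq_zero (h₁ hy) hζ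

/-- A nonzero vector `Y` annihilating all covectors of `L` would give `(0, Y, 0) ∈ Lᗮ = L`, against
the kernel condition. -/
lemma exists_mem_cotan (hL : IsManinFibre K 𝔥 L) (α : E →L[ℝ] ℝ) : ∃ ξ X, (ξ, X, α) ∈ L := by
  by_contra hα
  have h0 : α ∉ LinearMap.range (cotanProj L) := by
    rintro ⟨e, rfl⟩
    exact hα ⟨_, _, e.2⟩
  obtain ⟨ψ, hψ, hψ'⟩ := Submodule.exists_dual_map_eq_bot_of_notMem h0 inferInstance
  obtain ⟨Y, hY⟩ := exists_forall_dual_apply_eq ψ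
  have : Y = 0 := by
    refine hL.ker Y ((hL.lagrangian _).2 fun e he => ?_)
    have h1 : ψ e.2.2 = 0 := by
      rw [← Submodule.mem_bot (R := ℝ), ← hψ']
      exact ⟨_, ⟨⟨e, he⟩, rfl⟩, rfl⟩
    rw [flatPair_apply, ← hY, h1]
    simp
  rw [hY, this, map_zero] at hψ
  exact hψ rfl

variable {t : 𝔡 →ₗ[ℝ] 𝔡}

/-- With `eq_of_proj`, this is the isomorphism of `L` with `𝔥 × E*` on which all later constructions
of sections rest. -/
lemma exists_mem_proj (hL : IsManinFibre K 𝔥 L) (h𝔥 : K.IsLagrangian 𝔥)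
    (ht : LinearMap.IsProj 𝔥 t) {ζ : 𝔡} (hζ : ζ ∈ 𝔥) (α : E →L[ℝ] ℝ) :
    ∃ e ∈ L, t e.1 = ζ ∧ e.2.2 = α := by
  obtain ⟨ξ, X, h⟩ := hL.exists_mem_cotan α
  obtain ⟨Y, hY⟩ := hL.exists_mem_of_mem h𝔥 (sub_mem hζ (ht.map_mem ξ))
  refine ⟨_, add_mem h hY, ?_, ?_⟩
  · simp [ht.map_id _ hζ, ht.map_id _ (ht.map_mem ξ)]
  · simp

lemma eq_of_proj (hL : IsManinFibre K 𝔥 L) (ht : LinearMap.IsProj 𝔥 t)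
    {e e' : 𝔡 × E × (E →L[ℝ] ℝ)} (he : e ∈ L) (he' : e' ∈ L) (h1 : t e.1 = t e'.1)
    (h2 : e.2.2 = e'.2.2) : e = e' := by
  have h := sub_mem he he'
  have h22 : (e - e').2.2 = 0 := sub_eq_zero.2 h2
  have h3 : ((e - e').1, (e - e').2.1, (0 : E →L[ℝ] ℝ)) ∈ L := by
    rw [← h22]; exact h
  have h4 : (e - e').1 = 0 := by
    rw [← ht.map_id _ (hL.image _ _ h3), Prod.fst_sub, map_sub, h1, sub_self]
  rw [h4] at h3
  rw [← sub_eq_zero]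
  exact Prod.ext h4 (Prod.ext (hL.ker _ h3) h22)

end IsManinFibre

/-- An isotropic `L` with enough elements is Lagrangian, without counting dimensions. Given `e ⟂ L`,
subtract an element of `L` with the same covector. What is left is orthogonal to the elements `(ζ,
X, 0)`, so its `𝔡`-component is in `𝔥ᗮ = 𝔥` and can be subtracted too; the remaining vector pairs to
zero with every covector. -/
lemma isManinFibre_of_exists (h𝔥 : K.IsLagrangian 𝔥)
    (iso : ∀ e ∈ L, ∀ e' ∈ L, flatPair K e e' = 0)
    (h₁ : ∀ ζ ∈ 𝔥, ∃ X, (ζ, X, 0) ∈ L) (h₂ : ∀ α, ∃ ξ X, (ξ, X, α) ∈ L) :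
    IsManinFibre K 𝔥 L := by
  have k₀ : ∀ X, (∀ e' ∈ L, flatPair K ((0, X, 0) : 𝔡 × E × (E →L[ℝ] ℝ)) e' = 0) → X = 0 := by
    intro X hX
    by_contra hX0
    obtain ⟨a, ha⟩ := exists_clm_apply_ne_zero hX0
    obtain ⟨ξ, Y, h⟩ := h₂ a
    have := hX _ h
    rw [flatPair_apply] at this
    exact ha (by simpa using this)
  have k₁ : ∀ ξ X, (∀ e' ∈ L, flatPair K ((ξ, X, 0) : 𝔡 × E × (E →L[ℝ] ℝ)) e' = 0) →
      ξ ∈ 𝔥 := by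
    intro ξ X hX
    rw [← h𝔥]
    intro ζ hζ
    obtain ⟨Y, hY⟩ := h₁ ζ hζ
    have := hX _ hY
    rw [flatPair_apply] at this
    exact (K.form_comm _ _).trans (by simpa using this)
  refine ⟨fun e => ⟨iso e, fun he => ?_⟩, fun ξ X h => k₁ ξ X (iso _ h), fun X h => k₀ X (iso _ h)⟩
  obtain ⟨ξ, X, hX⟩ := h₂ e.2.2
  have hd : ∀ e' ∈ L, flatPair K (e - (ξ, X, e.2.2)) e' = 0 := by
    intro e' he'
    rw [map_sub, sub_apply, he e' he', iso _ hX e' he', sub_zero]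
  have hd' : e - (ξ, X, e.2.2) = (e.1 - ξ, e.2.1 - X, 0) :=
    Prod.ext rfl (Prod.ext rfl (sub_self e.2.2))
  rw [hd'] at hd
  obtain ⟨Y, hY⟩ := h₁ _ (k₁ _ _ hd)
  have h0 : e.2.1 - X - Y = 0 := by
    refine k₀ _ fun e' he' => ?_
    have : ((0, e.2.1 - X - Y, 0) : 𝔡 × E × (E →L[ℝ] ℝ)) = (e.1 - ξ, e.2.1 - X, 0) - (e.1 - ξ, Y, 0) := by
      simp
    rw [this, map_sub, sub_apply, hd e' he', iso _ hY e' he', sub_zero]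
  have : e = (ξ, X, e.2.2) + (e.1 - ξ, Y, 0) := by
    rw [sub_eq_zero] at h0
    rw [← h0]
    refine Prod.ext ?_ (Prod.ext ?_ ?_) <;> simp
  rw [this]
  exact add_mem hX hY

section Reduced

variable {EP : Type*} [NormedAddCommGroup EP] [NormedSpace ℝ EP] [FiniteDimensional ℝ EP]
  {Er : Type*} [NormedAddCommGroup Er] [NormedSpace ℝ Er] [FiniteDimensional ℝ Er]

variable (K) in
/-- The reduction of a fibre `L`, with `i : T_p P → T_p M` and `q : T_p P → T_{q p} M_{𝔠,S}`. -/
def reducedFibre (𝔠 : LieSubalgebra ℝ 𝔡) (i : EP →L[ℝ] E) (q : EP →L[ℝ] Er)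
    (L : Submodule ℝ (𝔡 × E × (E →L[ℝ] ℝ))) :
    Submodule ℝ (K.Reduced 𝔠 × Er × (Er →L[ℝ] ℝ)) where
  carrier := {e | ∃ (ξ : 𝔠) (U : EP) (α : E →L[ℝ] ℝ), K.toReduced 𝔠 ξ = e.1 ∧ q U = e.2.1 ∧
    α.comp i = e.2.2.comp q ∧ ((ξ : 𝔡), i U, α) ∈ L}
  add_mem' := by
    rintro e e' ⟨ξ, U, α, h1, h2, h3, h4⟩ ⟨ξ', U', α', h1', h2', h3', h4'⟩
    refine ⟨ξ + ξ', U + U', α + α', ?_, ?_, ?_, ?_⟩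
    · rw [map_add, h1, h1']; rfl
    · rw [map_add, h2, h2']; rfl
    · rw [ContinuousLinearMap.add_comp, h3, h3', ← ContinuousLinearMap.add_comp]; rfl
    · have := add_mem h4 h4'
      rw [map_add]
      exact this
  zero_mem' := ⟨0, 0, 0, map_zero _, map_zero _, by simp, by rw [map_zero]; exact zero_mem L⟩
  smul_mem' := by
    rintro c e ⟨ξ, U, α, h1, h2, h3, h4⟩
    refine ⟨c • ξ, c • U, c • α, ?_, ?_, ?_, ?_⟩
    · rw [map_smul, h1]; rfl
    · rw [map_smul, h2]; rfl
    · rw [ContinuousLinearMap.smul_comp, h3, ← ContinuousLinearMap.smul_comp]; rfl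
    · have := L.smul_mem c h4
      rw [map_smul]
      exact this

/-- The linear algebra of the reduction at a point. -/
structure IsReductiveFibre (𝔥 𝔠 : LieSubalgebra ℝ 𝔡) (i : EP →L[ℝ] E) (q : EP →L[ℝ] Er)
    (L : Submodule ℝ (𝔡 × E × (E →L[ℝ] ℝ))) : Prop where
  injective : Function.Injective i
  tangent : ∀ e ∈ L, e.1 ∈ 𝔠 → ∃ U, i U = e.2.1
  vertical : ∀ w ∈ 𝔥, w ∈ K.perp 𝔠.toSubmodule → ∀ U, (w, i U, 0) ∈ L → q U = 0

variable {𝔥 𝔠 : LieSubalgebra ℝ 𝔡} {i : EP →L[ℝ] E} {q : EP →L[ℝ] Er}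

namespace IsReductiveFibre

/-- An element `w ∈ 𝔥 ∩ 𝔠ᗮ` acts by some `i U` with `q U = 0`. Isotropy of `L` gives `⟨w, e.1⟩ =
e.2.2 (i U) = γ (q U) = 0`. -/
lemma mem_sup (hr : IsReductiveFibre (K := K) 𝔥 𝔠 i q L) (hL : IsManinFibre K 𝔥.toSubmodule L)
    (h𝔥 : K.IsLagrangian 𝔥.toSubmodule) (h𝔠 : K.IsCoisotropic 𝔠.toSubmodule)
    {e : 𝔡 × E × (E →L[ℝ] ℝ)} (he : e ∈ L) {γ : Er →L[ℝ] ℝ} (hγ : e.2.2.comp i = γ.comp q) :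
    e.1 ∈ 𝔥.toSubmodule ⊔ 𝔠.toSubmodule := by
  refine InvariantMetric.mem_sup_of_form_eq_zero h𝔥 fun w hw => ?_
  obtain ⟨X, hX⟩ := hL.exists_mem_of_mem h𝔥 hw.1
  obtain ⟨U, rfl⟩ := hr.tangent _ hX (h𝔠 hw.2)
  have h0 := hr.vertical w hw.1 hw.2 U hX
  have h1 := (hL.lagrangian _).1 hX _ he
  have h2 : e.2.2 (i U) = γ (q U) := DFunLike.congr_fun hγ U
  rw [flatPair_apply, h2, h0] at h1
  simpa using h1

variable {t' : K.Reduced 𝔠 →ₗ[ℝ] K.Reduced 𝔠} {t : 𝔡 →ₗ[ℝ] 𝔡}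

/-- For an adapted `t`, prescribing `t e.1 = ζ ∈ 𝔥 ∩ 𝔠` and a covector that descends already makes
`e` reducible: `e.1 - ζ` lies in `𝔥 + 𝔠` and is killed by `t`, hence lies in `𝔠` with class killed
by `t'`. -/
lemma exists_reduced (hr : IsReductiveFibre (K := K) 𝔥 𝔠 i q L)
    (hL : IsManinFibre K 𝔥.toSubmodule L)
    (h𝔥 : K.IsLagrangian 𝔥.toSubmodule) (h𝔠 : K.IsCoisotropic 𝔠.toSubmodule)
    (ht' : LinearMap.IsProj (K.reduceSubalgebra 𝔠 𝔥).toSubmodule t')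
    (ht : LinearMap.IsProj 𝔥.toSubmodule t)
    (htt : ∀ ξ ∈ 𝔥.toSubmodule ⊔ 𝔠.toSubmodule, t ξ = 0 →
      ∃ h : ξ ∈ 𝔠, t' (K.toReduced 𝔠 ⟨ξ, h⟩) = 0) {ζ : 𝔠} (hζ : (ζ : 𝔡) ∈ 𝔥)
    {e : 𝔡 × E × (E →L[ℝ] ℝ)} (he : e ∈ L) (hte : t e.1 = ζ)
    {γ : Er →L[ℝ] ℝ} (hγ : e.2.2.comp i = γ.comp q) :
    ∃ (h : e.1 ∈ 𝔠) (U : EP), i U = e.2.1 ∧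
      t' (K.toReduced 𝔠 ⟨e.1, h⟩) = K.toReduced 𝔠 ζ ∧
      (K.toReduced 𝔠 ⟨e.1, h⟩, q U, γ) ∈ reducedFibre K 𝔠 i q L := by
  have h1 := hr.mem_sup hL h𝔥 h𝔠 he hγ
  have hζ' : (ζ : 𝔡) ∈ 𝔥.toSubmodule := hζ
  obtain ⟨h2, h3⟩ := htt (e.1 - ζ)
    (sub_mem h1 (le_sup_left (a := 𝔥.toSubmodule) (b := 𝔠.toSubmodule) hζ))
    (by rw [map_sub, hte, ht.map_id _ hζ', sub_self])
  have h4 : e.1 ∈ 𝔠 := by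
    rw [← sub_add_cancel e.1 (ζ : 𝔡)]
    exact 𝔠.add_mem h2 ζ.2
  obtain ⟨U, hU⟩ := hr.tangent e he h4
  refine ⟨h4, U, hU, ?_, ⟨e.1, h4⟩, U, e.2.2, rfl, rfl, hγ, ?_⟩
  · have h5 : K.toReduced 𝔠 ⟨e.1, h4⟩ = K.toReduced 𝔠 ⟨e.1 - ζ, h2⟩ + K.toReduced 𝔠 ζ := by
      rw [← map_add]
      exact congrArg _ (Subtype.ext (sub_add_cancel e.1 (ζ : 𝔡)).symm)
    rw [h5, map_add, h3, zero_add]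
    exact ht'.map_id _ ⟨ζ, hζ, rfl⟩
  · rw [hU]
    exact he

theorem isManinFibre (hr : IsReductiveFibre (K := K) 𝔥 𝔠 i q L)
    (hL : IsManinFibre K 𝔥.toSubmodule L)
    (h𝔥 : K.IsLagrangian 𝔥.toSubmodule) (h𝔠 : K.IsCoisotropic 𝔠.toSubmodule) :
    IsManinFibre (K.reduce 𝔠) (K.reduceSubalgebra 𝔠 𝔥).toSubmodule
      (reducedFibre K 𝔠 i q L) := by
  refine isManinFibre_of_exists (isLagrangian_reduceSubalgebra h𝔥 h𝔠) ?_ ?_ ?_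
  · rintro ⟨_, _, γ⟩ ⟨ξ, U, α, rfl, rfl, h3, h4⟩ ⟨_, _, γ'⟩ ⟨ξ', U', α', rfl, rfl, h3', h4'⟩
    have h := (hL.lagrangian _).1 h4 _ h4'
    rw [flatPair_apply] at h ⊢
    have e1 : α (i U') = γ (q U') := DFunLike.congr_fun h3 U'
    have e2 : α' (i U) = γ' (q U) := DFunLike.congr_fun h3' U
    rw [e1, e2] at h
    exact h
  · rintro _ ⟨ζ, hζ, rfl⟩
    obtain ⟨X, hX⟩ := hL.exists_mem_of_mem h𝔥 hζ
    obtain ⟨U, hU⟩ := hr.tangent _ hX ζ.2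
    refine ⟨q U, ζ, U, 0, rfl, rfl, by simp, ?_⟩
    rw [hU]
    exact hX
  · intro γ
    obtain ⟨T, hT⟩ := exists_isCompl (K.reduceSubalgebra 𝔠 𝔥).toSubmodule
    have ht' : LinearMap.IsProj (K.reduceSubalgebra 𝔠 𝔥).toSubmodule
        ((K.reduceSubalgebra 𝔠 𝔥).toSubmodule.projection T hT) :=
      ⟨Submodule.projection_apply_mem hT, fun x hx =>
        Submodule.projection_apply_of_mem_left hT hx⟩
    obtain ⟨t, ht, htt⟩ := exists_isProj_adapted ht'
    obtain ⟨j, hj⟩ := LinearMap.exists_leftInverse_of_injective (i : EP →ₗ[ℝ] E)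
      (LinearMap.ker_eq_bot.2 hr.injective)
    -- A left inverse `j` of `i` extends `γ ∘ q` from the tangent space of `P` to `E`.
    let α : E →L[ℝ] ℝ := (γ.comp q).comp j.toContinuousLinearMap
    obtain ⟨e, he, he1, he2⟩ := hL.exists_mem_proj h𝔥 ht 𝔥.zero_mem α
    have hγ : e.2.2.comp i = γ.comp q := by
      rw [he2]
      ext U
      exact congrArg (fun u => γ (q u)) (LinearMap.congr_fun hj U)
    obtain ⟨h, U, -, -, hU⟩ := hr.exists_reduced hL h𝔥 h𝔠 ht' ht htt (ζ := 0) 𝔥.zero_mem he he1 hγ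
    exact ⟨_, _, hU⟩

end IsReductiveFibre

end Reduced

end Fibre

end

/-! ### Smooth sections with prescribed projection to `𝔥 × T*M`. -/

section

variable {𝔡 : Type*} [LieRing 𝔡] [LieAlgebra ℝ 𝔡] [Module.Finite ℝ 𝔡] {K : InvariantMetric 𝔡}
  {E : Type*} [NormedAddCommGroup E] [NormedSpace ℝ E] [FiniteDimensional ℝ E]
  {M : Type*} [TopologicalSpace M] [ChartedSpace E M] [IsManifold 𝓘(ℝ, E) ∞ M]

/-- Linear combinations of a tuple of vectors. -/
def combination (V : Type*) [NormedAddCommGroup V] [NormedSpace ℝ V] [FiniteDimensional ℝ V]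
    (r : ℕ) : (Fin r → V) →L[ℝ] (Fin r → ℝ) →L[ℝ] V :=
  LinearMap.toContinuousBilinearMap (LinearMap.mk₂ ℝ (fun v c => ∑ i, c i • v i)
    (by intros; simp [Finset.sum_add_distrib])
    (fun a v c => by
      simp only [Pi.smul_apply, Finset.smul_sum]
      exact Finset.sum_congr rfl fun i _ => smul_comm _ _ _)
    (by intros; simp [add_smul, Finset.sum_add_distrib])
    (by intros; simp [Finset.smul_sum, mul_smul]))

lemma combination_apply {V : Type*} [NormedAddCommGroup V] [NormedSpace ℝ V]
    [FiniteDimensional ℝ V] {r : ℕ} (v : Fin r → V) (c : Fin r → ℝ) :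
    combination V r v c = ∑ i, c i • v i := rfl

lemma exists_frame_of_bijective {V W : Type*} [NormedAddCommGroup V] [NormedSpace ℝ V]
    [FiniteDimensional ℝ V] [NormedAddCommGroup W] [NormedSpace ℝ W] (L : Submodule ℝ V)
    (T : V →L[ℝ] W) (hT : Function.Bijective fun e : L => T e) :
    ∃ (r : ℕ) (b : Fin r → V), (∀ i, b i ∈ L) ∧
      Function.Bijective (T.comp (combination V r b)) := by
  let b := Module.finBasis ℝ L
  have hm0 : ∀ c : Fin (Module.finrank ℝ L) → ℝ,
      combination V _ (fun i => (b i : V)) c = (b.equivFun.symm c : L) := by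
    intro c
    rw [combination_apply, b.equivFun_symm_apply]
    push_cast
    rfl
  refine ⟨_, fun i => b i, fun i => (b i).2, ?_⟩
  have : ⇑(T.comp (combination V _ fun i => (b i : V))) = (fun e : L => T e) ∘ b.equivFun.symm :=
    funext fun c => congrArg T (hm0 c)
  rw [this]
  exact hT.comp b.equivFun.symm.bijective

lemma flatten_sum {ι : Type*} (s : Finset ι) (c : ι → ℝ) (m₀ m : M) (e : ι → CFib 𝔡 E m) :
    flatten m₀ m (∑ i ∈ s, c i • e i) = ∑ i ∈ s, c i • flatten m₀ m (e i) := by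
  classical
  induction s using Finset.induction_on with
  | empty =>
    have := flatten_smul m₀ m 0 (0 : CFib 𝔡 E m)
    rw [zero_smul, zero_smul] at this
    simpa using this
  | insert a s ha ih => rw [Finset.sum_insert ha, Finset.sum_insert ha, flatten_add, ih, flatten_smul]

lemma flatten_self (m : M) (e : CFib 𝔡 E m) : flatten m m e = e :=
  Prod.ext rfl (Prod.ext (tangentCoord_self m _)
    (ContinuousLinearMap.ext fun v => congrArg e.2.2 (tangentOfCoord_self m v)))

variable {𝔥 : Submodule ℝ 𝔡} {L : ∀ m : M, Submodule ℝ (CFib 𝔡 E m)} {t : 𝔡 →ₗ[ℝ] 𝔡}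

/-- The isomorphism `L ≃ 𝔥 × E*` given by a projection `t` onto `𝔥`, on all of `𝔡 × E × E*`. -/
def maninProj (E : Type*) [NormedAddCommGroup E] [NormedSpace ℝ E] [FiniteDimensional ℝ E]
    (ht : LinearMap.IsProj 𝔥 t) : 𝔡 × E × (E →L[ℝ] ℝ) →L[ℝ] 𝔥 × (E →L[ℝ] ℝ) :=
  (t.codRestrict 𝔥 ht.map_mem).toContinuousLinearMap.prodMap (ContinuousLinearMap.snd ℝ E (E →L[ℝ] ℝ))

lemma IsManinFibre.exists_frame {L : Submodule ℝ (𝔡 × E × (E →L[ℝ] ℝ))}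
    (hL : IsManinFibre K 𝔥 L) (h𝔥 : K.IsLagrangian 𝔥) (ht : LinearMap.IsProj 𝔥 t) :
    ∃ (r : ℕ) (b : Fin r → 𝔡 × E × (E →L[ℝ] ℝ)), (∀ i, b i ∈ L) ∧
      Function.Bijective ((maninProj E ht).comp (combination _ r b)) := by
  refine exists_frame_of_bijective L (maninProj E ht) ⟨fun e e' h => Subtype.ext ?_, ?_⟩
  · exact hL.eq_of_proj ht e.2 e'.2 (congrArg (fun z => (z.1 : 𝔡)) h)
      (congrArg (fun z : 𝔥 × (E →L[ℝ] ℝ) => z.2) h)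
  · rintro ⟨⟨z, hz⟩, α⟩
    obtain ⟨e, he, he1, he2⟩ := hL.exists_mem_proj h𝔥 ht hz α
    exact ⟨⟨e, he⟩, Prod.ext (Subtype.ext he1) he2⟩

/-- The section is determined pointwise by its two projections, so only smoothness is at stake. Near
`m`, sections of `L` extending a basis of `L m` express it with coefficients `Φ⁻¹ w`, where `Φ` is
the projection read in that frame and `w` the prescribed data. -/
theorem exists_isSmoothAlong_proj (hL : ∀ x, IsManinFibre (E := E) K 𝔥 (L x))
    (hsub : ∀ (m : M), ∀ e ∈ L m, ∃ σ : ∀ x : M, CFib 𝔡 E x,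
      IsSmoothAlong 𝓘(ℝ, E) (fun x : M => x) σ ∧ (∀ x, σ x ∈ L x) ∧ σ m = e)
    (h𝔥 : K.IsLagrangian 𝔥) (ht : LinearMap.IsProj 𝔥 t) {ζ : 𝔡} (hζ : ζ ∈ 𝔥)
    {f : M → ℝ} (hf : ContMDiff 𝓘(ℝ, E) 𝓘(ℝ, ℝ) ∞ f) :
    ∃ σ : ∀ x : M, CFib 𝔡 E x, IsSmoothAlong 𝓘(ℝ, E) (fun x : M => x) σ ∧
      ∀ x, σ x ∈ L x ∧ t (σ x).1 = ζ ∧ (σ x).2.2 = dFun f x := by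
  have hex : ∀ x : M, ∃ e ∈ L x, t e.1 = ζ ∧ e.2.2 = dFun f x := fun x =>
    (hL x).exists_mem_proj h𝔥 ht hζ (dFun f x)
  choose σ hσ hσt hσf using hex
  refine ⟨σ, isSmoothAlong_iff.2 fun m => ⟨contMDiffAt_id, ?_⟩,
    fun x => ⟨hσ x, hσt x, hσf x⟩⟩
  obtain ⟨r, b, hb, hbij⟩ := (hL m).exists_frame h𝔥 ht
  have hs : ∀ i, ∃ s : ∀ x : M, CFib 𝔡 E x,
      IsSmoothAlong 𝓘(ℝ, E) (fun x : M => x) s ∧ (∀ x, s x ∈ L x) ∧ s m = b i :=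
    fun i => hsub m _ (hb i)
  choose s hs hsL hsm using hs
  let G : M → Fin r → 𝔡 × E × (E →L[ℝ] ℝ) := fun x i => flatten m x (s i x)
  have hG : ContMDiffAt 𝓘(ℝ, E) 𝓘(ℝ, Fin r → 𝔡 × E × (E →L[ℝ] ℝ)) ∞ G m :=
    contMDiffAt_pi_space.2 fun i => (isSmoothAlong_iff.1 (hs i) m).2
  let T := maninProj E ht
  let Φ : M → (Fin r → ℝ) →L[ℝ] 𝔥 × (E →L[ℝ] ℝ) := fun x => T.comp (combination _ r (G x))
  have hΦ : ContMDiffAt 𝓘(ℝ, E) 𝓘(ℝ, (Fin r → ℝ) →L[ℝ] 𝔥 × (E →L[ℝ] ℝ)) ∞ Φ m := by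
    have h1 := ContMDiffAt.comp (g := combination (𝔡 × E × (E →L[ℝ] ℝ)) r) (f := G) m
      (combination (𝔡 × E × (E →L[ℝ] ℝ)) r).contMDiff.contMDiffAt hG
    exact (contMDiffAt_const (c := T)).clm_comp h1
  let w : M → 𝔥 × (E →L[ℝ] ℝ) := fun x => (⟨ζ, hζ⟩, (dFun (E := E) f x).comp (tangentOfCoord m x))
  have hw : ContMDiffAt 𝓘(ℝ, E) 𝓘(ℝ, 𝔥 × (E →L[ℝ] ℝ)) ∞ w m :=
    contMDiffAt_const.prodMk_space (contMDiffAt_dFun_comp_tangentOfCoord hf)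
  have hcomb : ∀ (x : M) (c : Fin r → ℝ), combination _ r (G x) c = flatten m x (∑ i, c i • s i x) := by
    intro x c
    rw [flatten_sum, combination_apply]
  have hmem : ∀ (x : M) (c : Fin r → ℝ), ∑ i, c i • s i x ∈ L x := fun x c =>
    sum_mem fun i _ => (L x).smul_mem _ (hsL i x)
  have hGm : G m = b := funext fun i => (flatten_self m _).trans (hsm i)
  let eΦ : (Fin r → ℝ) ≃L[ℝ] 𝔥 × (E →L[ℝ] ℝ) :=
    (LinearEquiv.ofBijective ((maninProj E ht).comp (combination _ r b) :
      (Fin r → ℝ) →ₗ[ℝ] 𝔥 × (E →L[ℝ] ℝ)) hbij).toContinuousLinearEquiv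
  have heΦ : (eΦ : (Fin r → ℝ) →L[ℝ] 𝔥 × (E →L[ℝ] ℝ)) = Φ m := by
    change _ = T.comp (combination _ r (G m))
    rw [hGm]
    exact ContinuousLinearMap.ext fun c => rfl
  have hinv : ContMDiffAt 𝓘(ℝ, E) 𝓘(ℝ, 𝔥 × (E →L[ℝ] ℝ) →L[ℝ] (Fin r → ℝ)) ∞
      (fun x => (Φ x).inverse) m := by
    have h1 : ContDiffAt ℝ ∞ ContinuousLinearMap.inverse (Φ m) := by
      rw [← heΦ]; exact contDiffAt_map_inverse eΦ
    exact ContMDiffAt.comp (g := ContinuousLinearMap.inverse) (f := Φ) m h1.contMDiffAt hΦ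
  have hfin := (ContMDiffAt.comp (g := combination (𝔡 × E × (E →L[ℝ] ℝ)) r) (f := G) m
      (combination (𝔡 × E × (E →L[ℝ] ℝ)) r).contMDiff.contMDiffAt hG).clm_apply
      (hinv.clm_apply hw)
  refine hfin.congr_of_eventuallyEq ?_
  -- `Φ m` is invertible and invertibility is an open condition.
  have hnear : ∀ᶠ x in 𝓝 m, Φ x ∈ range ((↑) : ((Fin r → ℝ) ≃L[ℝ] 𝔥 × (E →L[ℝ] ℝ)) → _) := by
    refine hΦ.continuousAt.eventually ?_
    rw [← heΦ]
    exact eΦ.nhds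
  filter_upwards [hnear, extChartAt_source_mem_nhds (I := 𝓘(ℝ, E)) m] with x ⟨e, he⟩ hx
  have hwx : Φ x ((Φ x).inverse (w x)) = w x := by
    rw [← he, ContinuousLinearMap.inverse_equiv]
    exact e.apply_symm_apply _
  change flatten m x (σ x) = combination _ r (G x) ((Φ x).inverse (w x))
  rw [hcomb]
  have h1 : T (flatten m x (∑ i, ((Φ x).inverse (w x)) i • s i x)) = w x := by
    rw [← hcomb]; exact hwx
  have h2 := (hL x).eq_of_proj ht (hσ x) (hmem x ((Φ x).inverse (w x)))
    ((hσt x).trans (congrArg (fun z => (z.1 : 𝔡)) h1).symm) (by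
      rw [hσf]
      have h3 := congrArg Prod.snd h1
      refine ContinuousLinearMap.ext fun v => ?_
      have h4 := DFunLike.congr_fun h3 (tangentCoord m x v)
      have h5 := tangentOfCoord_tangentCoord hx v
      exact ((congrArg _ h5).symm.trans h4.symm).trans (congrArg _ h5))
  exact congrArg (flatten m x) h2

end

/-! ### Vector fields as derivations. -/

section FunctionCalculus

variable {E : Type*} [NormedAddCommGroup E] [NormedSpace ℝ E]
  {M : Type*} [TopologicalSpace M] [ChartedSpace E M] [IsManifold 𝓘(ℝ, E) ∞ M]

/-- The derivative of `X f`, for a vector field `X` and a function `f`. -/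
lemma hasMFDerivAt_dFun_field {X : ∀ x : M, Tan E x} {m : M} {X' : E →L[ℝ] E}
    (hX : HasFDerivAt (fieldInChart m X) X' (extChartAt 𝓘(ℝ, E) m m)) {f : M → ℝ}
    (hf : ContMDiff 𝓘(ℝ, E) 𝓘(ℝ, ℝ) ∞ f) :
    HasMFDerivAt 𝓘(ℝ, E) 𝓘(ℝ, ℝ) (fun x => dFun f x (X x)) m
      ((fderiv ℝ (fderiv ℝ (f ∘ (extChartAt 𝓘(ℝ, E) m).symm)) (extChartAt 𝓘(ℝ, E) m m)).flip
          (show E from X m) +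
        (fderiv ℝ (f ∘ (extChartAt 𝓘(ℝ, E) m).symm) (extChartAt 𝓘(ℝ, E) m m)).comp X') := by
  have hd : ContDiffAt ℝ ∞ (fderiv ℝ (f ∘ (extChartAt 𝓘(ℝ, E) m).symm))
      (extChartAt 𝓘(ℝ, E) m m) :=
    (contDiffAt_comp_extChartAt_symm (mem_extChartAt_source m) (hf m)).fderiv_right (by simp)
  have h1 := ((hd.differentiableAt (by simp)).hasFDerivAt).clm_apply hX
  rw [fieldInChart_self, add_comm] at h1
  refine hasMFDerivAt_of_eventuallyEq_comp_extChartAt h1 ?_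
  filter_upwards [extChartAt_source_mem_nhds (I := 𝓘(ℝ, E)) m] with x hx
  have h2 := dVec_eq_fderiv hx ((hf x).mdifferentiableAt (by simp)) (X x)
  refine h2.trans ?_
  rw [Function.comp_apply, fieldInChart_extChartAt hx]

lemma fderiv_fderiv_comm {f : M → ℝ} (hf : ContMDiff 𝓘(ℝ, E) 𝓘(ℝ, ℝ) ∞ f) (m : M) (v w : E) :
    fderiv ℝ (fderiv ℝ (f ∘ (extChartAt 𝓘(ℝ, E) m).symm)) (extChartAt 𝓘(ℝ, E) m m) v w =
    fderiv ℝ (fderiv ℝ (f ∘ (extChartAt 𝓘(ℝ, E) m).symm)) (extChartAt 𝓘(ℝ, E) m m) w v :=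
  (contDiffAt_comp_extChartAt_symm (mem_extChartAt_source m) (hf m)).isSymmSndFDerivAt
    (by rw [minSmoothness_of_isRCLikeNormedField]; exact WithTop.coe_le_coe.2 le_top) v w

lemma differentiableAt_fieldInChart {X : ∀ x : M, Tan E x} {m : M}
    (hX : ContMDiffAt 𝓘(ℝ, E) 𝓘(ℝ, E).tangent ∞
      (fun x => (⟨x, X x⟩ : TangentBundle 𝓘(ℝ, E) M)) m) :
    DifferentiableAt ℝ (fieldInChart m X) (extChartAt 𝓘(ℝ, E) m m) := by
  have h1 := (contMDiffAt_tangent_iff.1 hX).2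
  have h2 := (contDiffAt_comp_extChartAt_symm (mem_extChartAt_source m) h1).differentiableAt
    (by simp)
  refine h2.congr_of_eventuallyEq ?_
  filter_upwards [extChartAt_target_mem_nhds (I := 𝓘(ℝ, E)) m] with y hy
  exact fieldInChart_eq hy X

/-- The Lie bracket of vector fields is the commutator of derivations. -/
lemma dFun_mlieBracket {X Y : ∀ x : M, Tan E x} {m : M}
    (hX : ContMDiffAt 𝓘(ℝ, E) 𝓘(ℝ, E).tangent ∞
      (fun x => (⟨x, X x⟩ : TangentBundle 𝓘(ℝ, E) M)) m)
    (hY : ContMDiffAt 𝓘(ℝ, E) 𝓘(ℝ, E).tangent ∞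
      (fun x => (⟨x, Y x⟩ : TangentBundle 𝓘(ℝ, E) M)) m)
    {f : M → ℝ} (hf : ContMDiff 𝓘(ℝ, E) 𝓘(ℝ, ℝ) ∞ f) :
    dFun f m (VectorField.mlieBracket 𝓘(ℝ, E) X Y m) =
      dFun (fun x => dFun f x (Y x)) m (X m) - dFun (fun x => dFun f x (X x)) m (Y m) := by
  have h1 := (hasMFDerivAt_dFun_field (differentiableAt_fieldInChart hX).hasFDerivAt hf).mfderiv
  have h2 := (hasMFDerivAt_dFun_field (differentiableAt_fieldInChart hY).hasFDerivAt hf).mfderiv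
  have h1' := DFunLike.congr_fun h1 (Y m)
  have h2' := DFunLike.congr_fun h2 (X m)
  have h3 := fderiv_fderiv_comm hf m (X m) (Y m)
  have h4 := dFun_self_eq_fderiv ((hf m).mdifferentiableAt (by simp))
    (VectorField.mlieBracket 𝓘(ℝ, E) X Y m)
  rw [mlieBracket_eq_fderiv] at h4 ⊢
  refine h4.trans ?_
  refine Eq.trans ?_ (congrArg₂ (fun a b : ℝ => a - b) h2' h1').symm
  have key : ∀ (B : E →L[ℝ] E →L[ℝ] ℝ) (a : E →L[ℝ] ℝ) (x y : E) (D D' : E →L[ℝ] E),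
      B x y = B y x → a (D' x - D y) = (B.flip y + a.comp D') x - (B.flip x + a.comp D) y := by
    intro B a x y D D' h
    simp [h]
  exact key _ _ _ _ _ _ h3

lemma contMDiffAt_dFun_field {EB HB : Type*} [NormedAddCommGroup EB] [NormedSpace ℝ EB]
    [TopologicalSpace HB] {I : ModelWithCorners ℝ EB HB}
    {B : Type*} [TopologicalSpace B] [ChartedSpace HB B] {g : B → M} {X : ∀ b, Tan E (g b)} {b₀ : B}
    (hX : ContMDiffAt I 𝓘(ℝ, E).tangent ∞
      (fun b => (⟨g b, X b⟩ : TangentBundle 𝓘(ℝ, E) M)) b₀)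
    {f : M → ℝ} (hf : ContMDiff 𝓘(ℝ, E) 𝓘(ℝ, ℝ) ∞ f) :
    ContMDiffAt I 𝓘(ℝ, ℝ) ∞ (fun b => dFun f (g b) (X b)) b₀ := by
  obtain ⟨h1, h2⟩ := contMDiffAt_tangent_iff.1 hX
  have h3 := ContMDiffAt.comp (g := fun x => (dFun (E := E) f x).comp (tangentOfCoord (g b₀) x)) b₀
    (contMDiffAt_dFun_comp_tangentOfCoord (m := g b₀) hf) h1
  refine (h3.clm_apply h2).congr_of_eventuallyEq ?_
  filter_upwards [h1.continuousAt.preimage_mem_nhds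
    (extChartAt_source_mem_nhds (I := 𝓘(ℝ, E)) (g b₀))] with b hb
  exact (congrArg (dFun f (g b)) (tangentOfCoord_tangentCoord hb (X b))).symm

end FunctionCalculus

/-! ### The trilinear form on sections with exact one-forms. -/

section

variable {𝔡 : Type*} [LieRing 𝔡] [LieAlgebra ℝ 𝔡] [Module.Finite ℝ 𝔡] {K : InvariantMetric 𝔡}
  {E : Type*} [NormedAddCommGroup E] [NormedSpace ℝ E] [FiniteDimensional ℝ E]
  {M : Type*} [TopologicalSpace M] [ChartedSpace E M] [IsManifold 𝓘(ℝ, E) ∞ M]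

lemma formInChart_dFun {f : M → ℝ} (hf : ContMDiff 𝓘(ℝ, E) 𝓘(ℝ, ℝ) ∞ f) (m : M) :
    formInChart m (fun x => dFun (E := E) f x) =ᶠ[𝓝 (extChartAt 𝓘(ℝ, E) m m)]
      fderiv ℝ (f ∘ (extChartAt 𝓘(ℝ, E) m).symm) := by
  filter_upwards [extChartAt_target_mem_nhds (I := 𝓘(ℝ, E)) m] with y hy
  have h1 := (extChartAt 𝓘(ℝ, E) m).map_target hy
  have h2 := formInChart_extChartAt h1 (fun x => dFun (E := E) f x)
  rw [dFun_comp_tangentOfCoord h1 ((hf _).mdifferentiableAt (by simp)),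
    (extChartAt 𝓘(ℝ, E) m).right_inv hy] at h2
  exact h2

/-- `courantTri` in terms of functions, for sections whose one-form components are exact. -/
theorem courantTri_of_exact {σ₁ σ₂ σ₃ : ∀ x : M, CFib 𝔡 E x} {f₁ f₂ f₃ : M → ℝ} {m : M}
    (h₁ : SmoothAlongAt 𝓘(ℝ, E) (fun x : M => x) σ₁ m)
    (h₂ : SmoothAlongAt 𝓘(ℝ, E) (fun x : M => x) σ₂ m)
    (hf₁ : ContMDiff 𝓘(ℝ, E) 𝓘(ℝ, ℝ) ∞ f₁) (hf₂ : ContMDiff 𝓘(ℝ, E) 𝓘(ℝ, ℝ) ∞ f₂)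
    (hf₃ : ContMDiff 𝓘(ℝ, E) 𝓘(ℝ, ℝ) ∞ f₃)
    (d₁ : ∀ x, (σ₁ x).2.2 = dFun f₁ x) (d₂ : ∀ x, (σ₂ x).2.2 = dFun f₂ x)
    (d₃ : ∀ x, (σ₃ x).2.2 = dFun f₃ x) :
    courantTri K m σ₁ σ₂ (σ₃ m) = K.form ⁅(σ₁ m).1, (σ₂ m).1⁆ (σ₃ m).1
      + dFun (fun x => K.form (σ₃ m).1 (σ₂ x).1) m (σ₁ m).2.1
      - dFun (fun x => K.form (σ₃ m).1 (σ₁ x).1) m (σ₂ m).2.1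
      + dFun (fun x => K.form (σ₂ m).1 (σ₁ x).1) m (σ₃ m).2.1
      - dFun (fun x => dFun f₃ x (σ₂ x).2.1) m (σ₁ m).2.1
      + dFun (fun x => dFun f₃ x (σ₁ x).2.1) m (σ₂ m).2.1
      - dFun (fun x => dFun f₂ x (σ₁ x).2.1) m (σ₃ m).2.1 := by
  have k₁ := h₁.hasFDerivAt
  have k₂ := h₂.hasFDerivAt
  have a : ∀ {σ : ∀ x : M, CFib 𝔡 E x} {D : E →L[ℝ] 𝔡 × E × (E →L[ℝ] ℝ)} (_ :
      HasFDerivAt (flatSec m σ) D (extChartAt 𝓘(ℝ, E) m m)) (ξ : 𝔡) (v : Tan E m),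
      dFun (fun x => K.form ξ (σ x).1) m v = K.form ξ (D v).1 := fun h ξ v =>
    DFunLike.congr_fun (hasMFDerivAt_algebra h (K.form ξ).toContinuousLinearMap).mfderiv v
  have c : ∀ {σ : ∀ x : M, CFib 𝔡 E x} {D : E →L[ℝ] 𝔡 × E × (E →L[ℝ] ℝ)} {f : M → ℝ} (_ :
      HasFDerivAt (flatSec m σ) D (extChartAt 𝓘(ℝ, E) m m))
      (_ : ContMDiff 𝓘(ℝ, E) 𝓘(ℝ, ℝ) ∞ f) (_ : ∀ x, (σ x).2.2 = dFun f x) (v : E),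
      (D v).2.2 = fderiv ℝ (fderiv ℝ (f ∘ (extChartAt 𝓘(ℝ, E) m).symm))
        (extChartAt 𝓘(ℝ, E) m m) v := by
    intro σ D f h hf hd v
    have g := hasFDerivAt_formInChart h
    have e : (fun x => (σ x).2.2) = fun x => dFun (E := E) f x := funext hd
    rw [e] at g
    have g' := g.congr_of_eventuallyEq (formInChart_dFun hf m).symm
    rw [g'.fderiv]
    rfl
  have b : ∀ {σ : ∀ x : M, CFib 𝔡 E x} {D : E →L[ℝ] 𝔡 × E × (E →L[ℝ] ℝ)} {f : M → ℝ} (_ :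
      HasFDerivAt (flatSec m σ) D (extChartAt 𝓘(ℝ, E) m m))
      (_ : ContMDiff 𝓘(ℝ, E) 𝓘(ℝ, ℝ) ∞ f) (v : Tan E m),
      dFun (fun x => dFun f x (σ x).2.1) m v =
        fderiv ℝ (fderiv ℝ (f ∘ (extChartAt 𝓘(ℝ, E) m).symm)) (extChartAt 𝓘(ℝ, E) m m) v
          (σ m).2.1 + dFun f m (D v).2.1 := by
    intro σ D f h hf v
    refine (DFunLike.congr_fun (hasMFDerivAt_dFun_field (hasFDerivAt_fieldInChart h) hf).mfderiv
      v).trans ?_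
    exact congrArg (fun z : ℝ => _ + z)
      (dFun_self_eq_fderiv ((hf m).mdifferentiableAt (by simp)) (D v).2.1).symm
  rw [a k₂, a k₁, a k₁, b k₂ hf₃, b k₁ hf₃, b k₁ hf₂]
  have s₁ := fderiv_fderiv_comm hf₁ m (σ₂ m).2.1 (σ₃ m).2.1
  have s₃ := fderiv_fderiv_comm hf₃ m (σ₁ m).2.1 (σ₂ m).2.1
  -- `B₁`, `B₂`, `B₃` are the Hessians of `f₁`, `f₂`, `f₃`. By symmetry `B₁` cancels on the left,
  -- `B₃` cancels on the right, and the two occurrences of `B₂` agree.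
  have key : ∀ (D₁ D₂ : E →L[ℝ] 𝔡 × E × (E →L[ℝ] ℝ)) (B₁ B₂ B₃ : E →L[ℝ] E →L[ℝ] ℝ)
      (e₁ e₂ e₃ : 𝔡 × E × (E →L[ℝ] ℝ)), (∀ v, (D₁ v).2.2 = B₁ v) → (∀ v, (D₂ v).2.2 = B₂ v) →
      B₁ e₂.2.1 e₃.2.1 = B₁ e₃.2.1 e₂.2.1 → B₃ e₁.2.1 e₂.2.1 = B₃ e₂.2.1 e₁.2.1 →
      B₂ e₁.2.1 e₃.2.1 = B₂ e₃.2.1 e₁.2.1 →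
      K.form ⁅e₁.1, e₂.1⁆ e₃.1 + flatPair K (D₂ e₁.2.1) e₃ - flatPair K (D₁ e₂.2.1) e₃ +
        flatPair K (D₁ e₃.2.1) e₂ =
      K.form ⁅e₁.1, e₂.1⁆ e₃.1 + K.form e₃.1 (D₂ e₁.2.1).1 - K.form e₃.1 (D₁ e₂.2.1).1 +
        K.form e₂.1 (D₁ e₃.2.1).1 - (B₃ e₁.2.1 e₂.2.1 + e₃.2.2 (D₂ e₁.2.1).2.1) +
        (B₃ e₂.2.1 e₁.2.1 + e₃.2.2 (D₁ e₂.2.1).2.1) -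
        (B₂ e₃.2.1 e₁.2.1 + e₂.2.2 (D₁ e₃.2.1).2.1) := by
    intro D₁ D₂ B₁ B₂ B₃ e₁ e₂ e₃ p₁ p₂ q₁ q₃ q₂
    simp only [flatPair_apply, p₁, p₂, K.form_comm e₃.1, K.form_comm e₂.1]
    linarith
  rw [← d₂, ← d₃]
  exact key _ _ _ _ _ (σ₁ m) (σ₂ m) (σ₃ m) (c k₁ hf₁ d₁) (c k₂ hf₂ d₂) s₁ s₃
    (fderiv_fderiv_comm hf₂ m (σ₁ m).2.1 (σ₃ m).2.1)

end

/-! ### Local sections of submersions and local retractions onto immersions. -/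

section NormalForms

variable {E : Type*} [NormedAddCommGroup E] [NormedSpace ℝ E]
  {M : Type*} [TopologicalSpace M] [ChartedSpace E M] [IsManifold 𝓘(ℝ, E) ∞ M]
  {EP : Type*} [NormedAddCommGroup EP] [NormedSpace ℝ EP]
  {P : Type*} [TopologicalSpace P] [ChartedSpace EP P] [IsManifold 𝓘(ℝ, EP) ∞ P]

/-- In suitable charts `q` is a linear projection; keep the complementary coordinates equal to those
of `p`. -/
lemma exists_local_section {q : P → M} {p : P}
    (h : Manifold.IsSubmersionAt 𝓘(ℝ, EP) 𝓘(ℝ, E) ∞ q p) :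
    ∃ (O : Set M) (j : M → P), IsOpen O ∧ q p ∈ O ∧ ContMDiffOn 𝓘(ℝ, E) 𝓘(ℝ, EP) ∞ j O ∧
      j (q p) = p ∧ ∀ x ∈ O, q (j x) = x := by
  have hw : ∀ u ∈ h.domChart.target, h.codChart (q (h.domChart.symm u)) = (h.equiv u).1 := by
    intro u hu
    have := h.writtenInCharts
      (show u ∈ (h.domChart.extend 𝓘(ℝ, EP)).target by simpa using hu)
    simpa using this
  let g : M → EP := fun x => h.equiv.symm (h.codChart x, (h.equiv (h.domChart p)).2)
  have hgp : g (q p) = h.domChart p := by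
    have h1 := hw _ (h.domChart.map_source h.mem_domChart_source)
    rw [h.domChart.left_inv h.mem_domChart_source] at h1
    change h.equiv.symm (h.codChart (q p), _) = _
    rw [h1]
    exact h.equiv.symm_apply_apply _
  have hg : ContMDiffOn 𝓘(ℝ, E) 𝓘(ℝ, EP) ∞ g h.codChart.source :=
    (h.equiv.symm : E × h.complement →L[ℝ] EP).contMDiff.comp_contMDiffOn
      ((contMDiffOn_of_mem_maximalAtlas h.codChart_mem_maximalAtlas).prodMk_space contMDiffOn_const)
  refine ⟨h.codChart.source ∩ g ⁻¹' h.domChart.target, fun x => h.domChart.symm (g x),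
    hg.continuousOn.isOpen_inter_preimage h.codChart.open_source h.domChart.open_target,
    ⟨h.mem_codChart_source, ?_⟩, ?_, ?_, ?_⟩
  · rw [mem_preimage, hgp]
    exact h.domChart.map_source h.mem_domChart_source
  · exact (contMDiffOn_symm_of_mem_maximalAtlas h.domChart_mem_maximalAtlas).comp
      (hg.mono inter_subset_left) fun x hx => hx.2
  · change h.domChart.symm (g (q p)) = p
    rw [hgp, h.domChart.left_inv h.mem_domChart_source]
  · rintro x ⟨hx1, hx2⟩
    refine h.codChart.injOn (h.source_subset_preimage_source (h.domChart.map_target hx2)) hx1 ?_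
    rw [hw _ hx2]
    change (h.equiv (h.equiv.symm _)).1 = _
    rw [h.equiv.apply_symm_apply]

/-- In suitable charts `i` is `u ↦ (u, 0)`; forget the second coordinate. -/
lemma exists_local_retraction {i : P → M} {p : P}
    (h : Manifold.IsImmersionAt 𝓘(ℝ, EP) 𝓘(ℝ, E) ∞ i p) :
    ∃ (O : Set M) (ρ : M → P), IsOpen O ∧ i p ∈ O ∧ ContMDiffOn 𝓘(ℝ, E) 𝓘(ℝ, EP) ∞ ρ O ∧
      ∀ᶠ x in 𝓝 p, ρ (i x) = x := by
  have hw : ∀ x ∈ h.domChart.source, h.codChart (i x) = h.equiv (h.domChart x, 0) := by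
    intro x hx
    have := h.writtenInCharts
      (show h.domChart x ∈ (h.domChart.extend 𝓘(ℝ, EP)).target by
        simpa using h.domChart.map_source hx)
    simpa [h.domChart.left_inv hx] using this
  let g : M → EP := fun x => (h.equiv.symm (h.codChart x)).1
  have hgi : ∀ x ∈ h.domChart.source, g (i x) = h.domChart x := by
    intro x hx
    change (h.equiv.symm (h.codChart (i x))).1 = _
    rw [hw x hx, h.equiv.symm_apply_apply]
  have hg : ContMDiffOn 𝓘(ℝ, E) 𝓘(ℝ, EP) ∞ g h.codChart.source :=
    ((ContinuousLinearMap.fst ℝ EP h.complement).comp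
      (h.equiv.symm : E →L[ℝ] EP × h.complement)).contMDiff.comp_contMDiffOn
      (contMDiffOn_of_mem_maximalAtlas h.codChart_mem_maximalAtlas)
  refine ⟨h.codChart.source ∩ g ⁻¹' h.domChart.target, fun x => h.domChart.symm (g x),
    hg.continuousOn.isOpen_inter_preimage h.codChart.open_source h.domChart.open_target,
    ⟨h.mem_codChart_source, ?_⟩, ?_, ?_⟩
  · rw [mem_preimage, hgi p h.mem_domChart_source]
    exact h.domChart.map_source h.mem_domChart_source
  · exact (contMDiffOn_symm_of_mem_maximalAtlas h.domChart_mem_maximalAtlas).comp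
      (hg.mono inter_subset_left) fun x hx => hx.2
  · filter_upwards [h.domChart.open_source.mem_nhds h.mem_domChart_source] with x hx
    rw [hgi x hx, h.domChart.left_inv hx]

/-- Compose `u` with a local retraction and cut off. The identity holds near `p` only, which
suffices for derivatives at `p`. -/
lemma exists_extension [FiniteDimensional ℝ E] [T2Space M] {i : P → M} {p : P}
    (h : Manifold.IsImmersionAt 𝓘(ℝ, EP) 𝓘(ℝ, E) ∞ i p) {V : Type*} [NormedAddCommGroup V]
    [NormedSpace ℝ V] {u : P → V} (hu : ContMDiff 𝓘(ℝ, EP) 𝓘(ℝ, V) ∞ u) :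
    ∃ f : M → V, ContMDiff 𝓘(ℝ, E) 𝓘(ℝ, V) ∞ f ∧ ∀ᶠ x in 𝓝 p, f (i x) = u x := by
  obtain ⟨O, ρ, hO, hp, hρ, hρi⟩ := exists_local_retraction h
  obtain ⟨f, hf, hfu⟩ := exists_contMDiff_eventuallyEq hO hp (hu.comp_contMDiffOn hρ)
  refine ⟨f, hf, ?_⟩
  filter_upwards [hρi, h.contMDiffAt.continuousAt.eventually hfu] with x h1 h2
  rw [h2, Function.comp_apply, h1]

lemma dMap_injective {i : P → M} {p : P} (h : Manifold.IsImmersionAt 𝓘(ℝ, EP) 𝓘(ℝ, E) ∞ i p) :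
    Function.Injective (dMap EP E i p) := by
  obtain ⟨O, ρ, hO, hp, hρ, hρi⟩ := exists_local_retraction h
  have h1 : MDifferentiableAt 𝓘(ℝ, E) 𝓘(ℝ, EP) ρ (i p) :=
    (hρ.contMDiffAt (hO.mem_nhds hp)).mdifferentiableAt (by simp)
  have h2 : MDifferentiableAt 𝓘(ℝ, EP) 𝓘(ℝ, E) i p := h.contMDiffAt.mdifferentiableAt (by simp)
  have h3 := mfderiv_comp p h1 h2
  have h4 : ρ ∘ i =ᶠ[𝓝 p] id := hρi
  rw [h4.mfderiv_eq, mfderiv_id] at h3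
  intro v w hvw
  have h5 : ∀ v, v = mfderiv 𝓘(ℝ, E) 𝓘(ℝ, EP) ρ (i p) (dMap EP E i p v) :=
    fun v => DFunLike.congr_fun h3 v
  exact (h5 v).trans ((congrArg _ hvw).trans (h5 w).symm)

end NormalForms

/-! ### Functions along integral curves, and transfer of derivatives between manifolds. -/

section Curves

variable {E : Type*} [NormedAddCommGroup E] [NormedSpace ℝ E]
  {M : Type*} [TopologicalSpace M] [ChartedSpace E M] [IsManifold 𝓘(ℝ, E) ∞ M]

lemma hasDerivWithinAt_comp_integralCurve {V : Type*} [NormedAddCommGroup V] [NormedSpace ℝ V]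
    {v : ∀ x : M, Tan E x} {c : ℝ → M} {I : Set ℝ}
    (hc : IsMIntegralCurveOn (I := 𝓘(ℝ, E)) c v I) {s : ℝ} (hs : s ∈ I) {f : M → V}
    (hf : MDifferentiableAt 𝓘(ℝ, E) 𝓘(ℝ, V) f (c s)) :
    HasDerivWithinAt (fun s => f (c s)) (dVec f (c s) (v (c s))) I s := by
  have h1 := hf.hasMFDerivAt.comp_hasMFDerivWithinAt s (hc s hs)
  have h2 : HasFDerivWithinAt (f ∘ c) ((show E →L[ℝ] V from dVec f (c s)).comp
      ((1 : ℝ →L[ℝ] ℝ).smulRight (show E from v (c s)))) I s := h1.hasFDerivWithinAt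
  have key : ∀ (l : E →L[ℝ] V) (w : E), l (((1 : ℝ →L[ℝ] ℝ).smulRight w) (1 : ℝ)) = l w := by
    intro l w
    simp
  exact h2.hasDerivWithinAt.congr_deriv (key _ _)

lemma eq_of_hasDerivWithinAt_zero {V : Type*} [NormedAddCommGroup V] [NormedSpace ℝ V] {F : ℝ → V}
    (h : ∀ s ∈ Icc (0 : ℝ) 1, HasDerivWithinAt F 0 (Icc 0 1) s) : F 0 = F 1 := by
  refine (constant_of_has_deriv_right_zero (fun s hs => (h s hs).continuousWithinAt)
    (fun s hs => ?_) 1 ⟨zero_le_one, le_rfl⟩).symm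
  exact (h s ⟨hs.1, hs.2.le⟩).mono_of_mem_nhdsWithin (Icc_mem_nhdsGE_of_mem hs)

end Curves

section Transfer

variable {E : Type*} [NormedAddCommGroup E] [NormedSpace ℝ E]
  {M : Type*} [TopologicalSpace M] [ChartedSpace E M] [IsManifold 𝓘(ℝ, E) ∞ M]
  {EP : Type*} [NormedAddCommGroup EP] [NormedSpace ℝ EP]
  {P : Type*} [TopologicalSpace P] [ChartedSpace EP P] [IsManifold 𝓘(ℝ, EP) ∞ P]
  {Er : Type*} [NormedAddCommGroup Er] [NormedSpace ℝ Er]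
  {Mr : Type*} [TopologicalSpace Mr] [ChartedSpace Er Mr] [IsManifold 𝓘(ℝ, Er) ∞ Mr]

lemma dFun_comp_apply {i : P → M} {f : M → ℝ} {p : P}
    (hf : MDifferentiableAt 𝓘(ℝ, E) 𝓘(ℝ, ℝ) f (i p))
    (hi : MDifferentiableAt 𝓘(ℝ, EP) 𝓘(ℝ, E) i p) (U : Tan EP p) :
    dFun (fun x => f (i x)) p U = dFun f (i p) (dMap EP E i p U) :=
  DFunLike.congr_fun (mfderiv_comp p hf hi) U

/-- Functions that correspond to each other along `M ← P → Mr` have the same derivatives. -/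
lemma dFun_eq_of_eventuallyEq {i : P → M} {q : P → Mr} {f : M → ℝ} {g : Mr → ℝ} {p : P}
    (hf : MDifferentiableAt 𝓘(ℝ, E) 𝓘(ℝ, ℝ) f (i p))
    (hi : MDifferentiableAt 𝓘(ℝ, EP) 𝓘(ℝ, E) i p)
    (hg : MDifferentiableAt 𝓘(ℝ, Er) 𝓘(ℝ, ℝ) g (q p))
    (hq : MDifferentiableAt 𝓘(ℝ, EP) 𝓘(ℝ, Er) q p)
    (h : ∀ᶠ x in 𝓝 p, f (i x) = g (q x)) (U : Tan EP p) :
    dFun f (i p) (dMap EP E i p U) = dFun g (q p) (dMap EP Er q p U) := by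
  rw [← dFun_comp_apply hf hi, ← dFun_comp_apply hg hq]
  have h' : (fun x => f (i x)) =ᶠ[𝓝 p] fun x => g (q x) := h
  exact DFunLike.congr_fun h'.mfderiv_eq U

lemma dFun_eq_zero_of_eventually {f : M → ℝ} {m : M} (h : ∀ᶠ x in 𝓝 m, f x = 0) (v : Tan E m) :
    dFun f m v = 0 := by
  have h' : f =ᶠ[𝓝 m] fun _ => 0 := h
  exact DFunLike.congr_fun (h'.mfderiv_eq.trans mfderiv_const) v

/-- Cut-off coordinate functions among the test functions `f` recover the coordinates of `Z`. -/
lemma contMDiffAt_tangent_of_forall [FiniteDimensional ℝ E] [T2Space M] {Z : ∀ x : M, Tan E x}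
    {m : M} (h : ∀ f : M → ℝ, ContMDiff 𝓘(ℝ, E) 𝓘(ℝ, ℝ) ∞ f →
      ContMDiffAt 𝓘(ℝ, E) 𝓘(ℝ, ℝ) ∞ (fun x => dFun f x (Z x)) m) :
    ContMDiffAt 𝓘(ℝ, E) 𝓘(ℝ, E).tangent ∞
      (fun x => (⟨x, Z x⟩ : TangentBundle 𝓘(ℝ, E) M)) m := by
  refine contMDiffAt_tangent_iff.2 ⟨contMDiffAt_id, contMDiffAt_of_forall_dual fun φ => ?_⟩
  let a : E →L[ℝ] ℝ := φ.toContinuousLinearMap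
  have hu : ContMDiffOn 𝓘(ℝ, E) 𝓘(ℝ, ℝ) ∞ (fun x => a (extChartAt 𝓘(ℝ, E) m x))
      (chartAt E m).source := fun x hx =>
    (ContMDiffAt.comp (g := a) (f := extChartAt 𝓘(ℝ, E) m) x a.contMDiff.contMDiffAt
      (contMDiffAt_extChartAt' hx)).contMDiffWithinAt
  obtain ⟨f, hf, hfu⟩ := exists_contMDiff_eventuallyEq (chartAt E m).open_source
    (mem_chart_source E m) hu
  refine (h f hf).congr_of_eventuallyEq ?_
  filter_upwards [eventually_eventually_nhds.2 hfu,
    (chartAt E m).open_source.mem_nhds (mem_chart_source E m)] with x hx hxs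
  have h1 : dFun (E := E) f x = dFun (fun x => a (extChartAt 𝓘(ℝ, E) m x)) x :=
    EventuallyEq.mfderiv_eq hx
  rw [h1]
  refine Eq.symm (Eq.trans (DFunLike.congr_fun (mfderiv_comp (g := a)
    (f := extChartAt 𝓘(ℝ, E) m) x a.mdifferentiableAt
    (mdifferentiableAt_extChartAt hxs)) (Z x)) ?_)
  exact DFunLike.congr_fun (a.mfderiv_eq (x := extChartAt 𝓘(ℝ, E) m x)) (tangentCoord m x (Z x))

/-- A flow step lasts unit time; rescaling time by `s` replaces `v` by `s • v`. This keeps every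
intermediate point of the curve in one leaf. -/
lemma flowStep_of_mem_Icc {F : Set (∀ x : M, Tan E x)} (hF : ∀ (a : ℝ), ∀ v ∈ F, a • v ∈ F)
    {v : ∀ x : M, Tan E x} (hv : v ∈ F) {c : ℝ → M}
    (hc : IsMIntegralCurveOn (I := 𝓘(ℝ, E)) c v (Icc 0 1)) {s : ℝ} (hs : s ∈ Icc (0 : ℝ) 1) :
    FlowStep F (c 0) (c s) := by
  refine ⟨s • v, hF s v hv, c ∘ (· * s), (hc.comp_mul s).mono fun r hr => ?_, by simp, by simp⟩
  exact ⟨mul_nonneg hr.1 hs.1, mul_le_one₀ hr.2 hs.1 hs.2⟩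

lemma eq_of_forall_hasDerivWithinAt_zero {F : ℝ → E}
    (h : ∀ a : E →L[ℝ] ℝ, ∀ s ∈ Icc (0 : ℝ) 1,
      HasDerivWithinAt (fun s => a (F s)) 0 (Icc 0 1) s) : F 0 = F 1 := by
  by_contra hne
  obtain ⟨a, ha⟩ := exists_clm_apply_ne_zero (sub_ne_zero.2 hne)
  rw [map_sub, sub_ne_zero] at ha
  exact ha (eq_of_hasDerivWithinAt_zero (h a))

end Transfer

/-! ### The reduced action on the quotient of `S`. -/

section Base

variable {𝔡 : Type*} [LieRing 𝔡] [LieAlgebra ℝ 𝔡] {K : InvariantMetric 𝔡}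
  {E : Type*} [NormedAddCommGroup E] [NormedSpace ℝ E]
  {N : Type*} [TopologicalSpace N] [ChartedSpace E N] [IsManifold 𝓘(ℝ, E) ∞ N]
  {ES : Type*} [NormedAddCommGroup ES] [NormedSpace ℝ ES]
  {S : Type*} [TopologicalSpace S] [ChartedSpace ES S] [IsManifold 𝓘(ℝ, ES) ∞ S]
  {Er : Type*} [NormedAddCommGroup Er] [NormedSpace ℝ Er]
  {Nr : Type*} [TopologicalSpace Nr] [ChartedSpace Er Nr] [IsManifold 𝓘(ℝ, Er) ∞ Nr]

/-- The conditions on `S ⊆ N` in the definition of reductive data. -/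
structure IsReductiveBase (ES Er : Type*) [NormedAddCommGroup ES] [NormedSpace ℝ ES]
    [NormedAddCommGroup Er] [NormedSpace ℝ Er]
    {S : Type*} [TopologicalSpace S] [ChartedSpace ES S]
    {Nr : Type*} [TopologicalSpace Nr] [ChartedSpace Er Nr]
    (A : CourantAction K E N) (𝔠 : LieSubalgebra ℝ 𝔡) (i : S → N) (q : S → Nr) : Prop where
  coisotropic : K.IsCoisotropic 𝔠.toSubmodule
  immersion : Manifold.IsImmersion 𝓘(ℝ, ES) 𝓘(ℝ, E) ∞ i
  invariant : ∀ ξ ∈ 𝔠, ∀ s : S, ∃ w : Tan ES s, dMap ES E i s w = A.field ξ (i s)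
  foliation : IsRegularFoliation ES Er (actionFields A (K.perp 𝔠.toSubmodule) ES i) q

namespace IsReductiveBase

variable {A : CourantAction K E N} {𝔠 : LieSubalgebra ℝ 𝔡} {i : S → N} {q : S → Nr}
  (h : IsReductiveBase ES Er A 𝔠 i q)

include h

lemma mdifferentiableAt_i (s : S) : MDifferentiableAt 𝓘(ℝ, ES) 𝓘(ℝ, E) i s :=
  (h.immersion.isImmersionAt s).contMDiffAt.mdifferentiableAt (by simp)

lemma mdifferentiableAt_q (s : S) : MDifferentiableAt 𝓘(ℝ, ES) 𝓘(ℝ, Er) q s :=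
  (h.foliation.submersion.isSubmersionAt s).contMDiffAt.mdifferentiableAt (by simp)

lemma injective (s : S) : Function.Injective (dMap ES E i s) :=
  dMap_injective (h.immersion.isImmersionAt s)

/-- The vector fields by which `𝔠` acts on `S`. -/
lemma exists_restrict : ∃ w : ∀ s : S, 𝔠 →ₗ[ℝ] Tan ES s,
    ∀ s ξ, dMap ES E i s (w s ξ) = A.field ξ (i s) := by
  choose w hw using fun (s : S) (ξ : 𝔠) => h.invariant ξ ξ.2 s
  refine ⟨fun s => ⟨⟨w s, fun ξ η => h.injective s ?_⟩, fun r ξ => h.injective s ?_⟩, hw⟩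
  · rw [hw, map_add, hw, hw]
    exact congrFun (map_add A.field (ξ : 𝔡) η) (i s)
  · rw [hw, map_smul, hw]
    exact congrFun (map_smul A.field r (ξ : 𝔡)) (i s)

def restrict (s : S) : 𝔠 →ₗ[ℝ] Tan ES s := h.exists_restrict.choose s

lemma dMap_restrict (s : S) (ξ : 𝔠) : dMap ES E i s (h.restrict s ξ) = A.field ξ (i s) :=
  h.exists_restrict.choose_spec s ξ

lemma eq_restrict {s : S} {ξ : 𝔠} {w : Tan ES s} (hw : dMap ES E i s w = A.field ξ (i s)) :
    w = h.restrict s ξ :=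
  h.injective s (hw.trans (h.dMap_restrict s ξ).symm)

lemma dMap_restrict_perp (s : S) {ξ : 𝔠} (hξ : (ξ : 𝔡) ∈ K.perp 𝔠.toSubmodule) :
    dMap ES Er q s (h.restrict s ξ) = 0 :=
  (h.foliation.vertical s _).2 ⟨fun s => h.restrict s ξ, ⟨ξ, hξ, fun s => h.dMap_restrict s ξ⟩, rfl⟩

/-- The vector of `Nr` at `q s` by which `ξ ∈ 𝔠` acts. -/
def fieldAt (s : S) : K.Reduced 𝔠 →ₗ[ℝ] Er :=
  (K.perpIdeal 𝔠).toSubmodule.liftQ ((dMap ES Er q s : ES →L[ℝ] Er).toLinearMap ∘ₗ h.restrict s)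
    fun _ hξ => h.dMap_restrict_perp s hξ

/-- Derivatives of functions along the reduced fields. -/
lemma dFun_fieldAt {k : N → ℝ} {f : Nr → ℝ} (hk : ContMDiff 𝓘(ℝ, E) 𝓘(ℝ, ℝ) ∞ k)
    (hf : ContMDiff 𝓘(ℝ, Er) 𝓘(ℝ, ℝ) ∞ f) {s : S} (hkf : ∀ᶠ x in 𝓝 s, k (i x) = f (q x)) (ξ : 𝔠) :
    dFun f (q s) (h.fieldAt s (K.toReduced 𝔠 ξ)) = dFun k (i s) (A.field ξ (i s)) := by
  rw [← h.dMap_restrict]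
  exact (dFun_eq_of_eventuallyEq ((hk _).mdifferentiableAt (by simp)) (h.mdifferentiableAt_i s)
    ((hf _).mdifferentiableAt (by simp)) (h.mdifferentiableAt_q s) hkf _).symm

lemma dFun_field_perp {k : N → ℝ} {f : Nr → ℝ} (hk : ContMDiff 𝓘(ℝ, E) 𝓘(ℝ, ℝ) ∞ k)
    (hf : ContMDiff 𝓘(ℝ, Er) 𝓘(ℝ, ℝ) ∞ f) {s : S} (hkf : ∀ᶠ x in 𝓝 s, k (i x) = f (q x)) {ξ : 𝔠}
    (hξ : K.toReduced 𝔠 ξ = 0) : dFun k (i s) (A.field ξ (i s)) = 0 := by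
  have h1 := h.dFun_fieldAt hk hf hkf ξ
  have h2 : h.fieldAt s (K.toReduced 𝔠 ξ) = 0 := by rw [hξ, map_zero]
  exact h1.symm.trans ((congrArg (dFun f (q s)) h2).trans (map_zero _))

lemma contMDiff_dFun_field (A : CourantAction K E N) {k : N → ℝ}
    (hk : ContMDiff 𝓘(ℝ, E) 𝓘(ℝ, ℝ) ∞ k) (ξ : 𝔡) :
    ContMDiff 𝓘(ℝ, E) 𝓘(ℝ, ℝ) ∞ (fun n => dFun k n (A.field ξ n)) := fun n =>
  contMDiffAt_dFun_field (A.smooth ξ n) hk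

/-- Let `w ∈ 𝔠ᗮ` generate the curve and let `k` extend `f ∘ q`. Then `w (ξ k) = [w, ξ] k + ξ (w k)`.
On `S` both terms vanish, since `w` and `[w, ξ]` lie in `𝔠ᗮ` and project to zero. So `ξ k`, the
derivative of `f` along the projected vector, is constant along the curve. -/
lemma fieldAt_eq_of_flowStep [FiniteDimensional ℝ E] [T2Space N] [FiniteDimensional ℝ Er]
    [T2Space Nr] {s s' : S}
    (hs : FlowStep (actionFields A (K.perp 𝔠.toSubmodule) ES i) s s') (ξ : 𝔠) :
    h.fieldAt s (K.toReduced 𝔠 ξ) = h.fieldAt s' (K.toReduced 𝔠 ξ) := by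
  obtain ⟨v, hv, c, hc, rfl, rfl⟩ := hs
  have hqc : ∀ r ∈ Icc (0 : ℝ) 1, q (c r) = q (c 0) := by
    intro r hr
    refine ((h.foliation.fibres _ _).2 (Relation.EqvGen.rel _ _ (flowStep_of_mem_Icc ?_ hv hc hr))).symm
    rintro a v ⟨w, hw, hwv⟩
    refine ⟨a • w, Submodule.smul_mem _ a hw, fun s => ?_⟩
    rw [map_smul, Pi.smul_apply, Pi.smul_apply, map_smul, hwv]
  obtain ⟨w, hw, hwv⟩ := hv
  lift w to 𝔠 using h.coisotropic hw
  have hvw : ∀ s, v s = h.restrict s w := fun s => h.eq_restrict (hwv s)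
  refine eq_of_forall_hasDerivWithinAt_zero (F := fun r => h.fieldAt (c r) (K.toReduced 𝔠 ξ))
    fun a s hs => ?_
  -- The curve stays over the single point `q (c 0)`, so one `f` serves for all times, while its
  -- extension `k` is chosen near each `c s`.
  obtain ⟨f, hf, hfa⟩ := exists_dFun_eq (E := Er) (q (c 0)) a
  have hfa' : ∀ x, x = q (c 0) → ∀ Z : Er, dFun (E := Er) f x Z = a Z := by
    rintro _ rfl Z
    exact DFunLike.congr_fun hfa Z
  have hq : ContMDiff 𝓘(ℝ, ES) 𝓘(ℝ, Er) ∞ q := fun s =>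
    (h.foliation.submersion.isSubmersionAt s).contMDiffAt
  obtain ⟨k, hk, hkf⟩ := exists_extension (h.immersion.isImmersionAt (c s)) (hf.comp hq)
  have hu := contMDiff_dFun_field h A hk ξ
  have hu' := contMDiff_dFun_field h A hk (w : 𝔡)
  have hcs : ContinuousWithinAt c (Icc 0 1) s := (hc s hs).1
  have hd := hasDerivWithinAt_comp_integralCurve hc hs
    (f := fun x => dFun k (i x) (A.field ξ (i x)))
    (((hu _).mdifferentiableAt (by simp)).comp (c s) (h.mdifferentiableAt_i (c s)))
  have hd0 : dVec (fun x => dFun k (i x) (A.field ξ (i x))) (c s) (v (c s)) = 0 := by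
    refine (dFun_comp_apply ((hu _).mdifferentiableAt (by simp)) (h.mdifferentiableAt_i (c s))
      (v (c s))).trans ?_
    rw [hwv]
    have h1 := dFun_mlieBracket (A.smooth w (i (c s))) (A.smooth ξ (i (c s))) hk
    rw [← A.field_lie] at h1
    have h2 : dFun k (i (c s)) (A.field ⁅(w : 𝔡), (ξ : 𝔡)⁆ (i (c s))) = 0 := by
      refine h.dFun_field_perp hk hf hkf (ξ := ⁅w, ξ⁆) ?_
      rw [K.toReduced_lie, (K.toReduced_eq_zero 𝔠).2 hw, zero_lie]
    -- `w k` vanishes along `S` near `c s`, and `ξ` is tangent to `S`.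
    have h3 : dFun (fun n => dFun k n (A.field w n)) (i (c s)) (A.field ξ (i (c s))) = 0 := by
      rw [← h.dMap_restrict, ← dFun_comp_apply ((hu' _).mdifferentiableAt (by simp))
        (h.mdifferentiableAt_i (c s))]
      refine dFun_eq_zero_of_eventually ?_ _
      filter_upwards [eventually_eventually_nhds.2 hkf] with x hx
      exact h.dFun_field_perp hk hf hx ((K.toReduced_eq_zero 𝔠).2 hw)
    rw [h2, h3, sub_zero] at h1
    exact h1.symm
  rw [hd0] at hd
  refine hd.congr_of_eventuallyEq_of_mem ?_ hs
  filter_upwards [hcs.eventually (eventually_eventually_nhds.2 hkf), self_mem_nhdsWithin]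
    with r hr hrI
  rw [← h.dFun_fieldAt hk hf hr ξ, hfa' _ (hqc r hrI)]

lemma fieldAt_eq [FiniteDimensional ℝ E] [T2Space N] [FiniteDimensional ℝ Er]
    [T2Space Nr] {s s' : S} (hs : q s = q s') : h.fieldAt s = h.fieldAt s' := by
  refine LinearMap.ext fun η => ?_
  obtain ⟨ξ, rfl⟩ := K.toReduced_surjective 𝔠 η
  induction (h.foliation.fibres s s').1 hs with
  | rel x y hxy => exact h.fieldAt_eq_of_flowStep hxy ξ
  | refl x => rfl
  | symm x y hxy ih => exact (ih ((h.foliation.fibres _ _).2 hxy)).symm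
  | trans x y z hxy hyz ih1 ih2 =>
    exact (ih1 ((h.foliation.fibres _ _).2 hxy)).trans (ih2 ((h.foliation.fibres _ _).2 hyz))

variable [FiniteDimensional ℝ E] [T2Space N] [FiniteDimensional ℝ Er] [T2Space Nr]

/-- The action of `𝔡_𝔠` on `Nr`. -/
def reducedField : K.Reduced 𝔠 →ₗ[ℝ] (∀ n : Nr, Tan Er n) :=
  LinearMap.pi fun n => (show K.Reduced 𝔠 →ₗ[ℝ] Tan Er n from
    h.fieldAt (Function.surjInv h.foliation.surjective n))

lemma reducedField_apply (η : K.Reduced 𝔠) (s : S) : h.reducedField η (q s) = h.fieldAt s η :=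
  LinearMap.congr_fun (h.fieldAt_eq (Function.surjInv_eq h.foliation.surjective (q s))) η

lemma dFun_reducedField {k : N → ℝ} {f : Nr → ℝ} (hk : ContMDiff 𝓘(ℝ, E) 𝓘(ℝ, ℝ) ∞ k)
    (hf : ContMDiff 𝓘(ℝ, Er) 𝓘(ℝ, ℝ) ∞ f) {s : S} (hkf : ∀ᶠ x in 𝓝 s, k (i x) = f (q x)) (ξ : 𝔠) :
    dFun f (q s) (h.reducedField (K.toReduced 𝔠 ξ) (q s)) = dFun k (i s) (A.field ξ (i s)) :=
  (congrArg (dFun f (q s)) (h.reducedField_apply _ s)).trans (h.dFun_fieldAt hk hf hkf ξ)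

lemma exists_lift {f : Nr → ℝ} (hf : ContMDiff 𝓘(ℝ, Er) 𝓘(ℝ, ℝ) ∞ f) (s : S) :
    ∃ k : N → ℝ, ContMDiff 𝓘(ℝ, E) 𝓘(ℝ, ℝ) ∞ k ∧ ∀ᶠ x in 𝓝 s, k (i x) = f (q x) :=
  exists_extension (h.immersion.isImmersionAt s)
    (hf.comp fun s => (h.foliation.submersion.isSubmersionAt s).contMDiffAt)

/-- Tested on `f`, the reduced field is the smooth function `ξ k` on `N` composed with `i` and a
local section of `q`. -/
lemma contMDiff_reducedField (η : K.Reduced 𝔠) : ContMDiff 𝓘(ℝ, Er) 𝓘(ℝ, Er).tangent ∞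
    (fun n => (⟨n, h.reducedField η n⟩ : TangentBundle 𝓘(ℝ, Er) Nr)) := by
  intro n
  obtain ⟨s, rfl⟩ := h.foliation.surjective n
  obtain ⟨ξ, rfl⟩ := K.toReduced_surjective 𝔠 η
  refine contMDiffAt_tangent_of_forall fun f hf => ?_
  obtain ⟨k, hk, hkf⟩ := h.exists_lift hf s
  obtain ⟨O, j, hO, hsO, hj, hjs, hqj⟩ :=
    exists_local_section (h.foliation.submersion.isSubmersionAt s)
  have hj' : ContMDiffAt 𝓘(ℝ, Er) 𝓘(ℝ, ES) ∞ j (q s) := hj.contMDiffAt (hO.mem_nhds hsO)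
  have hi : ContMDiff 𝓘(ℝ, ES) 𝓘(ℝ, E) ∞ i := fun s => (h.immersion.isImmersionAt s).contMDiffAt
  have hu := ((contMDiff_dFun_field h A hk ξ).comp hi).contMDiffAt.comp (q s) hj'
  refine hu.congr_of_eventuallyEq ?_
  have hjn : ∀ᶠ n in 𝓝 (q s), ∀ᶠ x in 𝓝 (j n), k (i x) = f (q x) := by
    have hjt : Tendsto j (𝓝 (q s)) (𝓝 s) := by simpa only [ContinuousAt, hjs] using hj'.continuousAt
    exact hjt.eventually (eventually_eventually_nhds.2 hkf)
  filter_upwards [hjn, hO.mem_nhds hsO] with n hn hnO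
  have h1 := h.dFun_reducedField hk hf hn ξ
  rw [hqj n hnO] at h1
  exact h1

/-- Vectors are compared as derivations. If `k` extends `f ∘ q`, then `ζ k` extends the reduced
derivative of `f` composed with `q`; second derivatives therefore transfer as well, and with them
the commutator. -/
lemma reducedField_lie (η θ : K.Reduced 𝔠) (n : Nr) : h.reducedField ⁅η, θ⁆ n =
    VectorField.mlieBracket 𝓘(ℝ, Er) (h.reducedField η) (h.reducedField θ) n := by
  obtain ⟨s, rfl⟩ := h.foliation.surjective n
  by_contra hne
  obtain ⟨a, ha⟩ : ∃ a : Cotan Er (q s), a (h.reducedField ⁅η, θ⁆ (q s) -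
      VectorField.mlieBracket 𝓘(ℝ, Er) (h.reducedField η) (h.reducedField θ) (q s)) ≠ 0 :=
    exists_clm_apply_ne_zero (E := Er) (sub_ne_zero.2 hne)
  obtain ⟨f, hf, hfa⟩ := exists_dFun_eq (E := Er) (q s) a
  rw [map_sub, sub_ne_zero, ← hfa, dFun_mlieBracket (h.contMDiff_reducedField η (q s))
    (h.contMDiff_reducedField θ (q s)) hf] at ha
  refine ha ?_
  obtain ⟨ξ, rfl⟩ := K.toReduced_surjective 𝔠 η
  obtain ⟨ζ, rfl⟩ := K.toReduced_surjective 𝔠 θ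
  obtain ⟨k, hk, hkf⟩ := h.exists_lift hf s
  have key : ∀ ξ ζ : 𝔠, dFun (fun x => dFun f x (h.reducedField (K.toReduced 𝔠 ζ) x)) (q s)
      (h.reducedField (K.toReduced 𝔠 ξ) (q s)) =
      dFun (fun x => dFun k x (A.field ζ x)) (i s) (A.field ξ (i s)) := by
    intro ξ ζ
    refine h.dFun_reducedField (contMDiff_dFun_field h A hk ζ)
      (fun x => contMDiffAt_dFun_field (h.contMDiff_reducedField (K.toReduced 𝔠 ζ) x) hf) ?_ ξ
    filter_upwards [eventually_eventually_nhds.2 hkf] with x hx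
    exact (h.dFun_reducedField hk hf hx ζ).symm
  rw [key, key, ← K.toReduced_lie, h.dFun_reducedField hk hf hkf,
    ← dFun_mlieBracket (A.smooth ξ (i s)) (A.smooth ζ (i s)) hk, ← A.field_lie]
  rfl

variable [Module.Finite ℝ 𝔡]

/-- With `V` the stabilizer in `𝔡`, the reduced stabilizer contains the image of `V ∩ 𝔠`. A class
orthogonal to it is represented in `(V ∩ 𝔠)ᗮ = Vᗮ + 𝔠ᗮ`, hence by an element of `Vᗮ ∩ 𝔠 ⊆ V ∩ 𝔠`. -/
lemma reducedField_coisotropic (n : Nr) : (K.reduce 𝔠).IsCoisotropic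
    (LinearMap.ker ((LinearMap.proj n).comp h.reducedField)) := by
  obtain ⟨s, rfl⟩ := h.foliation.surjective n
  intro η hη
  obtain ⟨ξ, rfl⟩ := K.toReduced_surjective 𝔠 η
  have hker : ∀ ζ : 𝔠, A.field ζ (i s) = 0 → K.toReduced 𝔠 ζ ∈
      LinearMap.ker ((LinearMap.proj (q s)).comp h.reducedField) := by
    intro ζ hζ
    have h0 : h.restrict s ζ = 0 := (h.eq_restrict ((map_zero _).trans hζ.symm)).symm
    have h2 : h.fieldAt s (K.toReduced 𝔠 ζ) = 0 :=
      (congrArg (dMap ES Er q s) h0).trans (map_zero (dMap ES Er q s))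
    exact LinearMap.mem_ker.2 ((h.reducedField_apply (K.toReduced 𝔠 ζ) s).trans h2)
  let V : Submodule ℝ 𝔡 := LinearMap.ker ((LinearMap.proj (i s)).comp A.field)
  have h1 : (ξ : 𝔡) ∈ K.perp V ⊔ K.perp 𝔠.toSubmodule := by
    refine InvariantMetric.mem_of_form_eq_zero (K := K) fun y hy => ?_
    have hyV : y ∈ V := by
      rw [← K.perp_perp V]
      exact fun z hz => hy z (le_sup_left (a := K.perp V) (b := K.perp 𝔠.toSubmodule) hz)
    have hyc : y ∈ 𝔠.toSubmodule := by
      rw [← K.perp_perp 𝔠.toSubmodule]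
      exact fun z hz => hy z (le_sup_right (a := K.perp V) (b := K.perp 𝔠.toSubmodule) hz)
    exact hη _ (hker ⟨y, hyc⟩ hyV)
  obtain ⟨a, ha, b, hb, hab⟩ := Submodule.mem_sup.1 h1
  have hb' : b ∈ 𝔠 := h.coisotropic hb
  have ha' : a ∈ 𝔠 := by
    rw [← sub_eq_of_eq_add hab.symm]
    exact 𝔠.sub_mem ξ.2 hb'
  have hξ : ξ = ⟨a, ha'⟩ + ⟨b, hb'⟩ := Subtype.ext hab.symm
  rw [hξ, map_add, (K.toReduced_eq_zero 𝔠 (x := ⟨b, hb'⟩)).2 hb, add_zero]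
  exact hker ⟨a, ha'⟩ (A.coisotropic (i s) ha)

/-- The action of `𝔡_𝔠` on the quotient of `S`. -/
def reducedAction : CourantAction (K.reduce 𝔠) Er Nr where
  field := h.reducedField
  smooth := h.contMDiff_reducedField
  field_lie := h.reducedField_lie
  coisotropic := h.reducedField_coisotropic

lemma dMap_q_eq (ξ : 𝔠) {s : S} {w : Tan ES s} (hw : dMap ES E i s w = A.field ξ (i s)) :
    dMap ES Er q s w = h.reducedAction.field (K.toReduced 𝔠 ξ) (q s) := by
  rw [h.eq_restrict hw]
  exact (h.reducedField_apply (K.toReduced 𝔠 ξ) s).symm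

end IsReductiveBase

end Base

/-! ### The reduced fibres are constant along the leaves of `P`. -/

section Moment

variable {𝔡 : Type*} [LieRing 𝔡] [LieAlgebra ℝ 𝔡] [Module.Finite ℝ 𝔡] {K : InvariantMetric 𝔡}
  {E : Type*} [NormedAddCommGroup E] [NormedSpace ℝ E] [FiniteDimensional ℝ E]
  {M : Type*} [TopologicalSpace M] [T2Space M] [ChartedSpace E M] [IsManifold 𝓘(ℝ, E) ∞ M]
  {EP : Type*} [NormedAddCommGroup EP] [NormedSpace ℝ EP] [FiniteDimensional ℝ EP]
  {P : Type*} [TopologicalSpace P] [ChartedSpace EP P] [IsManifold 𝓘(ℝ, EP) ∞ P]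
  {Er : Type*} [NormedAddCommGroup Er] [NormedSpace ℝ Er] [FiniteDimensional ℝ Er]
  {Mr : Type*} [TopologicalSpace Mr] [T2Space Mr] [ChartedSpace Er Mr] [IsManifold 𝓘(ℝ, Er) ∞ Mr]

/-- The vector fields on `P` by which the elements of `V ⊆ 𝔥` act. -/
def tangentFields (L : ∀ m : M, Submodule ℝ (CFib 𝔡 E m)) (V : Submodule ℝ 𝔡)
    (EP : Type*) [NormedAddCommGroup EP] [NormedSpace ℝ EP]
    {P : Type*} [TopologicalSpace P] [ChartedSpace EP P] (i : P → M) : Set (∀ p : P, Tan EP p) :=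
  {v | ∃ w ∈ V, ∀ p : P, (w, dMap EP E i p (v p), 0) ∈ L (i p)}

/-- The conditions on `P ⊆ M` in the definition of reductive data, in terms of the fibres of
the Dirac structure. -/
structure IsReductiveMoment (K : InvariantMetric 𝔡) (EP Er : Type*)
    [NormedAddCommGroup EP] [NormedSpace ℝ EP] [FiniteDimensional ℝ EP]
    [NormedAddCommGroup Er] [NormedSpace ℝ Er] [FiniteDimensional ℝ Er]
    {P : Type*} [TopologicalSpace P] [ChartedSpace EP P]
    {Mr : Type*} [TopologicalSpace Mr] [ChartedSpace Er Mr]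
    (𝔥 𝔠 : LieSubalgebra ℝ 𝔡) (L : ∀ m : M, Submodule ℝ (CFib 𝔡 E m))
    (i : P → M) (q : P → Mr) : Prop where
  lagrangian : K.IsLagrangian 𝔥.toSubmodule
  coisotropic : K.IsCoisotropic 𝔠.toSubmodule
  manin : ∀ x, IsManinFibre (E := E) K 𝔥.toSubmodule (L x)
  subbundle : ∀ (m : M), ∀ e ∈ L m, ∃ σ : ∀ x : M, CFib 𝔡 E x,
    IsSmoothAlong 𝓘(ℝ, E) (fun x : M => x) σ ∧ (∀ x, σ x ∈ L x) ∧ σ m = e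
  courantTri_eq_zero : ∀ σ₁ σ₂ : ∀ x : M, CFib 𝔡 E x,
    IsSmoothAlong 𝓘(ℝ, E) (fun x : M => x) σ₁ → IsSmoothAlong 𝓘(ℝ, E) (fun x : M => x) σ₂ →
    (∀ x, σ₁ x ∈ L x) → (∀ x, σ₂ x ∈ L x) → ∀ m, ∀ e₃ ∈ L m, courantTri K m σ₁ σ₂ e₃ = 0
  immersion : Manifold.IsImmersion 𝓘(ℝ, EP) 𝓘(ℝ, E) ∞ i
  reductive : ∀ p : P, IsReductiveFibre (K := K) (E := E) (EP := EP) (Er := Er) 𝔥 𝔠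
    (dMap EP E i p) (dMap EP Er q p) (L (i p))
  foliation : IsRegularFoliation EP Er
    (tangentFields L (𝔥.toSubmodule ⊓ K.perp 𝔠.toSubmodule) EP i) q

/-- The reduction of the Dirac structure, in terms of a point of `P`. -/
def reducedFibreAt (K : InvariantMetric 𝔡) (EP Er : Type*)
    [NormedAddCommGroup EP] [NormedSpace ℝ EP] [FiniteDimensional ℝ EP]
    [NormedAddCommGroup Er] [NormedSpace ℝ Er] [FiniteDimensional ℝ Er]
    {P : Type*} [TopologicalSpace P] [ChartedSpace EP P]
    {Mr : Type*} [TopologicalSpace Mr] [ChartedSpace Er Mr]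
    (𝔠 : LieSubalgebra ℝ 𝔡) (L : ∀ m : M, Submodule ℝ (CFib 𝔡 E m))
    (i : P → M) (q : P → Mr) (p : P) : Submodule ℝ (K.Reduced 𝔠 × Er × (Er →L[ℝ] ℝ)) :=
  reducedFibre (E := E) (EP := EP) (Er := Er) K 𝔠 (dMap EP E i p) (dMap EP Er q p) (L (i p))

/-- The section `σ` of `L`, whose one-form component is `df`, descends near `p` to a section of the
reduction with one-form component `dg`, whose component in `𝔥_𝔠` is `ζ`. -/
structure IsLift (K : InvariantMetric 𝔡) (EP Er : Type*)
    [NormedAddCommGroup EP] [NormedSpace ℝ EP] [FiniteDimensional ℝ EP]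
    [NormedAddCommGroup Er] [NormedSpace ℝ Er] [FiniteDimensional ℝ Er]
    {P : Type*} [TopologicalSpace P] [ChartedSpace EP P]
    {Mr : Type*} [TopologicalSpace Mr] [ChartedSpace Er Mr] {𝔠 : LieSubalgebra ℝ 𝔡}
    (L : ∀ m : M, Submodule ℝ (CFib 𝔡 E m)) (i : P → M) (q : P → Mr)
    (t : K.Reduced 𝔠 →ₗ[ℝ] K.Reduced 𝔠) (σ : ∀ x : M, CFib 𝔡 E x) (f : M → ℝ)
    (ζ : K.Reduced 𝔠) (g : Mr → ℝ) (p : P) : Prop where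
  smooth : IsSmoothAlong 𝓘(ℝ, E) (fun x : M => x) σ
  mem : ∀ x, σ x ∈ L x
  contMDiff : ContMDiff 𝓘(ℝ, E) 𝓘(ℝ, ℝ) ∞ f
  exact : ∀ x, (σ x).2.2 = dFun f x
  rel : ∀ᶠ x in 𝓝 p, f (i x) = g (q x)
  reduces : ∀ᶠ x in 𝓝 p, ∃ (h : (σ (i x)).1 ∈ 𝔠) (U : Tan EP x),
    dMap EP E i x U = (σ (i x)).2.1 ∧ t (K.toReduced 𝔠 ⟨_, h⟩) = ζ ∧
    (K.toReduced 𝔠 ⟨_, h⟩, dMap EP Er q x U, dFun (E := Er) g (q x)) ∈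
      reducedFibreAt K EP Er 𝔠 L i q x

lemma differentiableWithinAt_of_forall_dual {V : Type*} [NormedAddCommGroup V] [NormedSpace ℝ V]
    [FiniteDimensional ℝ V] {F : ℝ → V} {I : Set ℝ} {s : ℝ}
    (h : ∀ φ : V →ₗ[ℝ] ℝ, DifferentiableWithinAt ℝ (fun r => φ (F r)) I s) :
    DifferentiableWithinAt ℝ F I s := by
  let T : (Fin (Module.finrank ℝ V) → ℝ) →L[ℝ] V :=
    (Module.finBasis ℝ V).equivFun.symm.toLinearMap.toContinuousLinearMap
  have h1 : DifferentiableWithinAt ℝ (fun r j => (Module.finBasis ℝ V).coord j (F r)) I s :=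
    differentiableWithinAt_pi.2 fun j => h _
  have h2 := T.differentiableAt.comp_differentiableWithinAt s h1
  have h3 : (T ∘ fun r j => (Module.finBasis ℝ V).coord j (F r)) = F :=
    funext fun r => (Module.finBasis ℝ V).equivFun.symm_apply_apply (F r)
  rwa [h3] at h2

lemma IsManinFibre.mem_of_eq_zero {V : Submodule ℝ 𝔡} {L : Submodule ℝ (𝔡 × E × (E →L[ℝ] ℝ))}
    (hL : IsManinFibre K V L) {e : 𝔡 × E × (E →L[ℝ] ℝ)} (he : e ∈ L) (h0 : e.2.2 = 0) :
    e.1 ∈ V :=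
  hL.image _ e.2.1 (by rw [← h0]; exact he)

lemma exists_isProj {V : Type*} [AddCommGroup V] [Module ℝ V] (W : Submodule ℝ V) :
    ∃ t : V →ₗ[ℝ] V, LinearMap.IsProj W t := by
  obtain ⟨T, hT⟩ := exists_isCompl W
  exact ⟨W.projection T hT, Submodule.projection_apply_mem hT, fun x hx =>
    Submodule.projection_apply_of_mem_left hT hx⟩

namespace IsReductiveMoment

variable {𝔥 𝔠 : LieSubalgebra ℝ 𝔡} {L : ∀ m : M, Submodule ℝ (CFib 𝔡 E m)} {i : P → M}
  {q : P → Mr} (hr : IsReductiveMoment K EP Er 𝔥 𝔠 L i q)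
  {t : K.Reduced 𝔠 →ₗ[ℝ] K.Reduced 𝔠}

include hr

lemma contMDiff_i : ContMDiff 𝓘(ℝ, EP) 𝓘(ℝ, E) ∞ i := fun p =>
  (hr.immersion.isImmersionAt p).contMDiffAt

lemma contMDiff_q : ContMDiff 𝓘(ℝ, EP) 𝓘(ℝ, Er) ∞ q := fun p =>
  (hr.foliation.submersion.isSubmersionAt p).contMDiffAt

lemma mdifferentiableAt_i (p : P) : MDifferentiableAt 𝓘(ℝ, EP) 𝓘(ℝ, E) i p :=
  (hr.contMDiff_i p).mdifferentiableAt (by simp)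

lemma mdifferentiableAt_q (p : P) : MDifferentiableAt 𝓘(ℝ, EP) 𝓘(ℝ, Er) q p :=
  (hr.contMDiff_q p).mdifferentiableAt (by simp)

lemma exists_extension {k : Mr → ℝ} (hk : ContMDiff 𝓘(ℝ, Er) 𝓘(ℝ, ℝ) ∞ k) (p : P) :
    ∃ f : M → ℝ, ContMDiff 𝓘(ℝ, E) 𝓘(ℝ, ℝ) ∞ f ∧ ∀ᶠ x in 𝓝 p, f (i x) = k (q x) :=
  _root_.exists_extension (hr.immersion.isImmersionAt p) (hk.comp hr.contMDiff_q)

lemma dFun_eq {f : M → ℝ} {g : Mr → ℝ} {p : P} (hf : ContMDiff 𝓘(ℝ, E) 𝓘(ℝ, ℝ) ∞ f)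
    (hg : ContMDiff 𝓘(ℝ, Er) 𝓘(ℝ, ℝ) ∞ g) (h : ∀ᶠ x in 𝓝 p, f (i x) = g (q x)) (U : Tan EP p) :
    dFun f (i p) (dMap EP E i p U) = dFun g (q p) (dMap EP Er q p U) :=
  dFun_eq_of_eventuallyEq ((hf _).mdifferentiableAt (by simp)) (hr.mdifferentiableAt_i p)
    ((hg _).mdifferentiableAt (by simp)) (hr.mdifferentiableAt_q p) h U

lemma isManinFibre (p : P) : IsManinFibre (K.reduce 𝔠) (K.reduceSubalgebra 𝔠 𝔥).toSubmodule
    (reducedFibreAt K EP Er 𝔠 L i q p) :=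
  (hr.reductive p).isManinFibre (hr.manin _) hr.lagrangian hr.coisotropic

/-- Extend `g ∘ q` to `f` and take the section of `L` with data `(ξ, df)` relative to an adapted
projection; over `P` near `p` it is reducible by `exists_reduced`. -/
theorem exists_isLift (ht : LinearMap.IsProj (K.reduceSubalgebra 𝔠 𝔥).toSubmodule t)
    {ζ : K.Reduced 𝔠} (hζ : ζ ∈ (K.reduceSubalgebra 𝔠 𝔥).toSubmodule) {g : Mr → ℝ}
    (hg : ContMDiff 𝓘(ℝ, Er) 𝓘(ℝ, ℝ) ∞ g) (p : P) : ∃ σ f, IsLift K EP Er L i q t σ f ζ g p := by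
  obtain ⟨ξ, hξ, rfl⟩ := mem_reduceSubalgebra.1 hζ
  obtain ⟨t₀, ht₀, htt⟩ := exists_isProj_adapted ht
  obtain ⟨f, hf, hfg⟩ := hr.exists_extension hg p
  obtain ⟨σ, hσ, hσ'⟩ := exists_isSmoothAlong_proj hr.manin hr.subbundle hr.lagrangian ht₀ hξ hf
  refine ⟨σ, f, hσ, fun x => (hσ' x).1, hf, fun x => (hσ' x).2.2, hfg, ?_⟩
  filter_upwards [eventually_eventually_nhds.2 hfg] with x hx
  obtain ⟨h, U, h1, h2, h3⟩ := (hr.reductive x).exists_reduced (hr.manin _) hr.lagrangian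
    hr.coisotropic ht ht₀ htt hξ (hσ' (i x)).1 (hσ' (i x)).2.1 (γ := dFun (E := Er) g (q x)) (by
      refine ContinuousLinearMap.ext fun U => ?_
      exact (DFunLike.congr_fun (hσ' (i x)).2.2 _).trans (hr.dFun_eq hf hg hx U))
  exact ⟨h, U, h1, h2, h3⟩

omit hr in
/-- A linear extension to `𝔡` of the projection `𝔠 → 𝔡_𝔠`. -/
lemma exists_extend_toReduced (K : InvariantMetric 𝔡) (𝔠 : LieSubalgebra ℝ 𝔡) :
    ∃ r : 𝔡 →ₗ[ℝ] K.Reduced 𝔠, ∀ ξ : 𝔠, r ξ = K.toReduced 𝔠 ξ := by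
  obtain ⟨r, hr⟩ := LinearMap.exists_extend (p := 𝔠.toSubmodule) (K.toReduced 𝔠)
  exact ⟨r, fun ξ => LinearMap.congr_fun hr ξ⟩

omit hr in
lemma form_lie_eq_zero {w a b : 𝔡} (hw : w ∈ K.perp 𝔠.toSubmodule) (ha : a ∈ 𝔠) (hb : b ∈ 𝔠) :
    K.form ⁅w, a⁆ b = 0 := by
  have h1 := K.invariant a w b
  have h2 : K.form w ⁅a, b⁆ = 0 := (K.form_comm _ _).trans (hw _ (𝔠.lie_mem ha hb))
  rw [← lie_skew, map_neg, LinearMap.neg_apply, h1, h2, neg_neg]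

lemma hasDerivWithinAt_comp {v : ∀ p : P, Tan EP p} {c : ℝ → P}
    (hc : IsMIntegralCurveOn (I := 𝓘(ℝ, EP)) c v (Icc 0 1)) {s : ℝ} (hs : s ∈ Icc (0 : ℝ) 1)
    {u : M → ℝ} (hu : ContMDiff 𝓘(ℝ, E) 𝓘(ℝ, ℝ) ∞ u) :
    HasDerivWithinAt (fun r => u (i (c r))) (dFun u (i (c s)) (dMap EP E i (c s) (v (c s))))
      (Icc 0 1) s := by
  rw [← dFun_comp_apply ((hu _).mdifferentiableAt (by simp)) (hr.mdifferentiableAt_i (c s))]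
  exact hasDerivWithinAt_comp_integralCurve hc hs (f := fun x => u (i x))
    (((hu _).mdifferentiableAt (by simp)).comp (c s) (hr.mdifferentiableAt_i (c s)))

omit hr in
lemma contMDiff_form {σ : ∀ x : M, CFib 𝔡 E x} (hσ : IsSmoothAlong 𝓘(ℝ, E) (fun x : M => x) σ)
    (φ : 𝔡 →ₗ[ℝ] ℝ) : ContMDiff 𝓘(ℝ, E) 𝓘(ℝ, ℝ) ∞ fun x => φ (σ x).1 :=
  hσ.algebra φ

omit hr in
lemma contMDiff_dFun {σ : ∀ x : M, CFib 𝔡 E x} (hσ : IsSmoothAlong 𝓘(ℝ, E) (fun x : M => x) σ)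
    {f : M → ℝ} (hf : ContMDiff 𝓘(ℝ, E) 𝓘(ℝ, ℝ) ∞ f) :
    ContMDiff 𝓘(ℝ, E) 𝓘(ℝ, ℝ) ∞ fun x => dFun f x (σ x).2.1 := fun x =>
  contMDiffAt_dFun_field (hσ.tangent x) hf

/-- The flows of the vertical vector fields preserve the reduction infinitesimally. -/
lemma dFun_vertical {w : 𝔡} {v : ∀ p : P, Tan EP p} (hw : w ∈ 𝔥.toSubmodule ⊓ K.perp 𝔠.toSubmodule)
    (hv : ∀ p : P, (w, dMap EP E i p (v p), 0) ∈ L (i p)) {p : P}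
    {σ₂ σ₃ : ∀ x : M, CFib 𝔡 E x} {f₂ f₃ : M → ℝ} {ζ₂ ζ₃ : K.Reduced 𝔠} {g₂ g₃ : Mr → ℝ}
    (h₂ : IsLift K EP Er L i q t σ₂ f₂ ζ₂ g₂ p) (h₃ : IsLift K EP Er L i q t σ₃ f₃ ζ₃ g₃ p)
    (hg₂ : ContMDiff 𝓘(ℝ, Er) 𝓘(ℝ, ℝ) ∞ g₂) (hg₃ : ContMDiff 𝓘(ℝ, Er) 𝓘(ℝ, ℝ) ∞ g₃) :
    dFun (fun x => K.form (σ₃ (i p)).1 (σ₂ x).1) (i p) (dMap EP E i p (v p)) =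
      dFun (fun x => dFun f₃ x (σ₂ x).2.1) (i p) (dMap EP E i p (v p)) := by
  obtain ⟨t₀, ht₀⟩ := exists_isProj 𝔥.toSubmodule
  have hc0 : ∀ x : M, dFun (E := E) (fun _ => (0 : ℝ)) x = 0 := fun x => mfderiv_const
  -- `σ₁` is the generator of `w`: having zero one-form, its `𝔡`-component lies in `𝔥` and is
  -- therefore constantly `w`; over `P` its vector component is `v`. The result is the vanishing of
  -- `courantTri` for `σ₁, σ₂, σ₃`, in which two terms survive.
  obtain ⟨σ₁, hσ₁, hσ₁'⟩ := exists_isSmoothAlong_proj hr.manin hr.subbundle hr.lagrangian ht₀ hw.1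
    (f := fun _ => 0) contMDiff_const
  have hσ₁0 : ∀ x, (σ₁ x).2.2 = 0 := fun x => (hσ₁' x).2.2.trans (hc0 x)
  have hσ₁w : ∀ x, (σ₁ x).1 = w := by
    intro x
    have h1 : (σ₁ x).1 ∈ 𝔥.toSubmodule := (hr.manin x).mem_of_eq_zero (hσ₁' x).1 (hσ₁0 x)
    rw [← ht₀.map_id _ h1, (hσ₁' x).2.1]
  have hσ₁v : ∀ x : P, (σ₁ (i x)).2.1 = dMap EP E i x (v x) := by
    intro x
    have h1 := (hr.manin (i x)).eq_of_proj ht₀ (hσ₁' (i x)).1 (hv x)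
      (congrArg t₀ (hσ₁w (i x))) (hσ₁0 (i x))
    exact congrArg (fun z => z.2.1) h1
  have h := hr.courantTri_eq_zero σ₁ σ₂ hσ₁ h₂.smooth (fun x => (hσ₁' x).1) h₂.mem (i p) _
    (h₃.mem (i p))
  rw [courantTri_of_exact (isSmoothAlong_iff.1 hσ₁ _) (isSmoothAlong_iff.1 h₂.smooth _)
    contMDiff_const h₂.contMDiff h₃.contMDiff (fun x => (hσ₁' x).2.2) h₂.exact h₃.exact] at h
  obtain ⟨m₂, U₂, hU₂, -⟩ := h₂.reduces.self_of_nhds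
  obtain ⟨m₃, U₃, hU₃, -⟩ := h₃.reduces.self_of_nhds
  have k1 : K.form ⁅(σ₁ (i p)).1, (σ₂ (i p)).1⁆ (σ₃ (i p)).1 = 0 := by
    rw [hσ₁w]
    exact form_lie_eq_zero hw.2 m₂ m₃
  have k2 : ∀ (ξ : 𝔡) (X : Tan E (i p)), dFun (fun x => K.form ξ (σ₁ x).1) (i p) X = 0 := by
    intro ξ X
    simp only [hσ₁w]
    exact DFunLike.congr_fun mfderiv_const X
  -- Along `P` the derivative of `f` in the direction of `σ₁` is `dg (dq v) = 0`, so its derivatives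
  -- tangent to `P` vanish.
  have k3 : ∀ {σ : ∀ x : M, CFib 𝔡 E x} {f : M → ℝ} {ζ : K.Reduced 𝔠} {g : Mr → ℝ}
      (_ : IsLift K EP Er L i q t σ f ζ g p) (_ : ContMDiff 𝓘(ℝ, Er) 𝓘(ℝ, ℝ) ∞ g) (U : Tan EP p),
      dFun (fun x => dFun f x (σ₁ x).2.1) (i p) (dMap EP E i p U) = 0 := by
    intro σ f ζ g hl hg U
    rw [← dFun_comp_apply ((contMDiff_dFun hσ₁ hl.contMDiff _).mdifferentiableAt (by simp))
      (hr.mdifferentiableAt_i p)]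
    refine dFun_eq_zero_of_eventually ?_ _
    filter_upwards [eventually_eventually_nhds.2 hl.rel] with x hx
    rw [hσ₁v, hr.dFun_eq hl.contMDiff hg hx, (hr.foliation.vertical x _).2 ⟨v, ⟨w, hw, hv⟩, rfl⟩,
      map_zero]
  have k4 := k3 h₃ hg₃ U₂
  have k5 := k3 h₂ hg₂ U₃
  rw [hU₂] at k4
  rw [hU₃] at k5
  rw [k1, k2, k2, k4, k5, hσ₁v] at h
  linarith

/-- All reduced fibres along the curve sit in one vector space. For `e` in the first, let `F r` be
the element of the fibre at `c r` with the same two projections. The derivative of `F` lies in the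
fibre and projects to zero, so `F` is constant. -/
theorem reducedFibreAt_le {v : ∀ p : P, Tan EP p}
    (hv : v ∈ tangentFields L (𝔥.toSubmodule ⊓ K.perp 𝔠.toSubmodule) EP i) {c : ℝ → P}
    (hc : IsMIntegralCurveOn (I := 𝓘(ℝ, EP)) c v (Icc 0 1)) :
    reducedFibreAt K EP Er 𝔠 L i q (c 0) ≤ reducedFibreAt K EP Er 𝔠 L i q (c 1) := by
  have hqc : ∀ r ∈ Icc (0 : ℝ) 1, q (c r) = q (c 0) := by
    intro r hr'
    refine ((hr.foliation.fibres _ _).2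
      (Relation.EqvGen.rel _ _ (flowStep_of_mem_Icc ?_ hv hc hr'))).symm
    rintro a v ⟨w, hw, hwv⟩
    refine ⟨a • w, Submodule.smul_mem _ a hw, fun p => ?_⟩
    have h1 := (L (i p)).smul_mem a (hwv p)
    rw [Pi.smul_apply, map_smul]
    simpa using h1
  obtain ⟨w, hw, hwv⟩ := hv
  obtain ⟨t, ht⟩ := exists_isProj (K.reduceSubalgebra 𝔠 𝔥).toSubmodule
  intro e he
  have hF : ∀ r, ∃ y ∈ reducedFibreAt K EP Er 𝔠 L i q (c r), t y.1 = t e.1 ∧ y.2.2 = e.2.2 :=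
    fun r => (hr.isManinFibre (c r)).exists_mem_proj
      (isLagrangian_reduceSubalgebra hr.lagrangian hr.coisotropic) ht (ht.map_mem _) _
  choose F hFL hFt hFe using hF
  have hF0 : F 0 = e := (hr.isManinFibre (c 0)).eq_of_proj ht (hFL 0) he (hFt 0) (hFe 0)
  suffices h : F 0 = F 1 by
    rw [← hF0, h]
    exact hFL 1
  obtain ⟨g, hg, hge⟩ := exists_dFun_eq (E := Er) (q (c 0)) e.2.2
  have hge' : ∀ x, x = q (c 0) → dFun (E := Er) g x = e.2.2 := by
    rintro _ rfl
    exact hge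
  refine eq_of_hasDerivWithinAt_zero fun s hs => ?_
  -- Near `s`, uniqueness makes `F` the reduction of one smooth section `σ` of `L`; this yields
  -- differentiability, although the vectors `U` themselves are only chosen pointwise.
  obtain ⟨σ, f, hσ⟩ := hr.exists_isLift ht (ht.map_mem e.1) hg (c s)
  have hcs : ContinuousWithinAt c (Icc 0 1) s := (hc s hs).1
  have hFσ : ∀ᶠ r in 𝓝[Icc 0 1] s, ∃ (h : (σ (i (c r))).1 ∈ 𝔠) (U : Tan EP (c r)),
      dMap EP E i (c r) U = (σ (i (c r))).2.1 ∧ F r = (K.toReduced 𝔠 ⟨_, h⟩, dMap EP Er q (c r) U,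
        e.2.2) := by
    filter_upwards [hcs.eventually hσ.reduces, self_mem_nhdsWithin] with r ⟨h, U, h1, h2, h3⟩ hrI
    refine ⟨h, U, h1, (hr.isManinFibre (c r)).eq_of_proj ht (hFL r) ?_ ((hFt r).trans h2.symm)
      (hFe r)⟩
    have h4 := hge' _ (hqc r hrI)
    rw [h4] at h3
    exact h3
  have hd1 : DifferentiableWithinAt ℝ (fun r => (F r).1) (Icc 0 1) s := by
    obtain ⟨l, hl⟩ := exists_extend_toReduced K 𝔠
    refine differentiableWithinAt_of_forall_dual fun φ => ?_
    refine (hr.hasDerivWithinAt_comp hc hs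
      (hσ.smooth.algebra (φ ∘ₗ l))).differentiableWithinAt.congr_of_eventuallyEq_of_mem ?_ hs
    filter_upwards [hFσ] with r ⟨h, U, h1, h2⟩
    rw [h2]
    exact congrArg φ (hl ⟨_, h⟩).symm
  have hk : ∀ {k : Mr → ℝ} {u : M → ℝ}, ContMDiff 𝓘(ℝ, Er) 𝓘(ℝ, ℝ) ∞ k →
      ContMDiff 𝓘(ℝ, E) 𝓘(ℝ, ℝ) ∞ u → (∀ᶠ x in 𝓝 (c s), u (i x) = k (q x)) →
      ∀ φ : Er →L[ℝ] ℝ, (dFun k (q (c 0)) = φ) →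
      ∀ᶠ r in 𝓝[Icc 0 1] s, φ (F r).2.1 = dFun u (i (c r)) (σ (i (c r))).2.1 := by
    intro k u hk hu huk φ hφ
    filter_upwards [hFσ, hcs.eventually (eventually_eventually_nhds.2 huk), self_mem_nhdsWithin]
      with r ⟨h, U, h1, h2⟩ hur hrI
    have h3 : ∀ x, x = q (c 0) → dFun (E := Er) k x = φ := by
      rintro _ rfl
      exact hφ
    rw [h2, ← h1, hr.dFun_eq hu hk hur, h3 _ (hqc r hrI)]
    rfl
  have hd2 : DifferentiableWithinAt ℝ (fun r => (F r).2.1) (Icc 0 1) s := by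
    refine differentiableWithinAt_of_forall_dual fun φ => ?_
    obtain ⟨k, hk1, hk2⟩ := exists_dFun_eq (E := Er) (q (c 0)) φ.toContinuousLinearMap
    obtain ⟨u, hu, huk⟩ := hr.exists_extension hk1 (c s)
    exact (hr.hasDerivWithinAt_comp hc hs
      (contMDiff_dFun hσ.smooth hu)).differentiableWithinAt.congr_of_eventuallyEq_of_mem
      (hk hk1 hu huk _ hk2) hs
  have hd : DifferentiableWithinAt ℝ F (Icc 0 1) s := by
    have h3 : DifferentiableWithinAt ℝ (fun r => (F r).2.2) (Icc 0 1) s := by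
      simp only [hFe]
      exact differentiableWithinAt_const _
    exact hd1.prodMk (hd2.prodMk h3)
  obtain ⟨D, hD⟩ : ∃ D, HasDerivWithinAt F D (Icc 0 1) s := ⟨_, hd.hasDerivWithinAt⟩
  have hu : UniqueDiffWithinAt ℝ (Icc (0 : ℝ) 1) s := uniqueDiffOn_Icc zero_lt_one s hs
  have hDt : t D.1 = 0 := by
    have h1 := ((t.toContinuousLinearMap.comp (ContinuousLinearMap.fst ℝ (K.Reduced 𝔠)
      (Er × (Er →L[ℝ] ℝ)))).hasFDerivAt.comp_hasDerivWithinAt s hD)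
    have h2 : HasDerivWithinAt (fun r => t (F r).1) 0 (Icc 0 1) s := by
      simp only [hFt]
      exact hasDerivWithinAt_const _ _ _
    exact hu.eq_deriv _ h1 h2
  have hDe : D.2.2 = 0 := by
    have h1 := (((ContinuousLinearMap.snd ℝ Er (Er →L[ℝ] ℝ)).comp (ContinuousLinearMap.snd ℝ
      (K.Reduced 𝔠) (Er × (Er →L[ℝ] ℝ)))).hasFDerivAt.comp_hasDerivWithinAt s hD)
    have h2 : HasDerivWithinAt (fun r => (F r).2.2) 0 (Icc 0 1) s := by
      simp only [hFe]
      exact hasDerivWithinAt_const _ _ _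
    exact hu.eq_deriv _ h1 h2
  -- The fibre is Lagrangian, so orthogonality to each `e₃` in it is enough. With `e₃` frozen and
  -- lifted to `σ₃`, the derivative of `⟨F r, e₃⟩` is the difference of the two sides of
  -- `dFun_vertical`.
  have hDL : D ∈ reducedFibreAt K EP Er 𝔠 L i q (c s) := by
    refine ((hr.isManinFibre (c s)).lagrangian D).2 fun e₃ he₃ => ?_
    have h1 := ((flatPair (K.reduce 𝔠)).flip e₃).hasFDerivAt.comp_hasDerivWithinAt s hD
    refine hu.eq_deriv _ h1 ?_
    obtain ⟨g₃, hg₃, hge₃⟩ := exists_dFun_eq (E := Er) (q (c 0)) e₃.2.2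
    obtain ⟨σ₃, f₃, hσ₃⟩ := hr.exists_isLift ht (ht.map_mem e₃.1) hg₃ (c s)
    have he₃σ : ∃ h : (σ₃ (i (c s))).1 ∈ 𝔠, e₃.1 = K.toReduced 𝔠 ⟨_, h⟩ := by
      obtain ⟨h, U, h1, h2, h3⟩ := hσ₃.reduces.self_of_nhds
      have h4 : ∀ x, x = q (c 0) → dFun (E := Er) g₃ x = e₃.2.2 := by
        rintro _ rfl
        exact hge₃
      refine ⟨h, ?_⟩
      rw [h4 _ (hqc s hs)] at h3
      exact congrArg Prod.fst ((hr.isManinFibre (c s)).eq_of_proj ht he₃ h3 h2.symm rfl)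
    obtain ⟨h₃, he₃'⟩ := he₃σ
    have hev : ∀ᶠ r in 𝓝[Icc 0 1] s, flatPair (K.reduce 𝔠) (F r) e₃ =
        K.form (σ₃ (i (c s))).1 (σ (i (c r))).1 -
          (e.2.2 e₃.2.1 + dFun f₃ (i (c r)) (σ (i (c r))).2.1) := by
      filter_upwards [hFσ, hk hg₃ hσ₃.contMDiff hσ₃.rel _ hge₃] with r ⟨h, U, h1, h2⟩ h3
      rw [flatPair_apply, h3, hFe, he₃', h2, K.form_comm]
      rfl
    have hder := (hr.hasDerivWithinAt_comp hc hs (contMDiff_form hσ.smooth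
      (K.form (σ₃ (i (c s))).1))).sub ((hr.hasDerivWithinAt_comp hc hs
      (contMDiff_dFun hσ.smooth hσ₃.contMDiff)).const_add (e.2.2 e₃.2.1))
    rw [hr.dFun_vertical hw hwv hσ hσ₃ hg hg₃, sub_self] at hder
    exact hder.congr_of_eventuallyEq_of_mem hev hs
  have hD0 : D = 0 := (hr.isManinFibre (c s)).eq_of_proj ht hDL (zero_mem _)
    (hDt.trans (map_zero t).symm) hDe
  rwa [hD0] at hD

/-- Along a flow step one inclusion suffices: both fibres are Lagrangian, and orthogonal complements
reverse inclusions. -/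
theorem reducedFibreAt_eq {p p' : P} (h : q p = q p') :
    reducedFibreAt K EP Er 𝔠 L i q p = reducedFibreAt K EP Er 𝔠 L i q p' := by
  induction (hr.foliation.fibres p p').1 h with
  | rel x y hxy =>
    obtain ⟨v, hv, c, hc, rfl, rfl⟩ := hxy
    have hle := hr.reducedFibreAt_le hv hc
    refine le_antisymm hle fun e he => ((hr.isManinFibre _).lagrangian e).2 fun e' he' => ?_
    exact ((hr.isManinFibre _).lagrangian e).1 he e' (hle he')
  | refl x => rfl
  | symm x y hxy ih => exact (ih ((hr.foliation.fibres _ _).2 hxy)).symm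
  | trans x y z hxy hyz ih1 ih2 =>
    exact (ih1 ((hr.foliation.fibres _ _).2 hxy)).trans (ih2 ((hr.foliation.fibres _ _).2 hyz))

end IsReductiveMoment

end Moment

/-! ### Descent of sections and of integrability to the quotient. -/

section Descent

variable {𝔡 : Type*} [LieRing 𝔡] [LieAlgebra ℝ 𝔡] [Module.Finite ℝ 𝔡] {K : InvariantMetric 𝔡}
  {E : Type*} [NormedAddCommGroup E] [NormedSpace ℝ E] [FiniteDimensional ℝ E]
  {M : Type*} [TopologicalSpace M] [T2Space M] [ChartedSpace E M] [IsManifold 𝓘(ℝ, E) ∞ M]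
  {EP : Type*} [NormedAddCommGroup EP] [NormedSpace ℝ EP] [FiniteDimensional ℝ EP]
  {P : Type*} [TopologicalSpace P] [ChartedSpace EP P] [IsManifold 𝓘(ℝ, EP) ∞ P]
  {Er : Type*} [NormedAddCommGroup Er] [NormedSpace ℝ Er] [FiniteDimensional ℝ Er]
  {Mr : Type*} [TopologicalSpace Mr] [T2Space Mr] [ChartedSpace Er Mr] [IsManifold 𝓘(ℝ, Er) ∞ Mr]

/-- The sections `σ` and `σ'` with one-form components `df` and `dg` correspond to each other along
`M ← P → Mr`, near `p`. -/
structure IsDescent (K : InvariantMetric 𝔡) (EP : Type*)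
    [NormedAddCommGroup EP] [NormedSpace ℝ EP]
    {P : Type*} [TopologicalSpace P] [ChartedSpace EP P] {𝔠 : LieSubalgebra ℝ 𝔡}
    (L : ∀ m : M, Submodule ℝ (CFib 𝔡 E m)) (i : P → M) (q : P → Mr)
    (σ : ∀ x : M, CFib 𝔡 E x) (f : M → ℝ)
    (σ' : ∀ x : Mr, CFib (K.Reduced 𝔠) Er x) (g : Mr → ℝ) (p : P) : Prop where
  smooth : IsSmoothAlong 𝓘(ℝ, E) (fun x : M => x) σ
  mem : ∀ x, σ x ∈ L x
  contMDiff : ContMDiff 𝓘(ℝ, E) 𝓘(ℝ, ℝ) ∞ f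
  contMDiff' : ContMDiff 𝓘(ℝ, Er) 𝓘(ℝ, ℝ) ∞ g
  exact : ∀ x, (σ x).2.2 = dFun f x
  exact' : ∀ x, (σ' x).2.2 = dFun g x
  rel : ∀ᶠ x in 𝓝 p, f (i x) = g (q x)
  descends : ∀ᶠ x in 𝓝 p, (∃ h : (σ (i x)).1 ∈ 𝔠, K.toReduced 𝔠 ⟨_, h⟩ = (σ' (q x)).1) ∧
    ∃ U : Tan EP x, dMap EP E i x U = (σ (i x)).2.1 ∧ dMap EP Er q x U = (σ' (q x)).2.1

namespace IsReductiveMoment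

variable {𝔥 𝔠 : LieSubalgebra ℝ 𝔡} {L : ∀ m : M, Submodule ℝ (CFib 𝔡 E m)} {i : P → M}
  {q : P → Mr} (hr : IsReductiveMoment K EP Er 𝔥 𝔠 L i q)
  {t : K.Reduced 𝔠 →ₗ[ℝ] K.Reduced 𝔠}

/-- The reduction of the family `L`. -/
def reduction : ∀ x : Mr, Submodule ℝ (CFib (K.Reduced 𝔠) Er x) := fun x =>
  (reducedFibreAt K EP Er 𝔠 L i q (Function.surjInv hr.foliation.surjective x) :
    Submodule ℝ (K.Reduced 𝔠 × Er × (Er →L[ℝ] ℝ)))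

lemma reduction_apply (p : P) : hr.reduction (q p) = reducedFibreAt K EP Er 𝔠 L i q p :=
  hr.reducedFibreAt_eq (Function.surjInv_eq hr.foliation.surjective (q p))

lemma isManinFibre_reduction (x : Mr) : IsManinFibre (E := Er) (K.reduce 𝔠)
    (K.reduceSubalgebra 𝔠 𝔥).toSubmodule (hr.reduction x) :=
  hr.isManinFibre _

include hr

/-- Corresponding functions have corresponding derivatives along corresponding sections. Since this
holds in a neighbourhood of `p`, it can be iterated. -/
lemma eventually_dFun_eq {σ : ∀ x : M, CFib 𝔡 E x} {f : M → ℝ}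
    {σ' : ∀ x : Mr, CFib (K.Reduced 𝔠) Er x} {g : Mr → ℝ} {p : P}
    (h : IsDescent K EP L i q σ f σ' g p) {u : M → ℝ} {k : Mr → ℝ}
    (hu : ContMDiff 𝓘(ℝ, E) 𝓘(ℝ, ℝ) ∞ u) (hk : ContMDiff 𝓘(ℝ, Er) 𝓘(ℝ, ℝ) ∞ k)
    (huk : ∀ᶠ x in 𝓝 p, u (i x) = k (q x)) :
    ∀ᶠ x in 𝓝 p, dFun u (i x) (σ (i x)).2.1 = dFun k (q x) (σ' (q x)).2.1 := by
  filter_upwards [h.descends, eventually_eventually_nhds.2 huk] with x ⟨_, U, h1, h2⟩ hx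
  rw [← h1, ← h2]
  exact hr.dFun_eq hu hk hx U

omit hr in
lemma eventually_form_eq {σ : ∀ x : M, CFib 𝔡 E x} {f : M → ℝ}
    {σ' : ∀ x : Mr, CFib (K.Reduced 𝔠) Er x} {g : Mr → ℝ} {p : P}
    (h : IsDescent K EP L i q σ f σ' g p) (ξ : 𝔠) :
    ∀ᶠ x in 𝓝 p, K.form ξ (σ (i x)).1 = (K.reduce 𝔠).form (K.toReduced 𝔠 ξ) (σ' (q x)).1 := by
  filter_upwards [h.descends] with x ⟨⟨h1, h2⟩, _⟩
  rw [← h2]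
  rfl

/-- The pointwise unique section with data `(ζ, dg)` agrees near each point with the reduction of a
lift `σ`. Its smoothness follows by composing functions attached to `σ` with `i` and a local section
of `q`. -/
theorem exists_isSmoothAlong (ht : LinearMap.IsProj (K.reduceSubalgebra 𝔠 𝔥).toSubmodule t)
    {ζ : K.Reduced 𝔠} (hζ : ζ ∈ (K.reduceSubalgebra 𝔠 𝔥).toSubmodule) {g : Mr → ℝ}
    (hg : ContMDiff 𝓘(ℝ, Er) 𝓘(ℝ, ℝ) ∞ g) :
    ∃ σ' : ∀ x : Mr, CFib (K.Reduced 𝔠) Er x, IsSmoothAlong 𝓘(ℝ, Er) (fun x : Mr => x) σ' ∧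
      (∀ x, σ' x ∈ hr.reduction x ∧ t (σ' x).1 = ζ ∧ (σ' x).2.2 = dFun g x) ∧
      ∀ p, ∃ σ f, IsDescent K EP L i q σ f σ' g p := by
  have hex : ∀ x : Mr, ∃ e ∈ hr.reduction x, t e.1 = ζ ∧ e.2.2 = dFun (E := Er) g x := fun x =>
    (hr.isManinFibre_reduction x).exists_mem_proj
      (isLagrangian_reduceSubalgebra hr.lagrangian hr.coisotropic) ht hζ (dFun (E := Er) g x)
  choose σ' hσ' hσt hσg using hex
  have hdesc : ∀ p, ∃ σ f, IsDescent K EP L i q σ f σ' g p := by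
    intro p
    obtain ⟨σ, f, hσ⟩ := hr.exists_isLift ht hζ hg p
    refine ⟨σ, f, hσ.smooth, hσ.mem, hσ.contMDiff, hg, hσ.exact, hσg, hσ.rel, ?_⟩
    filter_upwards [hσ.reduces] with x ⟨h, U, h1, h2, h3⟩
    rw [← hr.reduction_apply x] at h3
    have h4 := (hr.isManinFibre_reduction (q x)).eq_of_proj ht h3 (hσ' (q x))
      (h2.trans (hσt (q x)).symm) (hσg (q x)).symm
    exact ⟨⟨h, congrArg Prod.fst h4⟩, U, h1, congrArg (fun z => z.2.1) h4⟩
  refine ⟨σ', ?_, fun x => ⟨hσ' x, hσt x, hσg x⟩, hdesc⟩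
  refine isSmoothAlong_iff.2 fun x => ?_
  obtain ⟨p, rfl⟩ := hr.foliation.surjective x
  obtain ⟨σ, f, hσ⟩ := hdesc p
  obtain ⟨O, j, hO, hpO, hj, hjp, hqj⟩ :=
    exists_local_section (hr.foliation.submersion.isSubmersionAt p)
  have hj' : ContMDiffAt 𝓘(ℝ, Er) 𝓘(ℝ, EP) ∞ j (q p) := hj.contMDiffAt (hO.mem_nhds hpO)
  have hjt : Tendsto j (𝓝 (q p)) (𝓝 p) := by
    simpa only [ContinuousAt, hjp] using hj'.continuousAt
  have hu : ∀ {u : M → ℝ}, ContMDiff 𝓘(ℝ, E) 𝓘(ℝ, ℝ) ∞ u → ∀ {k : Mr → ℝ},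
      (∀ᶠ y in 𝓝 p, u (i y) = k (q y)) → ContMDiffAt 𝓘(ℝ, Er) 𝓘(ℝ, ℝ) ∞ k (q p) := by
    intro u hu k huk
    refine ((hu.comp hr.contMDiff_i).contMDiffAt.comp (q p) hj').congr_of_eventuallyEq ?_
    filter_upwards [hjt.eventually huk, hO.mem_nhds hpO] with y hy hyO
    rw [Function.comp_apply, Function.comp_apply, hy, hqj y hyO]
  have h1 : ∀ φ : K.Reduced 𝔠 →ₗ[ℝ] ℝ,
      ContMDiffAt 𝓘(ℝ, Er) 𝓘(ℝ, ℝ) ∞ (fun y => φ (σ' y).1) (q p) := by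
    intro φ
    obtain ⟨l, hl⟩ := exists_extend_toReduced K 𝔠
    refine hu (hσ.smooth.algebra (φ ∘ₗ l)) ?_
    filter_upwards [hσ.descends] with y ⟨⟨h, h2⟩, _⟩
    rw [← h2]
    exact congrArg φ (hl ⟨_, h⟩)
  have h2 : ContMDiffAt 𝓘(ℝ, Er) 𝓘(ℝ, Er).tangent ∞
      (fun x => (⟨x, (σ' x).2.1⟩ : TangentBundle 𝓘(ℝ, Er) Mr)) (q p) := by
    refine contMDiffAt_tangent_of_forall fun k hk => ?_
    obtain ⟨u, hu', huk⟩ := hr.exists_extension hk p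
    exact hu (contMDiff_dFun hσ.smooth hu') (hr.eventually_dFun_eq hσ hu' hk huk)
  refine ⟨contMDiffAt_id, (contMDiffAt_of_forall_dual h1).prodMk_space
    ((contMDiffAt_tangent_iff.1 h2).2.prodMk_space ?_)⟩
  refine (contMDiffAt_dFun_comp_tangentOfCoord hg).congr_of_eventuallyEq
    (Eventually.of_forall fun y => ?_)
  exact congrArg (fun a : Er →L[ℝ] ℝ => a.comp (tangentOfCoord (q p) y)) (hσg y)

/-- By `courantTri_of_exact`, both trilinear forms are the same expression, and each of its terms
corresponds along `M ← P → Mr`. -/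
lemma courantTri_eq_zero_of_isDescent {p : P}
    {σ₁ σ₂ σ₃ : ∀ x : M, CFib 𝔡 E x} {f₁ f₂ f₃ : M → ℝ}
    {τ₁ τ₂ τ₃ : ∀ x : Mr, CFib (K.Reduced 𝔠) Er x} {g₁ g₂ g₃ : Mr → ℝ}
    (s₁ : IsSmoothAlong 𝓘(ℝ, Er) (fun x : Mr => x) τ₁)
    (s₂ : IsSmoothAlong 𝓘(ℝ, Er) (fun x : Mr => x) τ₂)
    (h₁ : IsDescent K EP L i q σ₁ f₁ τ₁ g₁ p) (h₂ : IsDescent K EP L i q σ₂ f₂ τ₂ g₂ p)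
    (h₃ : IsDescent K EP L i q σ₃ f₃ τ₃ g₃ p) :
    courantTri (K.reduce 𝔠) (q p) τ₁ τ₂ (τ₃ (q p)) = 0 := by
  rw [← hr.courantTri_eq_zero σ₁ σ₂ h₁.smooth h₂.smooth h₁.mem h₂.mem (i p) _ (h₃.mem (i p)),
    courantTri_of_exact (isSmoothAlong_iff.1 h₁.smooth _) (isSmoothAlong_iff.1 h₂.smooth _)
      h₁.contMDiff h₂.contMDiff h₃.contMDiff h₁.exact h₂.exact h₃.exact,
    courantTri_of_exact (isSmoothAlong_iff.1 s₁ _) (isSmoothAlong_iff.1 s₂ _)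
      h₁.contMDiff' h₂.contMDiff' h₃.contMDiff' h₁.exact' h₂.exact' h₃.exact']
  obtain ⟨⟨m₁, n₁⟩, -⟩ := h₁.descends.self_of_nhds
  obtain ⟨⟨m₂, n₂⟩, -⟩ := h₂.descends.self_of_nhds
  obtain ⟨⟨m₃, n₃⟩, -⟩ := h₃.descends.self_of_nhds
  have k1 : (K.reduce 𝔠).form ⁅(τ₁ (q p)).1, (τ₂ (q p)).1⁆ (τ₃ (q p)).1 =
      K.form ⁅(σ₁ (i p)).1, (σ₂ (i p)).1⁆ (σ₃ (i p)).1 := by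
    rw [← n₁, ← n₂, ← n₃]
    rfl
  -- The frozen argument of the metric lies in `𝔠`, so pairing with it depends only on classes
  -- modulo `𝔠ᗮ`.
  have k2 : ∀ {σ σ₀ : ∀ x : M, CFib 𝔡 E x} {f f₀ : M → ℝ}
      {τ τ₀ : ∀ x : Mr, CFib (K.Reduced 𝔠) Er x} {g g₀ : Mr → ℝ}
      (_ : IsDescent K EP L i q σ f τ g p) (_ : IsDescent K EP L i q σ₀ f₀ τ₀ g₀ p)
      (_ : IsSmoothAlong 𝓘(ℝ, Er) (fun x : Mr => x) τ) {ξ : 𝔡} (hξ : ξ ∈ 𝔠) {η : K.Reduced 𝔠}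
      (_ : K.toReduced 𝔠 ⟨ξ, hξ⟩ = η),
      dFun (fun x => (K.reduce 𝔠).form η (τ x).1) (q p) (τ₀ (q p)).2.1 =
      dFun (fun x => K.form ξ (σ x).1) (i p) (σ₀ (i p)).2.1 := by
    rintro σ σ₀ f f₀ τ τ₀ g g₀ h h₀ s ξ hξ _ rfl
    exact (hr.eventually_dFun_eq h₀ (h.smooth.algebra (K.form ξ))
      (s.algebra ((K.reduce 𝔠).form (K.toReduced 𝔠 ⟨ξ, hξ⟩)))
      (eventually_form_eq h ⟨ξ, hξ⟩)).self_of_nhds.symm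
  have k3 : ∀ {σ σ₀ : ∀ x : M, CFib 𝔡 E x} {f f₀ f' : M → ℝ}
      {τ τ₀ : ∀ x : Mr, CFib (K.Reduced 𝔠) Er x} {g g₀ g' : Mr → ℝ}
      (_ : IsDescent K EP L i q σ f τ g p) (_ : IsDescent K EP L i q σ₀ f₀ τ₀ g₀ p)
      (_ : IsSmoothAlong 𝓘(ℝ, Er) (fun x : Mr => x) τ) (_ : ContMDiff 𝓘(ℝ, E) 𝓘(ℝ, ℝ) ∞ f')
      (_ : ContMDiff 𝓘(ℝ, Er) 𝓘(ℝ, ℝ) ∞ g') (_ : ∀ᶠ x in 𝓝 p, f' (i x) = g' (q x)),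
      dFun (fun x => dFun g' x (τ x).2.1) (q p) (τ₀ (q p)).2.1 =
      dFun (fun x => dFun f' x (σ x).2.1) (i p) (σ₀ (i p)).2.1 := by
    intro σ σ₀ f f₀ f' τ τ₀ g g₀ g' h h₀ s hf' hg' hfg
    exact (hr.eventually_dFun_eq h₀ (contMDiff_dFun h.smooth hf') (contMDiff_dFun s hg')
      (hr.eventually_dFun_eq h hf' hg' hfg)).self_of_nhds.symm
  rw [k1, k2 h₂ h₁ s₂ m₃ n₃, k2 h₁ h₂ s₁ m₃ n₃, k2 h₁ h₃ s₁ m₂ n₂,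
    k3 h₂ h₁ s₂ h₃.contMDiff h₃.contMDiff' h₃.rel, k3 h₁ h₂ s₁ h₃.contMDiff h₃.contMDiff' h₃.rel,
    k3 h₁ h₃ s₁ h₂.contMDiff h₂.contMDiff' h₂.rel]

theorem exists_isDescent (x : Mr) {e : CFib (K.Reduced 𝔠) Er x} (he : e ∈ hr.reduction x) :
    ∃ (τ : ∀ x : Mr, CFib (K.Reduced 𝔠) Er x) (g : Mr → ℝ),
      IsSmoothAlong 𝓘(ℝ, Er) (fun x : Mr => x) τ ∧ (∀ x, τ x ∈ hr.reduction x) ∧ τ x = e ∧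
      ∀ p, ∃ σ f, IsDescent K EP L i q σ f τ g p := by
  obtain ⟨t, ht⟩ := exists_isProj (K.reduceSubalgebra 𝔠 𝔥).toSubmodule
  obtain ⟨g, hg, hge⟩ := exists_dFun_eq (E := Er) x e.2.2
  obtain ⟨τ, s, h1, h2⟩ := hr.exists_isSmoothAlong ht (ht.map_mem e.1) hg
  refine ⟨τ, g, s, fun x => (h1 x).1, ?_, h2⟩
  exact (hr.isManinFibre_reduction x).eq_of_proj ht (h1 x).1 he (h1 x).2.1
    ((h1 x).2.2.trans hge)

theorem isDiracAlongGraph {ENr : Type*} [NormedAddCommGroup ENr] [NormedSpace ℝ ENr]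
    {Nr : Type*} [TopologicalSpace Nr] [ChartedSpace ENr Nr] [IsManifold 𝓘(ℝ, ENr) ∞ Nr]
    (A : CourantAction (K.reduce 𝔠) ENr Nr) {μ : Mr → Nr}
    (hμ : ContMDiff 𝓘(ℝ, Er) 𝓘(ℝ, ENr) ∞ μ)
    (hA : ∀ (x : Mr), ∀ e ∈ hr.reduction x, dMap Er ENr μ x e.2.1 = A.anchor (μ x) e.1) :
    IsDiracAlongGraph A μ hr.reduction := by
  refine isDiracAlongGraph_of_courantTri hμ (fun x => (hr.isManinFibre_reduction x).lagrangian) ?_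
    hA ?_
  · intro x e he
    obtain ⟨τ, g, h1, h2, h3, -⟩ := hr.exists_isDescent x he
    exact ⟨τ, h1, h2, h3⟩
  · intro x e₁ he₁ e₂ he₂ e₃ he₃
    obtain ⟨τ₁, g₁, s₁, m₁, v₁, d₁⟩ := hr.exists_isDescent x he₁
    obtain ⟨τ₂, g₂, s₂, m₂, v₂, d₂⟩ := hr.exists_isDescent x he₂
    obtain ⟨τ₃, g₃, s₃, m₃, v₃, d₃⟩ := hr.exists_isDescent x he₃
    refine ⟨τ₁, τ₂, s₁, s₂, m₁, m₂, v₁, v₂, ?_⟩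
    obtain ⟨p, rfl⟩ := hr.foliation.surjective x
    obtain ⟨σ₁, f₁, h₁⟩ := d₁ p
    obtain ⟨σ₂, f₂, h₂⟩ := d₂ p
    obtain ⟨σ₃, f₃, h₃⟩ := d₃ p
    rw [← v₃]
    exact hr.courantTri_eq_zero_of_isDescent s₁ s₂ h₁ h₂ h₃

end IsReductiveMoment

end Descent

/-! ### Poisson structures as the case `𝔡 = 0`. -/

section Poisson

variable {𝔡 : Type*} [LieRing 𝔡] [LieAlgebra ℝ 𝔡] [Module.Finite ℝ 𝔡] {K : InvariantMetric 𝔡}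
  {EN : Type*} [NormedAddCommGroup EN] [NormedSpace ℝ EN]
  {N : Type*} [TopologicalSpace N] [ChartedSpace EN N] [IsManifold 𝓘(ℝ, EN) ∞ N]
  {E : Type*} [NormedAddCommGroup E] [NormedSpace ℝ E] [FiniteDimensional ℝ E]
  {M : Type*} [TopologicalSpace M] [ChartedSpace E M] [IsManifold 𝓘(ℝ, E) ∞ M]

/-- Without `𝔡`, the projection of `L` to `E*` is bijective: onto by `exists_mem_cotan`, injective
by the kernel condition. -/
lemma IsManinFibre.exists_graph [Subsingleton 𝔡] {V : Submodule ℝ 𝔡}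
    {L : Submodule ℝ (𝔡 × E × (E →L[ℝ] ℝ))} (hL : IsManinFibre K V L) :
    ∃ π : (E →L[ℝ] ℝ) →ₗ[ℝ] E, ∀ η Z γ, (η, Z, γ) ∈ L ↔ Z = π γ := by
  have h1 : ∀ γ, ∃ Z, ((0 : 𝔡), Z, γ) ∈ L := by
    intro γ
    obtain ⟨ξ, X, h⟩ := hL.exists_mem_cotan γ
    exact ⟨X, Subsingleton.elim ξ 0 ▸ h⟩
  choose π hπ using h1
  have h2 : ∀ {Z γ}, ((0 : 𝔡), Z, γ) ∈ L → Z = π γ := by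
    intro Z γ h
    have h3 := sub_mem h (hπ γ)
    simp only [Prod.mk_sub_mk, sub_self] at h3
    exact sub_eq_zero.1 (hL.ker _ h3)
  refine ⟨⟨⟨π, fun α β => (h2 ?_).symm⟩, fun c α => (h2 ?_).symm⟩, fun η Z γ => ?_⟩
  · simpa using add_mem (hπ α) (hπ β)
  · simpa using L.smul_mem c (hπ α)
  · rw [Subsingleton.elim η 0]
    refine ⟨h2, ?_⟩
    rintro rfl
    exact hπ γ

lemma dFun_neg {u : M → ℝ} (x : M) (v : Tan E x) :
    dFun (E := E) (fun x => - u x) x v = - dFun u x v :=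
  DFunLike.congr_fun mfderiv_neg v

/-- For `𝔡 = 0` the Dirac structures of morphisms of Manin pairs are graphs of Poisson
structures. -/
theorem exists_isPoisson [Subsingleton 𝔡] {V : Submodule ℝ 𝔡} {A : CourantAction K EN N}
    {μ : M → N} {L : ∀ m : M, Submodule ℝ (CFib 𝔡 E m)} (hL : IsDiracAlongGraph A μ L)
    (hm : ∀ x, IsManinFibre (E := E) K V (L x)) (hV : K.IsLagrangian V) :
    ∃ π : ∀ x : M, Cotan E x →ₗ[ℝ] Tan E x, IsPoisson π ∧
      ∀ x η Z γ, (η, Z, γ) ∈ L x ↔ Z = π x γ := by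
  have hex : ∀ x : M, ∃ π : Cotan E x →ₗ[ℝ] Tan E x, ∀ η Z γ, (η, Z, γ) ∈ L x ↔ Z = π γ :=
    fun x => (hm x).exists_graph
  choose π hπ using hex
  have skew : ∀ (x : M) (α β : Cotan E x), β (π x α) = - α (π x β) := by
    intro x α β
    have h1 := (hL.lagrangian x _).1 ((hπ x 0 _ α).2 rfl) _ ((hπ x 0 _ β).2 rfl)
    simp only [cpair, map_zero, zero_sub, neg_eq_zero] at h1
    linarith
  obtain ⟨t, ht⟩ := exists_isProj V
  have hsec : ∀ {f : M → ℝ}, ContMDiff 𝓘(ℝ, E) 𝓘(ℝ, ℝ) ∞ f → ∃ σ : ∀ x : M, CFib 𝔡 E x,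
      IsSmoothAlong 𝓘(ℝ, E) (fun x : M => x) σ ∧ (∀ x, σ x ∈ L x) ∧
      (∀ x, (σ x).2.1 = π x (dFun (E := E) f x)) ∧ ∀ x, (σ x).2.2 = dFun f x := by
    intro f hf
    obtain ⟨σ, h1, h2⟩ := exists_isSmoothAlong_proj hm hL.subbundle hV ht (zero_mem V) hf
    refine ⟨σ, h1, fun x => (h2 x).1, fun x => ?_, fun x => (h2 x).2.2⟩
    rw [← (h2 x).2.2]
    exact (hπ x (σ x).1 (σ x).2.1 (σ x).2.2).1 (h2 x).1
  refine ⟨π, ⟨skew, ?_, ?_⟩, hπ⟩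
  · intro f g hf hg
    obtain ⟨σ, h1, -, h2, -⟩ := hsec hf
    simp only [← h2]
    exact fun x => contMDiffAt_dFun_field (h1.tangent x) hg
  · intro f g h hf hg hh br x
    obtain ⟨σ₁, s₁, m₁, v₁, d₁⟩ := hsec hf
    obtain ⟨σ₂, s₂, m₂, v₂, d₂⟩ := hsec hg
    obtain ⟨σ₃, s₃, m₃, v₃, d₃⟩ := hsec hh
    have h0 := hL.courantTri_eq_zero s₁ s₂ m₁ m₂ (m₃ x)
    rw [courantTri_of_exact (isSmoothAlong_iff.1 s₁ _) (isSmoothAlong_iff.1 s₂ _) hf hg hh d₁ d₂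
      d₃] at h0
    have z : ∀ ξ : 𝔡, ξ = 0 := fun ξ => Subsingleton.elim ξ 0
    have z' : ∀ (ξ : 𝔡) (σ : ∀ x : M, CFib 𝔡 E x) (X : Tan E x),
        dFun (fun x => K.form ξ (σ x).1) x X = 0 := by
      intro ξ σ X
      refine dFun_eq_zero_of_eventually (Eventually.of_forall fun y => ?_) X
      rw [z ξ, map_zero, LinearMap.zero_apply]
    -- The terms involving the metric of `𝔡` vanish. The three left are iterated brackets, and the
    -- skew symmetry `br h f = - br f h` matches them with the Jacobi identity.
    rw [z', z', z', z (σ₃ x).1, map_zero] at h0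
    have hbr : br h f = fun y => - br f h y := funext fun y => skew y _ _
    have e1 : br f (br g h) x = dFun (fun x => dFun h x (σ₂ x).2.1) x (σ₁ x).2.1 := by
      simp only [br, v₁, v₂]
    have e2 : br g (br h f) x = - dFun (fun x => dFun h x (σ₁ x).2.1) x (σ₂ x).2.1 := by
      rw [hbr]
      refine (dFun_neg x _).trans ?_
      simp only [br, v₁, v₂]
    have e3 : br h (br f g) x = dFun (fun x => dFun g x (σ₁ x).2.1) x (σ₃ x).2.1 := by
      simp only [br, v₁, v₃]
    rw [e1, e2, e3]
    linarith

end Poisson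

/-! ### The composed relations in terms of points and vectors of `P`. -/

section Relation

variable {EM : Type*} [NormedAddCommGroup EM] [NormedSpace ℝ EM]
  {M : Type*} [TopologicalSpace M] [ChartedSpace EM M]
  {EP : Type*} [NormedAddCommGroup EP] [NormedSpace ℝ EP]
  {P : Type*} [TopologicalSpace P] [ChartedSpace EP P]
  {Er : Type*} [NormedAddCommGroup Er] [NormedSpace ℝ Er]
  {Mr : Type*} [TopologicalSpace Mr] [ChartedSpace Er Mr]

lemma mem_stdLift {f : P → M} {p : P} {U : Tan EP p} {α : Cotan EP p} {y : GenTan EM M} :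
    ((⟨p, U, α⟩, y) : GenTan EP P × GenTan EM M) ∈ stdLift EP EM f ↔
      ∃ β : Cotan EM (f p), β.comp (dMap EP EM f p) = α ∧ y = ⟨f p, dMap EP EM f p U, β⟩ := by
  constructor
  · rintro ⟨p', U', β, h⟩
    obtain ⟨h1, h2⟩ := Prod.mk.inj h
    obtain rfl : p = p' := congrArg Sigma.fst h1
    obtain ⟨rfl, rfl⟩ := Prod.mk.inj (eq_of_heq (Sigma.mk.inj h1).2)
    exact ⟨β, rfl, h2⟩
  · rintro ⟨β, rfl, rfl⟩
    exact ⟨p, U, β, rfl⟩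

lemma mem_relOne {iM : P → M} {qM : P → Mr} {y : GenTan EM M} {z : GenTan Er Mr} :
    (y, z) ∈ relOne EM EP Er iM qM ↔ ∃ (p : P) (U : Tan EP p) (β : Cotan EM (iM p))
      (γ : Cotan Er (qM p)), β.comp (dMap EP EM iM p) = γ.comp (dMap EP Er qM p) ∧
      y = ⟨iM p, dMap EP EM iM p U, β⟩ ∧ z = ⟨qM p, dMap EP Er qM p U, γ⟩ := by
  constructor
  · rintro ⟨⟨p, U, α⟩, h1, h2⟩
    obtain ⟨β, h3, h4⟩ := mem_stdLift.1 h1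
    obtain ⟨γ, h5, h6⟩ := mem_stdLift.1 h2
    exact ⟨p, U, β, γ, h3.trans h5.symm, h4, h6⟩
  · rintro ⟨p, U, β, γ, h1, h2, h3⟩
    exact ⟨⟨p, U, β.comp (dMap EP EM iM p)⟩, mem_stdLift.2 ⟨β, rfl, h2⟩, mem_stdLift.2 ⟨γ, h1.symm, h3⟩⟩

lemma mem_relTwo {𝔡 : Type*} [LieRing 𝔡] [LieAlgebra ℝ 𝔡] {K : InvariantMetric 𝔡}
    {𝔠 : LieSubalgebra ℝ 𝔡} {N S Nr : Type*} {iN : S → N} {qN : S → Nr} {y : 𝔡 × N}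
    {z : K.Reduced 𝔠 × Nr} : (y, z) ∈ relTwo K 𝔠 iN qN ↔
      ∃ (ξ : 𝔠) (s : S), y = ((ξ : 𝔡), iN s) ∧ z = (K.toReduced 𝔠 ξ, qN s) := by
  constructor
  · rintro ⟨⟨ξ, h1⟩, s, h2, h3⟩
    obtain ⟨h4, h5⟩ := Prod.mk.inj h1
    exact ⟨ξ, s, Prod.ext h4 h2.symm, Prod.ext h5 h3.symm⟩
  · rintro ⟨ξ, s, rfl, rfl⟩
    exact ⟨⟨ξ, rfl⟩, s, rfl, rfl⟩

lemma mem_reducedRel {𝔡 : Type*} [LieRing 𝔡] [LieAlgebra ℝ 𝔡] {K : InvariantMetric 𝔡}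
    {𝔠 : LieSubalgebra ℝ 𝔡} {N S Nr : Type*} {iN : S → N} {qN : S → Nr} {iM : P → M} {qM : P → Mr}
    {R : SetRel (GenTan EM M) (𝔡 × N)} {x : GenTan Er Mr} {z : K.Reduced 𝔠 × Nr} :
    (x, z) ∈ reducedRel K R 𝔠 EP Er iN qN iM qM ↔
      ∃ (p : P) (U : Tan EP p) (β : Cotan EM (iM p)) (γ : Cotan Er (qM p)) (ξ : 𝔠) (s : S),
      β.comp (dMap EP EM iM p) = γ.comp (dMap EP Er qM p) ∧
      ((⟨iM p, dMap EP EM iM p U, β⟩, ((ξ : 𝔡), iN s)) : GenTan EM M × (𝔡 × N)) ∈ R ∧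
      x = ⟨qM p, dMap EP Er qM p U, γ⟩ ∧ z = (K.toReduced 𝔠 ξ, qN s) := by
  constructor
  · rintro ⟨b, ⟨a, h1, h2⟩, h3⟩
    obtain ⟨p, U, β, γ, h4, rfl, h5⟩ := mem_relOne.1 h1
    obtain ⟨ξ, s, rfl, h6⟩ := mem_relTwo.1 h3
    exact ⟨p, U, β, γ, ξ, s, h4, h2, h5, h6⟩
  · rintro ⟨p, U, β, γ, ξ, s, h1, h2, h3, h4⟩
    exact ⟨_, ⟨_, mem_relOne.2 ⟨p, U, β, γ, h1, rfl, h3⟩, h2⟩, mem_relTwo.2 ⟨ξ, s, rfl, h4⟩⟩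

end Relation

/-! ### From reductive data to the conditions on `S` and `P`, and the induced map. -/

section Map

variable {𝔡 : Type*} [LieRing 𝔡] [LieAlgebra ℝ 𝔡] [Module.Finite ℝ 𝔡]
  {K : InvariantMetric 𝔡} {𝔥 : LieSubalgebra ℝ 𝔡}
  {EN : Type*} [NormedAddCommGroup EN] [NormedSpace ℝ EN] [FiniteDimensional ℝ EN]
  {N : Type*} [TopologicalSpace N] [T2Space N] [ChartedSpace EN N] [IsManifold 𝓘(ℝ, EN) ∞ N]
  {EM : Type*} [NormedAddCommGroup EM] [NormedSpace ℝ EM] [FiniteDimensional ℝ EM]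
  {M : Type*} [TopologicalSpace M] [T2Space M] [ChartedSpace EM M] [IsManifold 𝓘(ℝ, EM) ∞ M]
  {ES : Type*} [NormedAddCommGroup ES] [NormedSpace ℝ ES] [FiniteDimensional ℝ ES]
  {S : Type*} [TopologicalSpace S] [ChartedSpace ES S] [IsManifold 𝓘(ℝ, ES) ∞ S]
  {EP : Type*} [NormedAddCommGroup EP] [NormedSpace ℝ EP] [FiniteDimensional ℝ EP]
  {P : Type*} [TopologicalSpace P] [ChartedSpace EP P] [IsManifold 𝓘(ℝ, EP) ∞ P]
  {ENr : Type*} [NormedAddCommGroup ENr] [NormedSpace ℝ ENr] [FiniteDimensional ℝ ENr]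
  {Nr : Type*} [TopologicalSpace Nr] [T2Space Nr] [ChartedSpace ENr Nr] [IsManifold 𝓘(ℝ, ENr) ∞ Nr]
  {EMr : Type*} [NormedAddCommGroup EMr] [NormedSpace ℝ EMr] [FiniteDimensional ℝ EMr]
  {Mr : Type*} [TopologicalSpace Mr] [T2Space Mr] [ChartedSpace EMr Mr]
  [IsManifold 𝓘(ℝ, EMr) ∞ Mr]
  {A : CourantAction K EN N} {μ : M → N} {R : SetRel (GenTan EM M) (𝔡 × N)}
  {𝔠 : LieSubalgebra ℝ 𝔡} {iN : S → N} {qN : S → Nr} {iM : P → M} {qM : P → Mr}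

lemma IsManinFibre.eq_of_mem {V : Submodule ℝ 𝔡} {L : Submodule ℝ (𝔡 × EM × (EM →L[ℝ] ℝ))}
    (hL : IsManinFibre K V L) {ξ : 𝔡} {X Y : EM} {α : EM →L[ℝ] ℝ} (hX : (ξ, X, α) ∈ L)
    (hY : (ξ, Y, α) ∈ L) : X = Y := by
  have h := sub_mem hX hY
  rw [Prod.mk_sub_mk, Prod.mk_sub_mk, sub_self, sub_self] at h
  exact sub_eq_zero.1 (hL.ker _ h)

lemma field_congr (A : CourantAction K EN N) (ξ : 𝔡) {n n' : N} (h : n = n') :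
    (A.field ξ n : EN) = A.field ξ n' := by
  subst h
  rfl

lemma IsManinMorphism.isManinFibre (hR : IsManinMorphism A 𝔥 μ R)
    {L : ∀ m : M, Submodule ℝ (CFib 𝔡 EM m)} (hL : IsDiracAlongGraph A μ L)
    (hmem : ∀ (m : M) (X : Tan EM m) (α : Cotan EM m) (ξ : 𝔡) (n : N),
      ((⟨m, X, α⟩, (ξ, n)) : GenTan EM M × (𝔡 × N)) ∈ R ↔ n = μ m ∧ (ξ, X, α) ∈ L m) (x : M) :
    IsManinFibre (E := EM) K 𝔥.toSubmodule (L x) where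
  lagrangian := hL.lagrangian x
  image ξ X h := hR.image_tangent x X ξ (μ x) ((hmem x X 0 ξ (μ x)).2 ⟨rfl, h⟩)
  ker X h := hR.ker_tangent x X (μ x) ((hmem x X 0 0 (μ x)).2 ⟨rfl, h⟩)

namespace IsReductiveData

variable (hred : IsReductiveData ES EP ENr EMr A 𝔥 μ R 𝔠 iN qN iM qM)

include hred

lemma isReductiveBase : IsReductiveBase ES ENr A 𝔠 iN qN where
  coisotropic := hred.coisotropic
  immersion := hred.embedding_N.isImmersion
  invariant := hred.invariant
  foliation := hred.foliation_N

lemma exists_restrict : ∃ φ : P → S, ∀ p, iN (φ p) = μ (iM p) := by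
  have h : ∀ p, ∃ s, iN s = μ (iM p) := fun p => by
    have h1 : iM p ∈ μ ⁻¹' range iN := hred.range_M ▸ mem_range_self p
    exact h1
  choose φ hφ using h
  exact ⟨φ, hφ⟩

/-- Continuity comes from `iN` being a topological embedding; given that, smoothness can be tested
after the immersion `iN`. -/
lemma contMDiff_restrict (hμ : ContMDiff 𝓘(ℝ, EM) 𝓘(ℝ, EN) ∞ μ) {φ : P → S}
    (hφ : ∀ p, iN (φ p) = μ (iM p)) : ContMDiff 𝓘(ℝ, EP) 𝓘(ℝ, ES) ∞ φ := by
  have hiM : ContMDiff 𝓘(ℝ, EP) 𝓘(ℝ, EM) ∞ iM := fun p =>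
    (hred.embedding_M.isImmersion.isImmersionAt p).contMDiffAt
  have h1 : ContMDiff 𝓘(ℝ, EP) 𝓘(ℝ, EN) ∞ (iN ∘ φ) := by
    have h2 : iN ∘ φ = μ ∘ iM := funext hφ
    rw [h2]
    exact hμ.comp hiM
  have h2 : Continuous φ := hred.embedding_N.isEmbedding.continuous_iff.2 h1.continuous
  exact fun p => (ContMDiffAt.iff_comp_isImmersionAt
    (hred.embedding_N.isImmersion.isImmersionAt (φ p))).2 ⟨h2.continuousAt, h1 p⟩

/-- The action of `𝔠 ∩ 𝔥` corresponds to that of `𝔠` under `P → S`. -/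
lemma dMap_restrict_eq {L : ∀ m : M, Submodule ℝ (CFib 𝔡 EM m)} (hL : IsDiracAlongGraph A μ L)
    (hμ : ContMDiff 𝓘(ℝ, EM) 𝓘(ℝ, EN) ∞ μ) {φ : P → S} (hφ : ∀ p, iN (φ p) = μ (iM p))
    {p : P} {ξ : 𝔡} {U : Tan EP p} {α : Cotan EM (iM p)}
    (h : (ξ, dMap EP EM iM p U, α) ∈ L (iM p)) :
    dMap ES EN iN (φ p) (dMap EP ES φ p U) = A.field ξ (iN (φ p)) := by
  have h1 : MDifferentiableAt 𝓘(ℝ, EP) 𝓘(ℝ, ES) φ p :=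
    (hred.contMDiff_restrict hμ hφ p).mdifferentiableAt (by simp)
  have h2 : MDifferentiableAt 𝓘(ℝ, ES) 𝓘(ℝ, EN) iN (φ p) :=
    hred.isReductiveBase.mdifferentiableAt_i (φ p)
  have h3 : MDifferentiableAt 𝓘(ℝ, EP) 𝓘(ℝ, EM) iM p :=
    (hred.embedding_M.isImmersion.isImmersionAt p).contMDiffAt.mdifferentiableAt (by simp)
  have h4 : MDifferentiableAt 𝓘(ℝ, EM) 𝓘(ℝ, EN) μ (iM p) := (hμ _).mdifferentiableAt (by simp)
  have h5 : (iN ∘ φ) = μ ∘ iM := funext hφ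
  have h6 : (mfderiv 𝓘(ℝ, EP) 𝓘(ℝ, EN) (iN ∘ φ) p : EP →L[ℝ] EN) =
      mfderiv 𝓘(ℝ, EP) 𝓘(ℝ, EN) (μ ∘ iM) p := by rw [h5]
  have h7 := (mfderiv_comp p h2 h1).symm.trans (h6.trans (mfderiv_comp p h4 h3))
  have h8 := hL.anchor hμ h
  exact ((DFunLike.congr_fun h7 U).trans h8).trans (field_congr A ξ (hφ p)).symm

lemma isReductiveMoment (h𝔥 : K.IsLagrangian 𝔥.toSubmodule) (hR : IsManinMorphism A 𝔥 μ R)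
    {L : ∀ m : M, Submodule ℝ (CFib 𝔡 EM m)} (hL : IsDiracAlongGraph A μ L)
    (hμ : ContMDiff 𝓘(ℝ, EM) 𝓘(ℝ, EN) ∞ μ)
    (hmem : ∀ (m : M) (X : Tan EM m) (α : Cotan EM m) (ξ : 𝔡) (n : N),
      ((⟨m, X, α⟩, (ξ, n)) : GenTan EM M × (𝔡 × N)) ∈ R ↔ n = μ m ∧ (ξ, X, α) ∈ L m) :
    IsReductiveMoment K EP EMr 𝔥 𝔠 L iM qM := by
  have hman := hR.isManinFibre hL hmem
  obtain ⟨φ, hφ⟩ := hred.exists_restrict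
  have hfields : momentFields R μ (𝔥.toSubmodule ⊓ K.perp 𝔠.toSubmodule) EP iM =
      tangentFields L (𝔥.toSubmodule ⊓ K.perp 𝔠.toSubmodule) EP iM := by
    ext v
    refine exists_congr fun ξ => and_congr_right fun _ => forall_congr' fun p => ?_
    rw [hmem]
    exact and_iff_right rfl
  have hfol := hred.foliation_M
  rw [hfields] at hfol
  have himm : ∀ p, Function.Injective (dMap EP EM iM p) := fun p =>
    dMap_injective (hred.embedding_M.isImmersion.isImmersionAt p)
  have htan : ∀ p, ∀ e ∈ L (iM p), e.1 ∈ 𝔠 → ∃ U, dMap EP EM iM p U = e.2.1 := by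
    intro p e he hc
    obtain ⟨w, hw⟩ := hred.invariant e.1 hc (φ p)
    -- Since `dμ X = ρ ξ` is tangent to `S` for `ξ ∈ 𝔠`, the clean intersection makes `X` tangent to
    -- `P`.
    refine (hred.clean p (φ p) (hφ p) e.2.1).2 ⟨w, ?_⟩
    have h1 := field_congr A e.1 (hφ p)
    have h2 := hL.anchor hμ he
    exact Eq.trans hw (h1.trans h2.symm)
  refine ⟨h𝔥, hred.coisotropic, hman, hL.subbundle,
    fun σ₁ σ₂ s₁ s₂ m₁ m₂ m e₃ h₃ => hL.courantTri_eq_zero s₁ s₂ m₁ m₂ h₃,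
    hred.embedding_M.isImmersion, fun p => ⟨himm p, htan p, ?_⟩, hfol⟩
  intro w hw hwc U hU
  have hex : ∀ x : P, ∃ V : Tan EP x, (w, dMap EP EM iM x V, 0) ∈ L (iM x) := by
    intro x
    obtain ⟨X, hX⟩ := (hman (iM x)).exists_mem_of_mem h𝔥 hw
    obtain ⟨V, hV⟩ := htan x _ hX (hred.coisotropic hwc)
    exact ⟨V, by rw [hV]; exact hX⟩
  choose v hv using hex
  -- The action of `w` is a field `v` on all of `P`, and its value at `p` is `U` because `w`
  -- determines its vector in `L`.
  refine (hfol.vertical p U).2 ⟨v, ⟨w, ⟨hw, hwc⟩, hv⟩, himm p ?_⟩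
  exact (hman (iM p)).eq_of_mem (hv p) hU

/-- `P → S` maps the leaves of `P` to the leaves of `S`. -/
lemma restrict_eq_of_eq {L : ∀ m : M, Submodule ℝ (CFib 𝔡 EM m)} (hL : IsDiracAlongGraph A μ L)
    (hμ : ContMDiff 𝓘(ℝ, EM) 𝓘(ℝ, EN) ∞ μ)
    (hr : IsReductiveMoment K EP EMr 𝔥 𝔠 L iM qM) {φ : P → S}
    (hφ : ∀ p, iN (φ p) = μ (iM p)) {p p' : P} (h : qM p = qM p') : qN (φ p) = qN (φ p') := by
  have hb := hred.isReductiveBase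
  induction (hr.foliation.fibres p p').1 h with
  | rel x y hxy =>
    obtain ⟨v, ⟨w, hw, hwv⟩, c, hc, rfl, rfl⟩ := hxy
    -- The image under `φ` of an integral curve for `w ∈ 𝔥 ∩ 𝔠ᗮ` is an integral curve on `S` for the
    -- same `w`, now as an element of `𝔠ᗮ`.
    refine (hred.foliation_N.fibres _ _).2 (Relation.EqvGen.rel _ _
      ⟨fun s => hb.restrict s ⟨w, hred.coisotropic hw.2⟩,
        ⟨w, hw.2, fun s => hb.dMap_restrict s ⟨w, hred.coisotropic hw.2⟩⟩, φ ∘ c, ?_, rfl, rfl⟩)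
    intro r hr'
    have h1 : dMap EP ES φ (c r) (v (c r)) = hb.restrict (φ (c r)) ⟨w, hred.coisotropic hw.2⟩ :=
      hb.eq_restrict (hred.dMap_restrict_eq hL hμ hφ (hwv (c r)))
    have h2 := (((hred.contMDiff_restrict hμ hφ (c r)).mdifferentiableAt
      (by simp)).hasMFDerivAt).comp_hasMFDerivWithinAt r (hc r hr')
    have key : ∀ (l : EP →L[ℝ] ES) (a : EP) (b : ES), l a = b →
        l.comp ((1 : ℝ →L[ℝ] ℝ).smulRight a) = (1 : ℝ →L[ℝ] ℝ).smulRight b := by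
      rintro l a _ rfl
      ext
      simp
    have h3 := key _ _ _ h1
    exact Eq.mp (congrArg (HasMFDerivWithinAt 𝓘(ℝ, ℝ) 𝓘(ℝ, ES) (φ ∘ c) (Icc 0 1) r) h3) h2
  | refl x => rfl
  | symm x y hxy ih => exact (ih ((hr.foliation.fibres _ _).2 hxy)).symm
  | trans x y z hxy hyz ih1 ih2 =>
    exact (ih1 ((hr.foliation.fibres _ _).2 hxy)).trans (ih2 ((hr.foliation.fibres _ _).2 hyz))

end IsReductiveData

lemma contMDiff_of_comp {q : P → Mr} (hq : Manifold.IsSubmersion 𝓘(ℝ, EP) 𝓘(ℝ, EMr) ∞ q)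
    (hs : Function.Surjective q) {u : Mr → Nr} (hu : ContMDiff 𝓘(ℝ, EP) 𝓘(ℝ, ENr) ∞ (u ∘ q)) :
    ContMDiff 𝓘(ℝ, EMr) 𝓘(ℝ, ENr) ∞ u := by
  intro x
  obtain ⟨p, rfl⟩ := hs x
  obtain ⟨O, j, hO, hpO, hj, hjp, hqj⟩ := exists_local_section (hq.isSubmersionAt p)
  have hj' : ContMDiffAt 𝓘(ℝ, EMr) 𝓘(ℝ, EP) ∞ j (q p) := hj.contMDiffAt (hO.mem_nhds hpO)
  refine (hu.contMDiffAt.comp (q p) hj').congr_of_eventuallyEq ?_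
  filter_upwards [hO.mem_nhds hpO] with y hy
  exact (congrArg u (hqj y hy)).symm

end Map

end

/-! ### The reduction theorem. -/

theorem theorem3
    -- a quadratic Lie algebra `𝔡`, a Lagrangian subalgebra `𝔥`
    {𝔡 : Type*} [LieRing 𝔡] [LieAlgebra ℝ 𝔡] [Module.Finite ℝ 𝔡]
    (K : InvariantMetric 𝔡) (𝔥 : LieSubalgebra ℝ 𝔡) (h𝔥 : K.IsLagrangian 𝔥.toSubmodule)
    -- the manifolds `N` and `M`
    {EN : Type*} [NormedAddCommGroup EN] [NormedSpace ℝ EN] [FiniteDimensional ℝ EN]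
    {N : Type*} [TopologicalSpace N] [T2Space N] [SecondCountableTopology N]
    [ChartedSpace EN N] [IsManifold 𝓘(ℝ, EN) ∞ N]
    {EM : Type*} [NormedAddCommGroup EM] [NormedSpace ℝ EM] [FiniteDimensional ℝ EM]
    {M : Type*} [TopologicalSpace M] [T2Space M] [SecondCountableTopology M]
    [ChartedSpace EM M] [IsManifold 𝓘(ℝ, EM) ∞ M]
    -- the manifolds `S` and `P = μ⁻¹(S)`
    {ES : Type*} [NormedAddCommGroup ES] [NormedSpace ℝ ES] [FiniteDimensional ℝ ES]
    {S : Type*} [TopologicalSpace S] [ChartedSpace ES S] [IsManifold 𝓘(ℝ, ES) ∞ S]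
    {EP : Type*} [NormedAddCommGroup EP] [NormedSpace ℝ EP] [FiniteDimensional ℝ EP]
    {P : Type*} [TopologicalSpace P] [ChartedSpace EP P] [IsManifold 𝓘(ℝ, EP) ∞ P]
    -- the quotient manifolds `Nr = N_{𝔠,S}` and `Mr = M_{𝔠,S}`
    {ENr : Type*} [NormedAddCommGroup ENr] [NormedSpace ℝ ENr] [FiniteDimensional ℝ ENr]
    {Nr : Type*} [TopologicalSpace Nr] [T2Space Nr]
    [ChartedSpace ENr Nr] [IsManifold 𝓘(ℝ, ENr) ∞ Nr]
    {EMr : Type*} [NormedAddCommGroup EMr] [NormedSpace ℝ EMr] [FiniteDimensional ℝ EMr]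
    {Mr : Type*} [TopologicalSpace Mr] [T2Space Mr]
    [ChartedSpace EMr Mr] [IsManifold 𝓘(ℝ, EMr) ∞ Mr]
    -- the action Courant algebroid `𝔡 × N` and a morphism of Manin pairs
    (A : CourantAction K EN N) (μ : M → N) (R : SetRel (GenTan EM M) (𝔡 × N))
    (hR : IsManinMorphism A 𝔥 μ R)
    -- reductive data
    (𝔠 : LieSubalgebra ℝ 𝔡) (iN : S → N) (qN : S → Nr) (iM : P → M) (qM : P → Mr)
    (hred : IsReductiveData ES EP ENr EMr A 𝔥 μ R 𝔠 iN qN iM qM) :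
    -- `𝔥_𝔠` is a Lagrangian subalgebra of `𝔡_𝔠`
    (K.reduce 𝔠).IsLagrangian (K.reduceSubalgebra 𝔠 𝔥).toSubmodule ∧
    -- the action of `𝔠` on `S` descends to `𝔡_𝔠` and `N_{𝔠,S}`, with coisotropic stabilizers
    ∃ A' : CourantAction (K.reduce 𝔠) ENr Nr,
      (∀ (ξ : 𝔠) (s : S) (w : Tan ES s), dMap ES EN iN s w = A.field ξ (iN s) →
        dMap ES ENr qN s w = A'.field (K.toReduced 𝔠 ξ) (qN s)) ∧
      -- `μ` descends to `M_{𝔠,S} → N_{𝔠,S}`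
      ∃ μ' : Mr → Nr, (∀ (p : P) (s : S), iN s = μ (iM p) → μ' (qM p) = qN s) ∧
        -- `R_{𝔠,S}` is a morphism of Manin pairs over the induced map
        IsManinMorphism A' (K.reduceSubalgebra 𝔠 𝔥) μ' (reducedRel K R 𝔠 EP EMr iN qN iM qM) ∧
        -- if `𝔠` is Lagrangian, `R_{𝔠,S}` is the graph of a Poisson structure on `M_{𝔠,S}`
        (K.IsLagrangian 𝔠.toSubmodule →
          ∃ π : ∀ x : Mr, Cotan EMr x →ₗ[ℝ] Tan EMr x, IsPoisson π ∧
            ∀ (x : Mr) (Z : Tan EMr x) (γ : Cotan EMr x) (η : K.Reduced 𝔠) (n : Nr),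
              ((⟨x, Z, γ⟩, (η, n)) : GenTan EMr Mr × (K.Reduced 𝔠 × Nr)) ∈
                reducedRel K R 𝔠 EP EMr iN qN iM qM ↔ η = 0 ∧ n = μ' x ∧ Z = π x γ) := by
  obtain ⟨⟨hμ, L, hL, hmem⟩, -, -⟩ := id hR
  have hb := hred.isReductiveBase
  have hr := hred.isReductiveMoment h𝔥 hR hL hμ hmem
  have h𝔥' := isLagrangian_reduceSubalgebra h𝔥 hred.coisotropic
  obtain ⟨φ, hφ⟩ := hred.exists_restrict
  have hinj : Function.Injective iN := hred.embedding_N.isEmbedding.injective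
  -- The chosen preimage does not matter, because `φ` maps leaves into leaves.
  let μ' : Mr → Nr := fun x => qN (φ (Function.surjInv hr.foliation.surjective x))
  have hμ'q : ∀ p, μ' (qM p) = qN (φ p) := fun p =>
    hred.restrict_eq_of_eq hL hμ hr hφ (Function.surjInv_eq hr.foliation.surjective (qM p))
  have hφs : ContMDiff 𝓘(ℝ, EP) 𝓘(ℝ, ES) ∞ φ := hred.contMDiff_restrict hμ hφ
  have hqN : ContMDiff 𝓘(ℝ, ES) 𝓘(ℝ, ENr) ∞ qN := fun s =>
    (hb.foliation.submersion.isSubmersionAt s).contMDiffAt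
  have hμ'φ : μ' ∘ qM = qN ∘ φ := funext hμ'q
  have hμ' : ContMDiff 𝓘(ℝ, EMr) 𝓘(ℝ, ENr) ∞ μ' :=
    contMDiff_of_comp hr.foliation.submersion hr.foliation.surjective (by
      rw [hμ'φ]
      exact hqN.comp hφs)
  -- For an element coming from `(ξ, i U, α) ∈ L`, the vector `dφ U` is the action of `ξ` on `S`;
  -- differentiating `μ' ∘ qM = qN ∘ φ` carries this to the quotients.
  have hanchor : ∀ (x : Mr), ∀ e ∈ hr.reduction x,
      dMap EMr ENr μ' x e.2.1 = hb.reducedAction.anchor (μ' x) e.1 := by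
    intro x
    obtain ⟨p, rfl⟩ := hr.foliation.surjective x
    rw [hr.reduction_apply p]
    rintro ⟨_, _, γ⟩ ⟨ξ, U, α, rfl, rfl, h1, h2⟩
    have h3 := hb.dMap_q_eq ξ (hred.dMap_restrict_eq hL hμ hφ h2)
    have h4 : (mfderiv 𝓘(ℝ, EP) 𝓘(ℝ, ENr) (μ' ∘ qM) p : EP →L[ℝ] ENr) =
      mfderiv 𝓘(ℝ, EP) 𝓘(ℝ, ENr) (qN ∘ φ) p := by rw [hμ'φ]
    have h5 := (mfderiv_comp p ((hμ' (qM p)).mdifferentiableAt (by simp))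
      (hr.mdifferentiableAt_q p)).symm.trans (h4.trans (mfderiv_comp p
      (hb.mdifferentiableAt_q (φ p)) ((hφs p).mdifferentiableAt (by simp))))
    have h6 := field_congr hb.reducedAction (K.toReduced 𝔠 ξ) (hμ'q p)
    exact ((DFunLike.congr_fun h5 U).trans h3).trans h6.symm
  have hmem' : ∀ (x : Mr) (Z : Tan EMr x) (γ : Cotan EMr x) (η : K.Reduced 𝔠) (n : Nr),
      ((⟨x, Z, γ⟩, (η, n)) : GenTan EMr Mr × (K.Reduced 𝔠 × Nr)) ∈
        reducedRel K R 𝔠 EP EMr iN qN iM qM ↔ n = μ' x ∧ (η, Z, γ) ∈ hr.reduction x := by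
    intro x Z γ η n
    rw [mem_reducedRel]
    constructor
    · rintro ⟨p, U, β, γ', ξ, s, h1, h2, h3, h4⟩
      obtain rfl : x = qM p := congrArg Sigma.fst h3
      obtain ⟨rfl, rfl⟩ := Prod.mk.inj (eq_of_heq (Sigma.mk.inj h3).2)
      obtain ⟨rfl, rfl⟩ := Prod.mk.inj h4
      obtain ⟨h5, h6⟩ := (hmem _ _ _ _ _).1 h2
      -- The support of `R` on the graph of `μ` forces `iN s = μ (iM p)`, which determines `s`.
      obtain rfl : s = φ p := hinj (h5.trans (hφ p).symm)
      refine ⟨(hμ'q p).symm, ?_⟩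
      rw [hr.reduction_apply p]
      exact ⟨ξ, U, β, rfl, rfl, h1, h6⟩
    · obtain ⟨p, rfl⟩ := hr.foliation.surjective x
      rw [hr.reduction_apply p]
      rintro ⟨rfl, ξ, U, β, rfl, rfl, h1, h2⟩
      exact ⟨p, U, β, γ, ξ, φ p, h1, (hmem _ _ _ _ _).2 ⟨hφ p, h2⟩, rfl,
        Prod.ext rfl (hμ'q p)⟩
  have hman' := hr.isManinFibre_reduction
  have hdirac := hr.isDiracAlongGraph hb.reducedAction hμ' hanchor
  refine ⟨h𝔥', hb.reducedAction, fun ξ s w hw => hb.dMap_q_eq ξ hw, μ', fun p s hs => ?_,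
    ⟨⟨hμ', hr.reduction, hdirac, hmem'⟩, ?_, ?_⟩, fun h𝔠 => ?_⟩
  · rw [hμ'q, hinj (hs.trans (hφ p).symm)]
  · intro x X ξ n h
    exact (hman' x).image ξ X ((hmem' x X 0 ξ n).1 h).2
  · intro x X n h
    exact (hman' x).ker X ((hmem' x X 0 0 n).1 h).2
  · have hsub : ∀ η : K.Reduced 𝔠, η = 0 := by
      intro η
      obtain ⟨ξ, rfl⟩ := K.toReduced_surjective 𝔠 η
      refine (K.toReduced_eq_zero 𝔠).2 ?_
      have h1 : (ξ : 𝔡) ∈ 𝔠.toSubmodule := ξ.2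
      rwa [← h𝔠] at h1
    have : Subsingleton (K.Reduced 𝔠) := ⟨fun a b => (hsub a).trans (hsub b).symm⟩
    obtain ⟨π, hπ, hπ'⟩ := exists_isPoisson hdirac hman' h𝔥'
    refine ⟨π, hπ, fun x Z γ η n => ?_⟩
    rw [hmem', hπ']
    exact (and_iff_right (hsub η)).symm
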